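/- Let $q\in\mathbb C$, $q\neq 0$, be not a root of unity, and fix a square root $q^{1/2}$. For $N\ge 1$ put $n=\lfloor N/2\rfloor$, $i'=N+1-i$, $\rho_i=\frac N2-i$ and $\rho_{i'}=-\rho_i$ for $1\le i\le n$, and $\rho_{n+1}=0$ if $N=2n+1$. Let $\mathcal A$ be the associative unital $\mathbb C$-algebra generated by $x_1,\dots,x_N$ with relations $$x_ix_j=q\,x_jx_i\quad (i<j,\ i\ne j'),\qquad x_{i'}x_i-x_ix_{i'}=\frac{q-q^{-1}}{q^{\rho_i-1}+q^{1-\rho_i}}\sum_{j=i+1}^{(i+1)'}q^{\rho_{j'}}x_jx_{j'}\quad (i<n),$$ $x_{n'}x_n-x_nx_{n'}=(q^{1/2}-q^{-1/2})x_{n+1}^2$ if $N=2n+1$, and $x_{n'}x_n=x_nx_{n'}$ if $N=2n$. The monomials $\mathbf x^\nu=x_1^{\nu_1}\cdots x_N^{\nu_N}$ form a basis of $\mathcal A$; $\mathcal A_m$ is the span of those of degree $m$. Write $[a]=\frac{1-q^a}{1-q}$, $[a]_q=\frac{q^a-q^{-a}}{q-q^{-1}}$, $(a;b)_k=\prod_{i=0}^{k-1}(1-ab^i)$,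 and let $\varepsilon_i$ be the $i$-th unit vector. Linear operators $\partial_i$ on $\mathcal A$ are given by $$\partial_k\mathbf x^\nu=[\nu_k]_q\,q^{\nu_{k+1}+\cdots+\nu_N}\mathbf x^{\nu-\varepsilon_k}\ (k\le n),\qquad \partial_{n+1}\mathbf x^\nu=[\nu_{n+1}]\,q^{\nu_{n+2}+\cdots+\nu_N}\mathbf x^{\nu-\varepsilon_{n+1}}\ (N=2n+1),$$ $$\partial_{k'}\mathbf x^\nu=[\nu_{k'}]_q\,q^{\nu_k+\nu_{k'+1}+\cdots+\nu_N}\mathbf x^{\nu-\varepsilon_{k'}}+\sum_{j=k+1}^n[\nu_j]_q[\nu_{j'}]_q(q-q^{-1})q^{\rho_k-\rho_j+d_{kj}}\mathbf x^{\nu+\varepsilon_k-\varepsilon_j-\varepsilon_{j'}}$$ $$\qquad+[\nu_{n+1}-1][\nu_{n+1}]\frac{q-q^{-1}}{1+q}\,q^{\rho_k+2+e_k}\,\mathbf x^{\nu+\varepsilon_k-2\varepsilon_{n+1}}\qquad(k\le n),$$ where $d_{kj}=\nu_k+\cdots+\nu_{j-1}+\nu_{j'+1}+\cdots+\nu_N$,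 $e_k=\nu_k+\cdots+\nu_N-2\nu_{n+1}$, and the last summand is omitted for $N=2n$. Let $\Delta_q=\sum_{i=1}^Nq^{\rho_i}\partial_i\partial_{i'}$ and let $\mathcal H_m=\{p\in\mathcal A_m:\Delta_qp=0\}$ be the space of homogeneous $q$-harmonic polynomials of degree $m$. Let $Q=\sum_{i=1}^Nq^{\rho_{i'}}x_ix_{i'}$, and let $\tau:\mathcal A\to\mathcal A/(Q-1)$ be the quotient map. Let $h$ be the linear functional on $\mathcal A/(Q-1)$ (which exists) such that $h(\tau\mathbf x^\nu)=0$ unless $\nu_i=\nu_{i'}$ for all $i\le n$ and (for $N=2n+1$) $\nu_{n+1}=2r$ is even, and in that case, with $r=0$ for $N=2n$ and $u=\nu_1+\cdots+\nu_n+r$, $$h(\tau\mathbf x^\nu)=\frac{(q^{-2};q^{-2})_{\nu_1}\cdots(q^{-2};q^{-2})_{\nu_n}\,(q^{-1};q^{-2})_r\,(1+q)^r}{q^{\rho_1\nu_1+\cdots+\rho_n\nu_n+r}\,(1+q^{N-2})^{u}\,(q^{-N};q^{-2})_{u}}.$$ Let $\langle p_1,p_2\rangle=h(\tau(p_1^*p_2))$,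 where $*$ is the involutive anti-automorphism of $\mathcal A$ with $x_i^*=q^{\rho_{i'}}x_{i'}$: it is taken $\mathbb C$-linear for general $q$, and, when $q^{1/2}$ is real, also conjugate-linear. For $j\ge 1$ with $N_j:=N-2(j-1)\ge 3$ put $Q_j=\sum_{i=j}^{j'}q^{\rho_{i'}}x_ix_{i'}$, and for $M\ge a+b$, $l=M-a-b$, put $$t^{N_j,M}_{ab}=\sum_{k=0}^{\min(a,b)}\frac{(q^{-2a};q^2)_k\,(q^{-2b};q^2)_k}{(q^2;q^2)_k\,(q^{-N_j-2M+4};q^2)_k}\;\frac{q^{(1-\frac{N_j}2-2l+2)k}}{(1+q^{N_j-2})^k}\;Q_j^k\,x_j^{a-k}\,x_{j'}^{b-k}.$$ Let $m\ge 0$ and $M_j=m-\sum_{i<j}(m_i+m'_i)$. If $N=2n$ with $n\ge1$, then the products $$\Xi_{\mathbf m,\mathbf m',k}=t^{N,M_1}_{m_1m'_1}\,t^{N-2,M_2}_{m_2m'_2}\cdots t^{4,M_{n-1}}_{m_{n-1}m'_{n-1}}\,t^{2,k},\qquad t^{2,k}=x_n^k\ (k>0),\quad t^{2,0}=1,\quad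 t^{2,k}=x_{n'}^{-k}\ (k<0),$$ where $\mathbf m,\mathbf m'\in\mathbb Z_{\ge0}^{n-1}$ and $k\in\mathbb Z$ run over all values with $\sum_{i=1}^{n-1}(m_i+m'_i)+|k|=m$, form an orthogonal basis of $\mathcal H_m$ with respect to $\langle\cdot,\cdot\rangle$. If $N=2n+1$ with $n\ge0$, then the products $$\Xi_{\mathbf m,\mathbf m',\sigma}=t^{N,M_1}_{m_1m'_1}\,t^{N-2,M_2}_{m_2m'_2}\cdots t^{3,M_n}_{m_nm'_n}\,x_{n+1}^\sigma,$$ where $\mathbf m,\mathbf m'\in\mathbb Z_{\ge0}^{n}$ and $\sigma\in\{0,1\}$ run over all values with $\sum_{i=1}^{n}(m_i+m'_i)+\sigma=m$, form an orthogonal basis of $\mathcal H_m$ with respect to $\langle\cdot,\cdot\rangle$. -/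

import Mathlib

noncomputable section

open scoped BigOperators

/-! Throughout, `s` is a fixed square root of the deformation parameter `q = s ^ 2`, and the
indices `1, …, N` are shifted to `Fin N = {0, …, N - 1}`, so that `i' = N + 1 - i` becomes
`i.rev`.  An unprimed index is one with `i < i.rev`; the middle index (`N` odd) is the one with
`i = i.rev`; the remaining ones are the primed indices. -/

namespace QEuclid

/-- `[a] = (1 - q ^ a) / (1 - q)`. -/
def qBracket (q : ℂ) (a : ℤ) : ℂ := (1 - q ^ a) / (1 - q)

/-- `[a]_q = (q ^ a - q ^ (-a)) / (q - q⁻¹)`. -/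
def qNumber (q : ℂ) (a : ℤ) : ℂ := (q ^ a - q ^ (-a)) / (q - q⁻¹)

/-- The `q`-shifted factorial `(a; b)_k = (1 - a) (1 - a b) ⋯ (1 - a b ^ (k - 1))`. -/
def qPoch (a b : ℂ) (k : ℕ) : ℂ := ∏ i ∈ Finset.range k, (1 - a * b ^ i)

/-- Twice the number `ρ_i`: with 1-based indices, `2 ρ_i = N - 2 i` for unprimed `i`,
`0` for the middle index, and `ρ_{i'} = - ρ_i`.  Hence `q ^ ρ_i = s ^ rho2 i`. -/
def rho2 (N : ℕ) (i : Fin N) : ℤ :=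
  if i < i.rev then (N : ℤ) - 2 * ((i : ℤ) + 1)
  else if i = i.rev then 0
  else 2 * ((i.rev : ℤ) + 1) - (N : ℤ)

/-- The defining relations of the quantum Euclidean space. -/
inductive Rel (N : ℕ) (s : ℂ) : FreeAlgebra ℂ (Fin N) → FreeAlgebra ℂ (Fin N) → Prop
  /-- `x_i x_j = q x_j x_i` for `i < j`, `i ≠ j'`. -/
  | comm (i j : Fin N) (hij : i < j) (hne : i ≠ j.rev) :
      Rel N s (FreeAlgebra.ι ℂ i * FreeAlgebra.ι ℂ j)
        ((s ^ 2) • (FreeAlgebra.ι ℂ j * FreeAlgebra.ι ℂ i))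
  /-- The relation between `x_i` and `x_{i'}` for (1-based) `i < n`, `n = ⌊N / 2⌋`. -/
  | cross (i : Fin N) (hi : (i : ℕ) + 1 < N / 2) :
      Rel N s
        (FreeAlgebra.ι ℂ i.rev * FreeAlgebra.ι ℂ i - FreeAlgebra.ι ℂ i * FreeAlgebra.ι ℂ i.rev)
        (((s ^ 2 - (s ^ 2)⁻¹) / (s ^ (rho2 N i - 2) + s ^ (-rho2 N i + 2))) •
          ∑ j ∈ Finset.Ioo i i.rev,
            (s ^ rho2 N j.rev) • (FreeAlgebra.ι ℂ j * FreeAlgebra.ι ℂ j.rev))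
  /-- `x_{n'} x_n - x_n x_{n'} = (q ^ (1/2) - q ^ (-1/2)) x_{n+1} ^ 2` for `N = 2 n + 1`;
  here `i` is the index `n` and `k` the middle index `n + 1`. -/
  | odd (i k : Fin N) (hk : k = k.rev) (hi : (i : ℕ) + 1 = k) :
      Rel N s
        (FreeAlgebra.ι ℂ i.rev * FreeAlgebra.ι ℂ i - FreeAlgebra.ι ℂ i * FreeAlgebra.ι ℂ i.rev)
        ((s - s⁻¹) • (FreeAlgebra.ι ℂ k) ^ 2)
  /-- `x_{n'} x_n = x_n x_{n'}` for `N = 2 n`; here `i` is the index `n`. -/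
  | even (i : Fin N) (hi : (i : ℕ) + 1 = i.rev) :
      Rel N s (FreeAlgebra.ι ℂ i.rev * FreeAlgebra.ι ℂ i)
        (FreeAlgebra.ι ℂ i * FreeAlgebra.ι ℂ i.rev)

/-- The algebra `𝒜 = ℂ_q[x_1, …, x_N]` of polynomials on the quantum Euclidean space. -/
abbrev QSpace (N : ℕ) (s : ℂ) : Type := RingQuot (Rel N s)

/-- The generators `x_i` of `𝒜`. -/
def gen (N : ℕ) (s : ℂ) (i : Fin N) : QSpace N s :=
  RingQuot.mkAlgHom ℂ (Rel N s) (FreeAlgebra.ι ℂ i)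

/-- The ordered monomial `x ^ ν = x_1 ^ ν_1 x_2 ^ ν_2 ⋯ x_N ^ ν_N`. -/
def mono (N : ℕ) (s : ℂ) (ν : Fin N → ℕ) : QSpace N s :=
  (List.ofFn fun i => gen N s i ^ ν i).prod

/-- The subspace `𝒜_m` of homogeneous polynomials of degree `m`. -/
def homogeneous (N : ℕ) (s : ℂ) (m : ℕ) : Submodule ℂ (QSpace N s) :=
  Submodule.span ℂ {p | ∃ ν : Fin N → ℕ, ∑ i, ν i = m ∧ p = mono N s ν}

/-! ### The `q`-derivatives, the `q`-Laplace operator and harmonic polynomials -/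

/-- The value `∂_k ▹ x ^ ν` of the `q`-derivative `∂_k` on an ordered monomial.  (Whenever an
exponent `ν_j - 1` is truncated, the coefficient vanishes.)  In the third case `k = i'` with `i`
unprimed; the last sum runs over the middle index and is empty for even `N`. -/
def partialMono (N : ℕ) (s : ℂ) (k : Fin N) (ν : Fin N → ℕ) : QSpace N s :=
  if k < k.rev then
    (qNumber (s ^ 2) (ν k) * (s ^ 2) ^ (∑ i ∈ Finset.Ioi k, ν i)) •
      mono N s (ν - Pi.single k 1)
  else if k = k.rev then
    (qBracket (s ^ 2) (ν k) * (s ^ 2) ^ (∑ i ∈ Finset.Ioi k, ν i)) •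
      mono N s (ν - Pi.single k 1)
  else
    (qNumber (s ^ 2) (ν k) * (s ^ 2) ^ (ν k.rev + ∑ i ∈ Finset.Ioi k, ν i)) •
      mono N s (ν - Pi.single k 1)
    + ∑ j : Fin N with k.rev < j ∧ j < j.rev,
        (qNumber (s ^ 2) (ν j) * qNumber (s ^ 2) (ν j.rev) * (s ^ 2 - (s ^ 2)⁻¹)
          * s ^ (rho2 N k.rev - rho2 N j)
          * (s ^ 2) ^ ((∑ i ∈ Finset.Ico k.rev j, ν i) + ∑ i ∈ Finset.Ioi j.rev, ν i)) •
        mono N s (ν + Pi.single k.rev 1 - Pi.single j 1 - Pi.single j.rev 1)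
    + ∑ j : Fin N with j = j.rev,
        (qBracket (s ^ 2) ((ν j : ℤ) - 1) * qBracket (s ^ 2) (ν j)
          * ((s ^ 2 - (s ^ 2)⁻¹) / (1 + s ^ 2))
          * (s ^ rho2 N k.rev * (s ^ 2) ^ 2)
          * (s ^ 2) ^ ((∑ i ∈ Finset.Ici k.rev, (ν i : ℤ)) - 2 * (ν j : ℤ))) •
        mono N s (ν + Pi.single k.rev 1 - Pi.single j 2)

/-- The operator `∂_k` on `𝒜`: the linear operator with the prescribed values on the ordered
monomials.  The argument `B` is used only for the basis of `𝒜` formed by these monomials. -/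
def partialOp {N : ℕ} {s : ℂ} (B : Module.Basis (Fin N → ℕ) ℂ (QSpace N s)) (k : Fin N) :
    QSpace N s →ₗ[ℂ] QSpace N s :=
  B.constr ℂ (partialMono N s k)

/-- The `q`-Laplace operator `Δ_q = ∑_i q ^ ρ_i ∂_i ∂_{i'}`. -/
def laplace {N : ℕ} {s : ℂ} (B : Module.Basis (Fin N → ℕ) ℂ (QSpace N s)) :
    QSpace N s →ₗ[ℂ] QSpace N s :=
  ∑ i : Fin N, (s ^ rho2 N i) • (partialOp B i ∘ₗ partialOp B i.rev)

/-- The space `ℋ_m` of homogeneous `q`-harmonic polynomials of degree `m`. -/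
def harmonic {N : ℕ} {s : ℂ} (B : Module.Basis (Fin N → ℕ) ℂ (QSpace N s)) (m : ℕ) :
    Submodule ℂ (QSpace N s) :=
  homogeneous N s m ⊓ LinearMap.ker (laplace B)

/-! ### Squared radii, the quantum sphere and the invariant functional -/

/-- The squared `q`-radius of the subalgebra generated by the `x_i` with `j ≤ i ≤ j'`
(zero-based `j`); `j = 0` gives `Q = ∑_i q ^ ρ_{i'} x_i x_{i'}`. -/
def qRadius (N : ℕ) (s : ℂ) (j : ℕ) : QSpace N s :=
  ∑ i ∈ Finset.univ.filter (fun i : Fin N => j ≤ i.val ∧ j ≤ i.rev.val),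
    (s ^ rho2 N i.rev) • (gen N s i * gen N s i.rev)

/-- The relation `Q = 1`. -/
def SphereRel (N : ℕ) (s : ℂ) (a b : QSpace N s) : Prop := a = qRadius N s 0 ∧ b = 1

/-- The algebra of functions on the quantum sphere: `𝒜` modulo the relation `Q = 1`. -/
abbrev QSphere (N : ℕ) (s : ℂ) : Type := RingQuot (SphereRel N s)

/-- The restriction homomorphism `τ` from `𝒜` to the functions on the quantum sphere. -/
def restrict (N : ℕ) (s : ℂ) : QSpace N s →ₐ[ℂ] QSphere N s :=
  RingQuot.mkAlgHom ℂ (SphereRel N s)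

/-- The value at the middle index (`0` for even `N`), halved. -/
def halfMid {N : ℕ} (ν : Fin N → ℕ) : ℕ := (∑ i : Fin N with i = i.rev, ν i) / 2

open Classical in
/-- The value of the invariant functional on the restriction of `x ^ ν` to the quantum sphere. -/
def haarValue (N : ℕ) (s : ℂ) (ν : Fin N → ℕ) : ℂ :=
  if (∀ i, ν i = ν i.rev) ∧ (∀ i : Fin N, i = i.rev → Even (ν i)) then
    (∏ i : Fin N with i < i.rev, qPoch ((s ^ 2) ^ (-2 : ℤ)) ((s ^ 2) ^ (-2 : ℤ)) (ν i))
      * qPoch ((s ^ 2)⁻¹) ((s ^ 2) ^ (-2 : ℤ)) (halfMid ν) * (1 + s ^ 2) ^ halfMid ν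
    / (s ^ (∑ i : Fin N with i < i.rev, rho2 N i * (ν i : ℤ)) * (s ^ 2) ^ halfMid ν
      * (1 + (s ^ 2) ^ ((N : ℤ) - 2)) ^ ((∑ i : Fin N with i < i.rev, ν i) + halfMid ν)
      * qPoch ((s ^ 2) ^ (-(N : ℤ))) ((s ^ 2) ^ (-2 : ℤ))
          ((∑ i : Fin N with i < i.rev, ν i) + halfMid ν))
  else 0

/-- `h` is the invariant functional on the quantum sphere. -/
def IsInvariantFunctional {N : ℕ} {s : ℂ} (h : QSphere N s →ₗ[ℂ] ℂ) : Prop :=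
  ∀ ν : Fin N → ℕ, h (restrict N s (mono N s ν)) = haarValue N s ν

/-! ### The `*`-operation and the scalar product

The `*`-operation is constructed as the ring anti-automorphism with `x_i ↦ q ^ ρ_{i'} x_{i'}` that
acts on scalars through a given endomorphism `c` of `ℂ` fixing `s`.  It is used for `c` the complex
conjugation (the conjugate-linear `*`-operation) and for `c` the identity (the linear one). -/

/-- The opposite algebra of `𝒜`, with scalars acting through `c`. -/
def TwistedOp (N : ℕ) (s : ℂ) (_c : ℂ →+* ℂ) : Type := (QSpace N s)ᵐᵒᵖ

instance (N : ℕ) (s : ℂ) (c : ℂ →+* ℂ) : Ring (TwistedOp N s c) :=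
  inferInstanceAs (Ring (QSpace N s)ᵐᵒᵖ)

instance (N : ℕ) (s : ℂ) (c : ℂ →+* ℂ) : Algebra ℂ (TwistedOp N s c) :=
  RingHom.toAlgebra' ((algebraMap ℂ (QSpace N s)ᵐᵒᵖ).comp c)
    (fun z x => Algebra.commutes (A := (QSpace N s)ᵐᵒᵖ) (c z) x)

/-- The identity `𝒜 → 𝒜ᵒᵖ`, as an additive map. -/
def toTw (N : ℕ) (s : ℂ) (c : ℂ →+* ℂ) : QSpace N s →+ TwistedOp N s c :=
  (MulOpposite.opAddEquiv : QSpace N s ≃+ (QSpace N s)ᵐᵒᵖ).toAddMonoidHom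

/-- The `*`-operation on words in the generators. -/
def starFree (N : ℕ) (s : ℂ) (c : ℂ →+* ℂ) : FreeAlgebra ℂ (Fin N) →ₐ[ℂ] TwistedOp N s c :=
  FreeAlgebra.lift ℂ fun i => toTw N s c ((s ^ rho2 N i.rev) • gen N s i.rev)

theorem rho2_rev (N : ℕ) (i : Fin N) : rho2 N i.rev = -rho2 N i := by
  have h1 := Fin.val_rev i
  have h2 := i.isLt
  unfold rho2
  simp only [Fin.rev_rev, Fin.lt_def, Fin.ext_iff, h1]
  split_ifs <;> omega

theorem toTw_mul {N : ℕ} {s : ℂ} (c : ℂ →+* ℂ) (x y : QSpace N s) :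
    toTw N s c x * toTw N s c y = toTw N s c (y * x) := rfl

theorem smul_toTw {N : ℕ} {s : ℂ} (c : ℂ →+* ℂ) (z : ℂ) (x : QSpace N s) :
    z • toTw N s c x = toTw N s c (c z • x) := by
  have h : c z • x = x * algebraMap ℂ (QSpace N s) (c z) := by
    rw [Algebra.smul_def, Algebra.commutes]
  rw [h, Algebra.smul_def]
  rfl

theorem starFree_mul_ι (N : ℕ) (s : ℂ) (c : ℂ →+* ℂ) (i j : Fin N) :
    starFree N s c (FreeAlgebra.ι ℂ i * FreeAlgebra.ι ℂ j) =
      toTw N s c ((s ^ rho2 N j.rev * s ^ rho2 N i.rev) • (gen N s j.rev * gen N s i.rev)) := by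
  rw [starFree, map_mul, FreeAlgebra.lift_ι_apply, FreeAlgebra.lift_ι_apply, toTw_mul,
    smul_mul_smul_comm]

theorem starFree_mul_rev (N : ℕ) (s : ℂ) (c : ℂ →+* ℂ) (hs : s ≠ 0) (i : Fin N) :
    starFree N s c (FreeAlgebra.ι ℂ i * FreeAlgebra.ι ℂ i.rev) =
      toTw N s c (gen N s i * gen N s i.rev) := by
  rw [starFree_mul_ι, Fin.rev_rev, rho2_rev, ← zpow_add₀ hs, add_neg_cancel, zpow_zero, one_smul]

theorem starFree_rev_mul (N : ℕ) (s : ℂ) (c : ℂ →+* ℂ) (hs : s ≠ 0) (i : Fin N) :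
    starFree N s c (FreeAlgebra.ι ℂ i.rev * FreeAlgebra.ι ℂ i) =
      toTw N s c (gen N s i.rev * gen N s i) := by
  have := starFree_mul_rev N s c hs i.rev
  rwa [Fin.rev_rev] at this

theorem starFree_rel (N : ℕ) (s : ℂ) (c : ℂ →+* ℂ) (hs : s ≠ 0) (hc : c s = s)
    (a b : FreeAlgebra ℂ (Fin N)) (h : Rel N s a b) : starFree N s c a = starFree N s c b := by
  have hrel := RingQuot.mkAlgHom_rel ℂ h
  cases h with
  | comm i j hij hne =>
    have h2 : Rel N s _ _ := Rel.comm (s := s) j.rev i.rev (Fin.rev_lt_rev.mpr hij)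
      (by rw [Fin.rev_rev]; exact fun e => hne (by rw [e]))
    have hrel := RingQuot.mkAlgHom_rel ℂ h2
    simp only [map_mul, map_smul] at hrel
    rw [map_smul, starFree_mul_ι, starFree_mul_ι, smul_toTw, map_pow, hc]
    congr 1
    change gen N s j.rev * gen N s i.rev = s ^ 2 • (gen N s i.rev * gen N s j.rev) at hrel
    rw [hrel, smul_smul, smul_smul]
    congr 1
    ring
  | cross i hi =>
    simp only [map_mul, map_smul, map_sub, map_sum] at hrel
    rw [map_sub, starFree_rev_mul N s c hs, starFree_mul_rev N s c hs, map_smul, map_sum]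
    have hsum : ∀ j ∈ Finset.Ioo i i.rev,
        starFree N s c ((s ^ rho2 N j.rev) • (FreeAlgebra.ι ℂ j * FreeAlgebra.ι ℂ j.rev)) =
          toTw N s c ((s ^ rho2 N j.rev) • (gen N s j * gen N s j.rev)) := by
      intro j _
      rw [map_smul, starFree_mul_rev N s c hs, smul_toTw, map_zpow₀, hc]
    rw [Finset.sum_congr rfl hsum, ← map_sum, smul_toTw, ← map_sub]
    have hcc : c ((s ^ 2 - (s ^ 2)⁻¹) / (s ^ (rho2 N i - 2) + s ^ (-rho2 N i + 2))) =
        (s ^ 2 - (s ^ 2)⁻¹) / (s ^ (rho2 N i - 2) + s ^ (-rho2 N i + 2)) := by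
      simp only [map_div₀, map_sub, map_add, map_inv₀, map_pow, map_zpow₀, hc]
    rw [hcc]
    exact congrArg (toTw N s c) hrel
  | odd i k hk hi =>
    simp only [map_mul, map_smul, map_sub, map_pow] at hrel
    have hkk := starFree_mul_rev N s c hs k
    rw [← hk, ← pow_two, ← pow_two] at hkk
    rw [map_sub, starFree_rev_mul N s c hs, starFree_mul_rev N s c hs, map_smul, hkk,
      smul_toTw, map_sub c, map_inv₀, hc, ← map_sub]
    exact congrArg (toTw N s c) hrel
  | even i hi =>
    simp only [map_mul] at hrel
    rw [starFree_rev_mul N s c hs, starFree_mul_rev N s c hs]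
    exact congrArg (toTw N s c) hrel

/-- The `*`-operation `p ↦ p^*` on `𝒜`, as a ring homomorphism to the opposite algebra:
`x_i^* = q ^ ρ_{i'} x_{i'}`, `(p r)^* = r^* p^*`, `(z p)^* = c(z) p^*` for scalars `z`. -/
def starHom (N : ℕ) (s : ℂ) (c : ℂ →+* ℂ) (hs : s ≠ 0) (hc : c s = s) :
    QSpace N s →+* (QSpace N s)ᵐᵒᵖ :=
  RingQuot.lift (T := TwistedOp N s c)
    ⟨(starFree N s c).toRingHom, fun a b hab => starFree_rel N s c hs hc a b hab⟩

theorem starHom_mk (N : ℕ) (s : ℂ) (c : ℂ →+* ℂ) (hs : s ≠ 0) (hc : c s = s)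
    (a : FreeAlgebra ℂ (Fin N)) :
    starHom N s c hs hc (RingQuot.mkAlgHom ℂ (Rel N s) a) = starFree N s c a := by
  have h : (RingQuot.mkAlgHom ℂ (Rel N s) a) = RingQuot.mkRingHom (Rel N s) a := by
    rw [← RingQuot.mkAlgHom_coe ℂ]
    rfl
  rw [h]
  exact RingQuot.lift_mkRingHom_apply (T := TwistedOp N s c) (starFree N s c).toRingHom
    (fun a b hab => starFree_rel N s c hs hc a b hab) a

theorem starHom_gen (N : ℕ) (s : ℂ) (c : ℂ →+* ℂ) (hs : s ≠ 0) (hc : c s = s) (i : Fin N) :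
    (starHom N s c hs hc (gen N s i)).unop = (s ^ rho2 N i.rev) • gen N s i.rev := by
  rw [gen, starHom_mk, starFree, FreeAlgebra.lift_ι_apply]
  rfl

theorem starHom_smul (N : ℕ) (s : ℂ) (c : ℂ →+* ℂ) (hs : s ≠ 0) (hc : c s = s) (z : ℂ)
    (p : QSpace N s) :
    (starHom N s c hs hc (z • p)).unop = c z • (starHom N s c hs hc p).unop := by
  obtain ⟨a, rfl⟩ := RingQuot.mkAlgHom_surjective ℂ (Rel N s) p
  rw [← map_smul, starHom_mk, starHom_mk, map_smul]
  exact congrArg MulOpposite.unop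
    (smul_toTw c z (MulOpposite.unop (starFree N s c a : (QSpace N s)ᵐᵒᵖ)))

/-- The scalar product `⟨p₁, p₂⟩ = h ((τ p₁)^* (τ p₂)) = h (τ (p₁^* p₂))`. -/
def scalarProduct {N : ℕ} {s : ℂ} (h : QSphere N s →ₗ[ℂ] ℂ) (c : ℂ →+* ℂ) (hs : s ≠ 0)
    (hc : c s = s) (p₁ p₂ : QSpace N s) : ℂ :=
  h (restrict N s ((starHom N s c hs hc p₁).unop * p₂))

/-! ### The associated spherical polynomials -/

/-- The polynomial `t^{N_j, M}_{a b}` in `Q_j`, `x_j`, `x_{j'}` for the subalgebra generated by the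
`x_i` with `j ≤ i ≤ j'`, which is the quantum Euclidean space in `N_j = N - 2 j` coordinates
(zero-based `j`).  Here `l = M - a - b`, and `s ^ ((2 - N_j) k) = q ^ ((-n_j + ε) k)` with
`ε = 1` for `N_j = 2 n_j` and `ε = 1/2` for `N_j = 2 n_j + 1`. -/
def tPoly (N : ℕ) (s : ℂ) (j : Fin N) (M a b : ℕ) : QSpace N s :=
  let Nj : ℤ := (N : ℤ) - 2 * (j : ℤ)
  let l : ℤ := (M : ℤ) - a - b
  ∑ k ∈ Finset.range (min a b + 1),
    (qPoch ((s ^ 2) ^ (-2 * (a : ℤ))) ((s ^ 2) ^ 2) k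
        * qPoch ((s ^ 2) ^ (-2 * (b : ℤ))) ((s ^ 2) ^ 2) k
      / (qPoch ((s ^ 2) ^ 2) ((s ^ 2) ^ 2) k
        * qPoch ((s ^ 2) ^ (-Nj - 2 * (M : ℤ) + 4)) ((s ^ 2) ^ 2) k)
      * (s ^ ((2 - Nj) * (k : ℤ)) * (s ^ 2) ^ ((-2 * l + 2) * (k : ℤ))
      / (1 + (s ^ 2) ^ (Nj - 2)) ^ k)) •
      (qRadius N s j ^ k * gen N s j ^ (a - k) * gen N s j.rev ^ (b - k))

/-- `m - ∑_{i < j} (m_i + m'_i)`. -/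
def remDeg {r : ℕ} (m : ℕ) (a b : Fin r → ℕ) (j : Fin r) : ℕ :=
  m - ∑ i ∈ Finset.Iio j, (a i + b i)

/-- Indices `(𝐦, 𝐦', k)` for `N = 2 n` with `∑_i (m_i + m'_i) + |k| = m`. -/
def EvenIndex (n m : ℕ) : Type :=
  {x : (Fin (n - 1) → ℕ) × (Fin (n - 1) → ℕ) × ℤ //
    ∑ i, (x.1 i + x.2.1 i) + x.2.2.natAbs = m}

/-- Indices `(𝐦, 𝐦', σ)`, `σ ∈ {0, 1}`, for `N = 2 n + 1` with `∑_i (m_i + m'_i) + σ = m`. -/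
def OddIndex (n m : ℕ) : Type :=
  {x : (Fin n → ℕ) × (Fin n → ℕ) × Fin 2 // ∑ i, (x.1 i + x.2.1 i) + (x.2.2 : ℕ) = m}

/-- `t^{2, k}`: `x_n ^ k` for `k > 0`, `1` for `k = 0` and `x_{n'} ^ (-k)` for `k < 0`. -/
def tTwo (n : ℕ) (hn : 1 ≤ n) (s : ℂ) (k : ℤ) : QSpace (2 * n) s :=
  if 0 < k then gen (2 * n) s ⟨n - 1, by omega⟩ ^ k.natAbs
  else if k = 0 then 1
  else gen (2 * n) s ⟨n, by omega⟩ ^ k.natAbs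

/-- The ordered product `Ξ_{𝐦, 𝐦', k}` for `N = 2 n`. -/
def xiEven (n : ℕ) (hn : 1 ≤ n) (s : ℂ) (m : ℕ) (x : EvenIndex n m) : QSpace (2 * n) s :=
  (List.ofFn fun j : Fin (n - 1) =>
    tPoly (2 * n) s ⟨j, by omega⟩ (remDeg m x.1.1 x.1.2.1 j) (x.1.1 j) (x.1.2.1 j)).prod
    * tTwo n hn s x.1.2.2

/-- The ordered product `Ξ_{𝐦, 𝐦', σ}` for `N = 2 n + 1`. -/
def xiOdd (n : ℕ) (s : ℂ) (m : ℕ) (x : OddIndex n m) : QSpace (2 * n + 1) s :=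
  (List.ofFn fun j : Fin n =>
    tPoly (2 * n + 1) s ⟨j, by omega⟩ (remDeg m x.1.1 x.1.2.1 j) (x.1.1 j) (x.1.2.1 j)).prod
    * gen (2 * n + 1) s ⟨n, by omega⟩ ^ (x.1.2.2 : ℕ)

/-- The family `Ξ` is an orthogonal basis of the space `ℋ_m`: it is a linear basis of `ℋ_m`, it is
pairwise orthogonal for the bilinear form `h (τ (p₁^* p₂))` given by the linear `*`-operation, and,
if `s` is real, it is pairwise orthogonal for the sesquilinear scalar product given by the
conjugate-linear `*`-operation. -/
def IsOrthogonalBasis {N : ℕ} {s : ℂ} (hs : s ≠ 0)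
    (B : Module.Basis (Fin N → ℕ) ℂ (QSpace N s)) (h : QSphere N s →ₗ[ℂ] ℂ) (m : ℕ)
    {I : Type} (Ξ : I → QSpace N s) : Prop :=
  (∃ b : Module.Basis I ℂ (harmonic B m), ∀ x, (b x : QSpace N s) = Ξ x) ∧
  (∀ x y, x ≠ y → scalarProduct h (RingHom.id ℂ) hs rfl (Ξ x) (Ξ y) = 0) ∧
  (∀ hc : starRingEnd ℂ s = s, ∀ x y, x ≠ y →
    scalarProduct h (starRingEnd ℂ) hs hc (Ξ x) (Ξ y) = 0)

end QEuclid

end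

/-! The proof compares N and N + 2 coordinates. The algebra for N + 2 arises from the one for N by
adjoining two outer generators, the first and the last. They q-commute with homogeneous inner
elements, and their commutator is a multiple of the inner squared radius Q'. Hence every element is
a sum of terms `tri a y b`, that is x_1^a y x_N^b with y inner, and the coefficients y are unique
(`tri_induction`, `coeff_tri`). The Laplace operator and the functional obey recursions in these
terms (`lower_tri`, `numFun_tri`), so identities are proved by induction on N in steps of two.

On each homogeneous component the Laplace operator is a nonzero multiple of a lowering operator L
(`laplace_eq`). Three facts carry the argument. The squared radius Q is central. The commutator of L
and Q acts on degree d as a scalar proportional to the q-number of d + N/2, as in quantum sl_2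
(`lower_qRadius_mul`). Finally, L is symmetric for the unnormalized functional up to a degree term
(`balanced`), so that (q^d - q^e) times the functional of p r is zero for harmonic p, r of degrees
d, e.

A `HarmonicSystem` is a homogeneous, independent, orthogonal family of harmonic elements whose
multiples by powers of Q span the algebra. By the commutator relation these multiples are
independent, and a harmonic combination of them involves only the zeroth power of Q. The family is
therefore a basis of all harmonic elements.

Multiplying the members y of such a system by the polynomials t_ab gives a system for N + 2
(`HarmonicSystem.step`). The coefficients of t_ab are those for which L(t_ab y) telescopes to zero
(`lower_extend`). Independence follows from one extreme coefficient of t_ab y, and spanning from a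
triangularity argument. Products with different inner factors are orthogonal because the inner
factors are. With the same inner factor, either the total degrees differ or the torus weights a - b
do. The induction starts with 1, x for N = 1 and with the pure powers for N = 2; N = 0 is unsuitable
because Q vanishes there.

Dividing the unnormalized functional by a factor depending only on the degree makes it invariant
under multiplication by Q. It then descends to the sphere, and orthogonality is preserved because
only products of homogeneous elements are evaluated. -/

noncomputable section
namespace QEuclid

open Finset

/-- The parameter `s` is nonzero and `q = s ^ 2` is not a root of unity. -/
class Generic (s : ℂ) : Prop where
  ne_zero : s ≠ 0
  pow_ne_one : ∀ k : ℕ, 0 < k → (s ^ 2) ^ k ≠ 1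

/-! ### Nonvanishing facts for q not a root of unity -/

namespace Generic

variable (s : ℂ) [Generic s]

theorem zpow_ne_one {k : ℤ} (hk : k ≠ 0) : s ^ k ≠ 1 := by
  intro h
  have h2 : (s ^ 2) ^ k.natAbs = 1 := by
    rw [pow_right_comm, ← zpow_natCast s]
    rcases Int.natAbs_eq k with e | e
    · rw [← e, h, one_pow]
    · have : ((k.natAbs : ℕ) : ℤ) = -k := by omega
      rw [this, zpow_neg, h, inv_one, one_pow]
  exact pow_ne_one (s := s) _ (Int.natAbs_pos.mpr hk) h2

theorem zpow_ne_zpow {k l : ℤ} (hk : k ≠ l) : s ^ k ≠ s ^ l := by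
  intro h
  apply zpow_ne_one s (sub_ne_zero.mpr hk)
  rw [zpow_sub₀ ne_zero, h, div_self (zpow_ne_zero _ ne_zero)]

/-- If s^k = -s^l, squaring forces k = l, and then 2 s^k = 0. Such sums are the denominators in the
relations and in the formulas for the radius. -/
theorem zpow_add_ne_zero (k l : ℤ) : s ^ k + s ^ l ≠ 0 := by
  intro h
  by_cases e : k = l
  · rw [e, ← two_mul] at h
    exact mul_ne_zero two_ne_zero (zpow_ne_zero _ ne_zero) h
  · have h1 : s ^ k = -s ^ l := eq_neg_of_add_eq_zero_left h
    have h2 : s ^ (k + k) = s ^ (l + l) := by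
      rw [zpow_add₀ ne_zero, zpow_add₀ ne_zero, h1, neg_mul_neg]
    exact zpow_ne_zpow s (by omega) h2

theorem sub_inv_ne_zero : s ^ 2 - (s ^ 2)⁻¹ ≠ 0 := by
  have := zpow_ne_zpow s (k := 2) (l := -2) (by norm_num)
  rw [sub_ne_zero]
  simpa [zpow_neg] using this

end Generic

/-! ### The presentation and its universal property -/

section Presentation

variable {N : ℕ} {s : ℂ}

theorem smul_sub_smul (a : ℂ) (x y : QSpace N s) : a • x - a • y = a • (x - y) :=
  (smul_sub a x y).symm

theorem smul_sub_smul_right (a b : ℂ) (x : QSpace N s) : a • x - b • x = (a - b) • x :=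
  (sub_smul a b x).symm

theorem gen_rel {a b : FreeAlgebra ℂ (Fin N)} (h : Rel N s a b) :
    RingQuot.mkAlgHom ℂ (Rel N s) a = RingQuot.mkAlgHom ℂ (Rel N s) b :=
  RingQuot.mkAlgHom_rel ℂ h

theorem gen_comm {i j : Fin N} (hij : i < j) (hne : i ≠ j.rev) :
    gen N s i * gen N s j = s ^ 2 • (gen N s j * gen N s i) := by
  have h := gen_rel (s := s) (Rel.comm i j hij hne)
  rwa [map_mul, map_smul, map_mul] at h

theorem gen_induction {P : QSpace N s → Prop} (hc : ∀ z : ℂ, P (algebraMap ℂ _ z))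
    (hg : ∀ i, P (gen N s i)) (hm : ∀ x y, P x → P y → P (x * y))
    (ha : ∀ x y, P x → P y → P (x + y)) (x : QSpace N s) : P x := by
  obtain ⟨a, rfl⟩ := RingQuot.mkAlgHom_surjective ℂ (Rel N s) x
  induction a using FreeAlgebra.induction with
  | grade0 r => simpa using hc r
  | grade1 x => exact hg x
  | mul a b h1 h2 => rw [map_mul]; exact hm _ _ h1 h2
  | add a b h1 h2 => rw [map_add]; exact ha _ _ h1 h2

theorem algHom_ext {R : Type*} [Ring R] [Algebra ℂ R] {f g : QSpace N s →ₐ[ℂ] R}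
    (h : ∀ i, f (gen N s i) = g (gen N s i)) : f = g := by
  apply RingQuot.ringQuot_ext'
  apply FreeAlgebra.hom_ext
  funext i
  exact h i

/-- The homomorphism from `𝒜` with prescribed values on the generators. -/
def liftGen {R : Type*} [Ring R] [Algebra ℂ R] (f : Fin N → R)
    (h : ∀ a b, Rel N s a b → FreeAlgebra.lift ℂ f a = FreeAlgebra.lift ℂ f b) :
    QSpace N s →ₐ[ℂ] R :=
  RingQuot.liftAlgHom ℂ ⟨FreeAlgebra.lift ℂ f, fun a b => h a b⟩

theorem liftGen_gen {R : Type*} [Ring R] [Algebra ℂ R] (f : Fin N → R)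
    (h : ∀ a b, Rel N s a b → FreeAlgebra.lift ℂ f a = FreeAlgebra.lift ℂ f b) (i : Fin N) :
    liftGen f h (gen N s i) = f i := by
  rw [liftGen, gen, RingQuot.liftAlgHom_mkAlgHom_apply, FreeAlgebra.lift_ι_apply]

theorem qRadius_zero (N : ℕ) (s : ℂ) :
    qRadius N s 0 = ∑ i : Fin N, (s ^ rho2 N i.rev) • (gen N s i * gen N s i.rev) := by
  simp [qRadius]

end Presentation

/-! ### Scaling of the generators and homogeneity -/

section Scale

variable {N : ℕ} {s : ℂ}

/-- The automorphism scaling all generators by `z`. -/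
def scale (z : ℂ) : QSpace N s →ₐ[ℂ] QSpace N s :=
  liftGen (fun i => z • gen N s i) (by
    intro a b h
    have hr := gen_rel h
    -- All defining relations are homogeneous quadratic, so the substitution multiplies both sides
    -- by z^2.
    have key : ∀ i j : Fin N, FreeAlgebra.lift ℂ (fun i => z • gen N s i)
        (FreeAlgebra.ι ℂ i * FreeAlgebra.ι ℂ j) = (z * z) • RingQuot.mkAlgHom ℂ (Rel N s)
        (FreeAlgebra.ι ℂ i * FreeAlgebra.ι ℂ j) := by
      intro i j
      rw [map_mul, FreeAlgebra.lift_ι_apply, FreeAlgebra.lift_ι_apply, smul_mul_smul_comm, map_mul]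
      rfl
    cases h with
    | comm i j hij hne =>
      rw [map_smul, key, key, hr, map_smul, smul_comm]
    | cross i hi =>
      rw [map_sub, map_smul, map_sum, key, key, smul_sub_smul, ← map_sub, hr, map_smul, map_sum,
        smul_comm, Finset.smul_sum]
      congr 1
      refine Finset.sum_congr rfl fun j _ => ?_
      rw [map_smul, map_smul, key, smul_comm]
    | odd i k hk hi =>
      rw [pow_two] at hr ⊢
      rw [map_sub, map_smul, key, key, key, smul_sub_smul, ← map_sub, hr, map_smul, smul_comm]
    | even i hi =>
      rw [key, key, hr])

theorem scale_gen (z : ℂ) (i : Fin N) : scale z (gen N s i) = z • gen N s i :=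
  liftGen_gen _ _ i

theorem scale_scale (z w : ℂ) (p : QSpace N s) : scale z (scale w p) = scale (z * w) p := by
  have : (scale z).comp (scale w) = scale (N := N) (s := s) (z * w) := by
    apply algHom_ext
    intro i
    rw [AlgHom.comp_apply, scale_gen, map_smul, scale_gen, scale_gen, smul_smul, mul_comm]
  exact DFunLike.congr_fun this p

theorem scale_one (p : QSpace N s) : scale 1 p = p := by
  have : scale (N := N) (s := s) 1 = AlgHom.id ℂ _ := by
    apply algHom_ext
    intro i
    rw [scale_gen, one_smul, AlgHom.id_apply]
  exact DFunLike.congr_fun this p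

/-- `p` is homogeneous of degree `d`, in terms of the scaling by `q`. -/
def Hom (d : ℕ) (p : QSpace N s) : Prop := scale (s ^ 2) p = (s ^ 2) ^ d • p

theorem Hom.zero {d : ℕ} : Hom d (0 : QSpace N s) := by simp [Hom]

theorem Hom.add {d : ℕ} {p r : QSpace N s} (hp : Hom d p) (hr : Hom d r) : Hom d (p + r) := by
  rw [Hom, map_add, hp, hr, smul_add]

theorem Hom.smul {d : ℕ} {p : QSpace N s} (z : ℂ) (hp : Hom d p) : Hom d (z • p) := by
  rw [Hom, map_smul, hp, smul_comm]

theorem Hom.sum {d : ℕ} {ι : Type*} {t : Finset ι} {p : ι → QSpace N s}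
    (hp : ∀ i ∈ t, Hom d (p i)) : Hom d (∑ i ∈ t, p i) := by
  rw [Hom, map_sum, Finset.smul_sum]
  exact Finset.sum_congr rfl hp

theorem Hom.mul {d e : ℕ} {p r : QSpace N s} (hp : Hom d p) (hr : Hom e r) :
    Hom (d + e) (p * r) := by
  rw [Hom, map_mul, hp, hr, smul_mul_smul_comm, pow_add]

theorem Hom.one : Hom 0 (1 : QSpace N s) := by simp [Hom]

theorem Hom.gen (i : Fin N) : Hom 1 (QEuclid.gen N s i) := by
  rw [Hom, scale_gen, pow_one]

theorem Hom.pow {d : ℕ} {p : QSpace N s} (hp : Hom d p) (k : ℕ) : Hom (k * d) (p ^ k) := by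
  rw [Hom, map_pow, hp, smul_pow, ← pow_mul, mul_comm d k]

theorem Hom.list_prod : ∀ {r : ℕ} (f : Fin r → QSpace N s) (d : Fin r → ℕ),
    (∀ i, Hom (d i) (f i)) → Hom (∑ i, d i) (List.ofFn f).prod
  | 0, f, d, _ => by simpa using Hom.one
  | r + 1, f, d, h => by
    rw [List.ofFn_succ, List.prod_cons, Fin.sum_univ_succ]
    exact (h 0).mul (Hom.list_prod _ _ fun i => h i.succ)

theorem Hom.mono (ν : Fin N → ℕ) : Hom (∑ i, ν i) (QEuclid.mono N s ν) := by
  refine Hom.list_prod _ _ fun i => ?_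
  simpa using (Hom.gen (s := s) i).pow (ν i)

theorem Hom.qRadius (j : ℕ) : Hom 2 (QEuclid.qRadius N s j) :=
  Hom.sum fun i _ => ((Hom.gen i).mul (Hom.gen i.rev)).smul _

end Scale

end QEuclid
end

/-! ### Index bookkeeping for the passage from N to N + 2 -/

noncomputable section
namespace QEuclid

open Finset

section Index

variable {N : ℕ}

/-- The inclusion of the index set of `𝒜` for `N` into that for `N + 2`. -/
def inner (i : Fin N) : Fin (N + 2) := ⟨i + 1, by omega⟩

@[simp] theorem inner_val (i : Fin N) : (inner i : ℕ) = i + 1 := rfl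

@[simp] theorem inner_rev (i : Fin N) : (inner i).rev = inner i.rev := by
  ext
  simp only [Fin.val_rev, inner_val]
  omega

@[simp] theorem zero_rev : (0 : Fin (N + 2)).rev = Fin.last (N + 1) := Fin.rev_zero _

@[simp] theorem last_rev : (Fin.last (N + 1)).rev = (0 : Fin (N + 2)) := Fin.rev_last _

@[simp] theorem inner_lt_inner {i j : Fin N} : inner i < inner j ↔ i < j := by
  rw [Fin.lt_def, Fin.lt_def, inner_val, inner_val]
  omega

@[simp] theorem inner_inj {i j : Fin N} : inner i = inner j ↔ i = j := by
  simp [Fin.ext_iff]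

@[simp] theorem zero_lt_inner (i : Fin N) : (0 : Fin (N + 2)) < inner i := by
  simp [Fin.lt_def]

@[simp] theorem inner_lt_last (i : Fin N) : inner i < Fin.last (N + 1) := by
  simp [Fin.lt_def]

@[simp] theorem inner_ne_zero (i : Fin N) : inner i ≠ 0 := (zero_lt_inner i).ne'

@[simp] theorem zero_ne_inner (i : Fin N) : 0 ≠ inner i := (zero_lt_inner i).ne

@[simp] theorem inner_ne_last (i : Fin N) : inner i ≠ Fin.last (N + 1) := (inner_lt_last i).ne

@[simp] theorem last_ne_inner (i : Fin N) : Fin.last (N + 1) ≠ inner i := (inner_lt_last i).ne'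

@[simp] theorem zero_ne_last : (0 : Fin (N + 2)) ≠ Fin.last (N + 1) := by
  simp [Fin.ext_iff]

@[simp] theorem last_ne_zero : Fin.last (N + 1) ≠ (0 : Fin (N + 2)) := zero_ne_last.symm

theorem index_cases {P : Fin (N + 2) → Prop} (h0 : P 0) (hl : P (Fin.last _))
    (hi : ∀ j, P (inner j)) (i : Fin (N + 2)) : P i := by
  by_cases h : i = 0
  · exact h ▸ h0
  by_cases h' : i = Fin.last _
  · exact h' ▸ hl
  · have e : inner ⟨i - 1, by
        have := Fin.val_ne_of_ne h'
        have := Fin.val_ne_of_ne h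
        simp only [Fin.val_last, Fin.val_zero] at *
        omega⟩ = i := by
      ext
      have := Fin.val_ne_of_ne h
      simp only [inner_val, Fin.val_zero] at *
      omega
    exact e ▸ hi _

theorem sum_univ_inner {M : Type*} [AddCommMonoid M] (f : Fin (N + 2) → M) :
    ∑ i, f i = f 0 + ∑ i, f (inner i) + f (Fin.last _) := by
  rw [Fin.sum_univ_castSucc, Fin.sum_univ_succ]
  rfl

theorem prod_univ_inner {M : Type*} [CommMonoid M] (f : Fin (N + 2) → M) :
    ∏ i, f i = f 0 * (∏ i, f (inner i)) * f (Fin.last _) := by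
  rw [Fin.prod_univ_castSucc, Fin.prod_univ_succ]
  rfl

theorem sum_Ioo_eq {M : Type*} [AddCommMonoid M] (a b : Fin N) (f : Fin N → M) :
    ∑ i ∈ Ioo a b, f i = ∑ i, if a < i ∧ i < b then f i else 0 := by
  rw [← Finset.sum_filter, Finset.filter_lt_lt_eq_Ioo]

theorem sum_Ioo_zero_last {M : Type*} [AddCommMonoid M] (f : Fin (N + 2) → M) :
    ∑ i ∈ Ioo 0 (Fin.last _), f i = ∑ i, f (inner i) := by
  rw [sum_Ioo_eq, sum_univ_inner]
  simp

theorem sum_Ioo_inner {M : Type*} [AddCommMonoid M] (a b : Fin N) (f : Fin (N + 2) → M) :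
    ∑ i ∈ Ioo (inner a) (inner b), f i = ∑ i ∈ Ioo a b, f (inner i) := by
  rw [sum_Ioo_eq, sum_univ_inner, sum_Ioo_eq]
  have h1 : ¬ (inner a < 0) := by simp
  have h2 : ¬ (Fin.last (N + 1) < inner b) := not_lt.mpr (inner_lt_last b).le
  simp [h1, h2]

@[simp] theorem rho2_inner (i : Fin N) : rho2 (N + 2) (inner i) = rho2 N i := by
  unfold rho2
  simp only [inner_rev, inner_lt_inner, inner_inj, inner_val]
  push_cast
  split_ifs <;> ring

@[simp] theorem rho2_zero : rho2 (N + 2) 0 = N := by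
  unfold rho2
  rw [if_pos (by simp [Fin.lt_def])]
  push_cast
  simp

@[simp] theorem rho2_last : rho2 (N + 2) (Fin.last _) = -N := by
  rw [← zero_rev, rho2_rev, rho2_zero]

end Index

/-! ### The algebra for N + 2 as an extension of the algebra for N -/

section Step

variable {N : ℕ} {s : ℂ}

/-- The factor relating `x_i x_{i'}` and the squared radius. -/
def radFactor (N : ℕ) (s : ℂ) : ℂ := s ^ ((N : ℤ) - 2) + s ^ (2 - (N : ℤ))

/-- The coefficient in the relation between the outer generators. -/
def outerCoeff (N : ℕ) (s : ℂ) : ℂ := (s ^ 2 - (s ^ 2)⁻¹) / radFactor N s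

theorem sum_rev_eq_qRadius {R : Type*} [Ring R] [Algebra ℂ R] (φ : QSpace N s →ₐ[ℂ] R) :
    ∑ i : Fin N, (s ^ rho2 N i.rev) • (φ (gen N s i) * φ (gen N s i.rev)) =
      φ (qRadius N s 0) := by
  rw [qRadius_zero, map_sum]
  simp only [map_smul, map_mul]

/-- With one inner coordinate the denominator is s + s⁻¹, which divides q - q⁻¹. Thus the special
relation for odd N is the general outer relation with inner radius x^2. -/
theorem outerCoeff_one_mul [Generic s] : outerCoeff 1 s = s - s⁻¹ := by
  have h0 : s ≠ 0 := Generic.ne_zero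
  have h1 : s ^ (-1 : ℤ) + s ^ (1 : ℤ) ≠ 0 := Generic.zpow_add_ne_zero s _ _
  unfold outerCoeff radFactor
  norm_num at h1 ⊢
  rw [div_eq_iff h1]
  field_simp
  ring

theorem qRadius_one_zero : qRadius 1 s 0 = gen 1 s 0 ^ 2 := by
  rw [qRadius_zero]
  simp [rho2, pow_two]

/-- Universal property of the extension. Relations not involving an outer generator are those of the
inner algebra. The `cross`, `odd` and `even` relations at the first index occur for N ≥ 2, N = 1 and
N = 0 respectively, and all take the form `huv`. -/
theorem exists_liftStep [Generic s] {R : Type*} [Ring R] [Algebra ℂ R] (φ : QSpace N s →ₐ[ℂ] R)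
    (u v : R) (hu : ∀ i, u * φ (gen N s i) = s ^ 2 • (φ (gen N s i) * u))
    (hv : ∀ i, φ (gen N s i) * v = s ^ 2 • (v * φ (gen N s i)))
    (huv : v * u - u * v = outerCoeff N s • φ (qRadius N s 0)) :
    ∃ ψ : QSpace (N + 2) s →ₐ[ℂ] R, ψ (gen _ s 0) = u ∧ ψ (gen _ s (Fin.last _)) = v ∧
      ∀ i, ψ (gen _ s (inner i)) = φ (gen N s i) := by
  have hs0 : s ≠ 0 := Generic.ne_zero
  set f : Fin (N + 2) → R := fun i => if h : i = 0 then u else if h' : i = Fin.last _ then v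
    else φ (gen N s ⟨i - 1, by
        have := Fin.val_ne_of_ne h'
        have := Fin.val_ne_of_ne h
        simp only [Fin.val_last, Fin.val_zero] at *
        omega⟩) with hf
  have f0 : f 0 = u := by simp [hf]
  have fl : f (Fin.last _) = v := by simp [hf]
  have fi : ∀ i, f (inner i) = φ (gen N s i) := by
    intro i
    simp [hf]
  have lm : ∀ i j, FreeAlgebra.lift ℂ f (FreeAlgebra.ι ℂ i * FreeAlgebra.ι ℂ j) = f i * f j := by
    intro i j
    rw [map_mul, FreeAlgebra.lift_ι_apply, FreeAlgebra.lift_ι_apply]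
  have hrel : ∀ a b, Rel (N + 2) s a b → FreeAlgebra.lift ℂ f a = FreeAlgebra.lift ℂ f b := by
    intro a b h
    cases h with
    | comm i j hij hne =>
      rw [map_smul, lm, lm]
      induction i using index_cases with
      | h0 =>
        induction j using index_cases with
        | h0 => exact absurd hij (lt_irrefl _)
        | hl => exact absurd last_rev.symm hne
        | hi j => rw [f0, fi, hu]
      | hl => exact absurd hij (not_lt.mpr (Fin.le_last _))
      | hi i =>
        induction j using index_cases with
        | h0 => exact absurd hij (not_lt.mpr (Fin.zero_le _))
        | hl => rw [fl, fi, hv]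
        | hi j =>
          rw [fi, fi, ← map_mul, ← map_mul, ← map_smul, gen_comm (inner_lt_inner.mp hij)]
          intro e
          exact hne (by rw [e, inner_rev])
    | cross i hi =>
      rw [map_sub, map_smul, map_sum, lm, lm]
      simp only [map_smul, lm]
      induction i using index_cases with
      | h0 =>
        rw [zero_rev, f0, fl, huv, sum_Ioo_zero_last, ← sum_rev_eq_qRadius]
        simp only [inner_rev, fi, rho2_inner, rho2_zero]
        unfold outerCoeff radFactor
        rw [neg_add_eq_sub]
      | hl =>
        simp only [Fin.val_last] at hi
        omega
      | hi i =>
        have h := gen_rel (s := s) (Rel.cross i (by simp only [inner_val] at hi; omega))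
        rw [map_sub, map_smul, map_sum] at h
        simp only [map_smul, map_mul] at h
        rw [inner_rev, sum_Ioo_inner]
        simp only [fi, inner_rev, rho2_inner]
        have h2 := congrArg φ h
        rw [map_sub, map_smul, map_sum] at h2
        simp only [map_smul, map_mul] at h2
        exact h2
    | odd i k hk hi =>
      rw [pow_two, map_sub, map_smul, lm, lm, lm]
      induction i using index_cases with
      | h0 =>
        have hN : N = 1 := by
          have h1 := congrArg Fin.val hk
          simp only [Fin.val_rev, Fin.val_zero] at h1 hi
          omega
        subst hN
        have hk1 : k = inner 0 := by
          ext
          simp only [Fin.val_zero, inner_val] at hi ⊢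
          omega
        rw [zero_rev, f0, fl, huv, hk1, fi, outerCoeff_one_mul, qRadius_one_zero, map_pow, pow_two]
      | hl =>
        have := k.isLt
        simp only [Fin.val_last] at hi
        omega
      | hi i =>
        induction k using index_cases with
        | h0 =>
          simp only [inner_val, Fin.val_zero] at hi
          omega
        | hl => exact absurd hk (by simp)
        | hi k =>
          simp only [inner_val] at hi
          have h := gen_rel (s := s) (Rel.odd i k (by simpa using hk) (by omega))
          rw [pow_two, map_sub, map_smul] at h
          simp only [map_mul] at h
          rw [inner_rev, fi, fi, fi]
          have h2 := congrArg φ h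
          rw [map_sub, map_smul] at h2
          simp only [map_mul] at h2
          exact h2
    | even i hi =>
      rw [lm, lm]
      induction i using index_cases with
      | h0 =>
        have hN : N = 0 := by
          simp only [Fin.val_rev, Fin.val_zero] at hi
          omega
        subst hN
        -- Without inner coordinates the radius is an empty sum, so `huv` says that the two images
        -- commute.
        rw [zero_rev, f0, fl, ← sub_eq_zero, huv, qRadius_zero]
        simp
      | hl =>
        simp only [Fin.val_last, Fin.val_rev] at hi
        omega
      | hi i =>
        have h := gen_rel (s := s) (Rel.even i (by simpa using hi))
        rw [inner_rev, fi, fi, ← map_mul, ← map_mul]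
        rw [map_mul, map_mul] at h
        exact congrArg φ h
  refine ⟨liftGen f hrel, ?_, ?_, fun i => ?_⟩ <;> rw [liftGen_gen]
  exacts [f0, fl, fi i]

/-- The embedding of `𝒜` for `N` into `𝒜` for `N + 2`. -/
def iota (N : ℕ) (s : ℂ) : QSpace N s →ₐ[ℂ] QSpace (N + 2) s :=
  liftGen (fun i => gen (N + 2) s (inner i)) (by
    intro a b h
    cases h with
    | comm i j hij hne =>
      have h := gen_rel (s := s) (Rel.comm (inner i) (inner j) (inner_lt_inner.mpr hij)
        (by simpa using hne))
      simp only [map_smul, map_mul, FreeAlgebra.lift_ι_apply] at h ⊢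
      exact h
    | cross i hi =>
      have h := gen_rel (s := s) (Rel.cross (inner i) (by simp only [inner_val]; omega))
      rw [map_sub, map_smul, inner_rev, sum_Ioo_inner, map_sum] at h
      rw [map_sub, map_smul, map_sum]
      simp only [map_smul, map_mul, inner_rev, rho2_inner, FreeAlgebra.lift_ι_apply] at h ⊢
      exact h
    | odd i k hk hi =>
      have h := gen_rel (s := s) (Rel.odd (inner i) (inner k) (by simpa using hk)
        (by simp only [inner_val]; omega))
      rw [map_sub, map_smul, inner_rev, map_pow] at h
      rw [map_sub, map_smul, map_pow]
      simp only [map_mul, FreeAlgebra.lift_ι_apply] at h ⊢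
      exact h
    | even i hi =>
      have h := gen_rel (s := s) (Rel.even (inner i) (by simpa using hi))
      rw [inner_rev] at h
      simp only [map_mul, FreeAlgebra.lift_ι_apply] at h ⊢
      exact h)

@[simp] theorem iota_gen (i : Fin N) : iota N s (gen N s i) = gen (N + 2) s (inner i) :=
  liftGen_gen _ _ i

/-- The first generator of `𝒜` for `N + 2`. -/
abbrev xFirst (N : ℕ) (s : ℂ) : QSpace (N + 2) s := gen (N + 2) s 0

/-- The last generator of `𝒜` for `N + 2`. -/
abbrev xLast (N : ℕ) (s : ℂ) : QSpace (N + 2) s := gen (N + 2) s (Fin.last (N + 1))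

theorem xFirst_mul_iota (y : QSpace N s) :
    xFirst N s * iota N s y = iota N s (scale (s ^ 2) y) * xFirst N s := by
  induction y using gen_induction with
  | hc z => simp only [AlgHom.commutes]; exact (Algebra.commutes z _).symm
  | hg i =>
    rw [scale_gen, map_smul, iota_gen, gen_comm (zero_lt_inner i) (by simp), smul_mul_assoc]
  | hm x y hx hy => rw [map_mul, map_mul, map_mul, ← mul_assoc, hx, mul_assoc, hy, mul_assoc]
  | ha x y hx hy => rw [map_add, map_add, map_add, mul_add, add_mul, hx, hy]

theorem iota_mul_xLast (y : QSpace N s) :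
    iota N s y * xLast N s = xLast N s * iota N s (scale (s ^ 2) y) := by
  induction y using gen_induction with
  | hc z => simp only [AlgHom.commutes]; exact (Algebra.commutes z _)
  | hg i =>
    rw [scale_gen, map_smul, iota_gen, gen_comm (inner_lt_last i) (by simp), mul_smul_comm]
  | hm x y hx hy => rw [map_mul, map_mul, map_mul, mul_assoc, hy, ← mul_assoc, hx, mul_assoc]
  | ha x y hx hy => rw [map_add, map_add, map_add, mul_add, add_mul, hx, hy]

/-- The three shapes of the defining relation merge because the inner radius is 0 for N = 0 and x^2
for N = 1. -/
theorem xLast_mul_xFirst [Generic s] : xLast N s * xFirst N s =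
    xFirst N s * xLast N s + outerCoeff N s • iota N s (qRadius N s 0) := by
  rw [← sub_eq_iff_eq_add']
  rcases N with _ | _ | N
  · have h := gen_rel (s := s) (N := 0 + 2) (Rel.even 0 (by simp))
    rw [map_mul, map_mul, zero_rev] at h
    rw [qRadius_zero]
    simp only [univ_eq_empty, sum_empty, map_zero, smul_zero, sub_eq_zero]
    exact h
  · have h := gen_rel (s := s) (N := 0 + 1 + 2) (Rel.odd 0 (inner 0) (by simp) (by simp))
    rw [map_sub, map_mul, map_mul, zero_rev, map_smul, map_pow] at h
    simp only [zero_add] at *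
    rw [outerCoeff_one_mul, qRadius_one_zero, map_pow, iota_gen]
    exact h
  · have h := gen_rel (s := s) (N := N + 1 + 1 + 2)
      (Rel.cross 0 (by simp only [Fin.val_zero]; omega))
    rw [map_sub, map_mul, map_mul, zero_rev, map_smul, map_sum, sum_Ioo_zero_last] at h
    simp only [inner_rev, map_smul, map_mul, rho2_inner, rho2_zero] at h
    rw [qRadius_zero, map_sum]
    simp only [map_smul, map_mul, iota_gen]
    unfold outerCoeff radFactor
    rw [← neg_add_eq_sub ((N + 1 + 1 : ℕ) : ℤ) 2]
    exact h

end Step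

end QEuclid
end

/-! ### Centrality of the squared radius and the normal form -/

noncomputable section
namespace QEuclid

open Finset

section Radius

variable {N : ℕ} {s : ℂ}

theorem radFactor_ne_zero [Generic s] (N : ℕ) : radFactor N s ≠ 0 :=
  Generic.zpow_add_ne_zero s _ _

theorem radFactor_add_two (N : ℕ) (s : ℂ) :
    radFactor (N + 2) s = s ^ (N : ℤ) + s ^ (-(N : ℤ)) := by
  unfold radFactor
  push_cast
  congr 2 <;> ring

/-- The coefficient of the inner squared radius in the outer one. -/
def innerCoeff (N : ℕ) (s : ℂ) : ℂ := s ^ 2 * radFactor (N + 2) s / radFactor N s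

theorem innerCoeff_ne_zero [Generic s] (N : ℕ) : innerCoeff N s ≠ 0 :=
  div_ne_zero (mul_ne_zero (pow_ne_zero _ Generic.ne_zero) (radFactor_ne_zero _))
    (radFactor_ne_zero _)

/-- The cancellation behind centrality: the term created when x_N passes x_1 compensates the factor
q^(-2) created when the inner radius passes x_1. -/
theorem outerCoeff_relation [Generic s] (N : ℕ) :
    radFactor (N + 2) s * outerCoeff N s = innerCoeff N s * (1 - ((s ^ 2) ^ 2)⁻¹) := by
  have h0 : s ≠ 0 := Generic.ne_zero
  have h1 := radFactor_ne_zero (s := s) N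
  unfold innerCoeff outerCoeff
  field_simp

/-- The summand 1 comes from the inner part of Q. The other comes from reordering x_N x_1, which has
weight s^N in Q. -/
theorem innerCoeff_eq [Generic s] (N : ℕ) :
    innerCoeff N s = 1 + s ^ (N : ℤ) * outerCoeff N s := by
  have h0 : s ≠ 0 := Generic.ne_zero
  have h1 := radFactor_ne_zero (s := s) N
  unfold innerCoeff outerCoeff
  rw [radFactor_add_two, div_eq_iff h1, add_mul, mul_assoc, div_mul_cancel₀ _ h1]
  have e1 : s ^ ((N : ℤ) - 2) = s ^ (N : ℤ) * (s ^ 2)⁻¹ := by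
    rw [zpow_sub₀ h0]; norm_cast
  have e2 : s ^ (2 - (N : ℤ)) = s ^ 2 * (s ^ (N : ℤ))⁻¹ := by
    rw [zpow_sub₀ h0]; norm_cast
  unfold radFactor
  rw [e1, e2, zpow_neg]
  have h2 : s ^ (N : ℤ) ≠ 0 := zpow_ne_zero _ h0
  field_simp
  ring

theorem qRadius_step [Generic s] (N : ℕ) : qRadius (N + 2) s 0 =
    radFactor (N + 2) s • (xFirst N s * xLast N s) + innerCoeff N s • iota N s (qRadius N s 0) := by
  have h0 : s ≠ 0 := Generic.ne_zero
  rw [qRadius_zero, sum_univ_inner]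
  simp only [zero_rev, last_rev, inner_rev, rho2_inner, rho2_zero, rho2_last]
  have h : ∑ i : Fin N, s ^ rho2 N i.rev • (gen (N + 2) s (inner i) * gen (N + 2) s (inner i.rev))
      = iota N s (qRadius N s 0) := by
    rw [← sum_rev_eq_qRadius]
    simp only [iota_gen]
  rw [h, xLast_mul_xFirst, innerCoeff_eq, radFactor_add_two]
  module

theorem xFirst_mul_iota_of_hom {d : ℕ} {y : QSpace N s} (hy : Hom d y) :
    xFirst N s * iota N s y = (s ^ 2) ^ d • (iota N s y * xFirst N s) := by
  rw [xFirst_mul_iota, hy, map_smul, smul_mul_assoc]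

theorem iota_mul_xLast_of_hom {d : ℕ} {y : QSpace N s} (hy : Hom d y) :
    iota N s y * xLast N s = (s ^ 2) ^ d • (xLast N s * iota N s y) := by
  rw [iota_mul_xLast, hy, map_smul, mul_smul_comm]

theorem iota_mul_xFirst_of_hom [Generic s] {d : ℕ} {y : QSpace N s} (hy : Hom d y) :
    iota N s y * xFirst N s = ((s ^ 2) ^ d)⁻¹ • (xFirst N s * iota N s y) := by
  have h0 : (s ^ 2) ^ d ≠ 0 := pow_ne_zero _ (pow_ne_zero _ Generic.ne_zero)
  rw [xFirst_mul_iota_of_hom hy, smul_smul, inv_mul_cancel₀ h0, one_smul]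

theorem xLast_mul_iota_of_hom [Generic s] {d : ℕ} {y : QSpace N s} (hy : Hom d y) :
    xLast N s * iota N s y = ((s ^ 2) ^ d)⁻¹ • (iota N s y * xLast N s) := by
  have h0 : (s ^ 2) ^ d ≠ 0 := pow_ne_zero _ (pow_ne_zero _ Generic.ne_zero)
  rw [iota_mul_xLast_of_hom hy, smul_smul, inv_mul_cancel₀ h0, one_smul]

theorem commute_of_gen {x : QSpace N s} (h : ∀ i, Commute x (gen N s i)) (p : QSpace N s) :
    Commute x p := by
  induction p using gen_induction with
  | hc z => exact (Algebra.commutes z x).symm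
  | hg i => exact h i
  | hm a b ha hb => exact ha.mul_right hb
  | ha a b ha hb => exact ha.add_right hb

/-- For the outer generators this is `outerCoeff_relation`. For an inner generator, the q-factors
from passing x_1 and x_N are inverse to each other, and the inner radius commutes by hypothesis. -/
theorem commute_qRadius_step [Generic s] (N : ℕ)
    (ih : ∀ p, Commute (qRadius N s 0) p) (p : QSpace (N + 2) s) :
    Commute (qRadius (N + 2) s 0) p := by
  have h0 : s ≠ 0 := Generic.ne_zero
  have hr := outerCoeff_relation (s := s) N
  apply commute_of_gen
  intro i
  unfold Commute SemiconjBy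
  rw [qRadius_step]
  induction i using index_cases with
  | h0 =>
    rw [add_mul, mul_add, smul_mul_assoc, smul_mul_assoc, mul_smul_comm, mul_smul_comm, mul_assoc,
      xLast_mul_xFirst, mul_add, mul_smul_comm, smul_add, smul_smul, hr,
      iota_mul_xFirst_of_hom (Hom.qRadius 0)]
    module
  | hl =>
    rw [add_mul, mul_add, smul_mul_assoc, smul_mul_assoc, mul_smul_comm, mul_smul_comm,
      ← mul_assoc (gen (N + 2) s (Fin.last (N + 1))), xLast_mul_xFirst, add_mul, smul_mul_assoc,
      smul_add, smul_smul, hr, xLast_mul_iota_of_hom (Hom.qRadius 0)]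
    module
  | hi i =>
    have h1 := xFirst_mul_iota_of_hom (Hom.gen (s := s) i)
    have h2 := xLast_mul_iota_of_hom (Hom.gen (s := s) i)
    have h3 : iota N s (qRadius N s 0) * iota N s (gen N s i) =
      iota N s (gen N s i) * iota N s (qRadius N s 0) := by
      rw [← map_mul, ← map_mul, ih]
    rw [iota_gen] at h1 h2 h3
    rw [add_mul, mul_add, smul_mul_assoc, smul_mul_assoc, mul_smul_comm, mul_smul_comm, h3,
      mul_assoc, h2, mul_smul_comm, ← mul_assoc, h1, smul_mul_assoc, smul_smul ((_ : ℂ)⁻¹), pow_one,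
      inv_mul_cancel₀ (pow_ne_zero _ h0), one_smul, mul_assoc]

theorem commute_qRadius [Generic s] : ∀ (N : ℕ) (p : QSpace N s), Commute (qRadius N s 0) p
  | 0, p => by
    rw [qRadius_zero]
    simp
  | 1, p => by
    rw [qRadius_one_zero]
    apply commute_of_gen
    intro i
    rw [Fin.fin_one_eq_zero i]
    exact (Commute.refl _).pow_left 2
  | N + 2, p => commute_qRadius_step N (commute_qRadius N) p

/-- The element `x_1 ^ a y x_N ^ b` with `y` in the inner subalgebra. -/
def tri (a : ℕ) (y : QSpace N s) (b : ℕ) : QSpace (N + 2) s :=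
  xFirst N s ^ a * iota N s y * xLast N s ^ b

theorem tri_add (a b : ℕ) (y z : QSpace N s) : tri a (y + z) b = tri a y b + tri a z b := by
  simp only [tri, map_add, mul_add, add_mul]

theorem tri_smul (a b : ℕ) (c : ℂ) (y : QSpace N s) : tri a (c • y) b = c • tri a y b := by
  simp only [tri, map_smul, mul_smul_comm, smul_mul_assoc]

theorem tri_zero (a b : ℕ) : tri a (0 : QSpace N s) b = 0 := by
  simp only [tri, map_zero, mul_zero, zero_mul]

theorem tri_sum {ι : Type*} (t : Finset ι) (f : ι → QSpace N s) (a b : ℕ) :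
    tri a (∑ i ∈ t, f i) b = ∑ i ∈ t, tri a (f i) b := by
  simp only [tri, map_sum, Finset.mul_sum, Finset.sum_mul]

theorem iota_eq_tri (y : QSpace N s) : iota N s y = tri 0 y 0 := by
  simp [tri]

theorem xFirst_mul_tri (a : ℕ) (y : QSpace N s) (b : ℕ) :
    xFirst N s * tri a y b = tri (a + 1) y b := by
  simp only [tri, ← mul_assoc, ← pow_succ']

theorem tri_mul_xLast (a : ℕ) (y : QSpace N s) (b : ℕ) :
    tri a y b * xLast N s = tri a y (b + 1) := by
  simp only [tri, mul_assoc, ← pow_succ]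

theorem mul_inv_pow_succ {z : ℂ} (hz : z ≠ 0) (a : ℕ) : z * z⁻¹ ^ (a + 1) = z⁻¹ ^ a := by
  rw [pow_succ', mul_inv_cancel_left₀ hz]

theorem scale_scale_inv (z : ℂ) (hz : z ≠ 0) (y : QSpace N s) :
    scale z (scale z⁻¹ y) = y := by
  rw [scale_scale, mul_inv_cancel₀ hz, scale_one]

theorem iota_mul_xFirst_pow [Generic s] (y : QSpace N s) (a : ℕ) :
    iota N s y * xFirst N s ^ a = xFirst N s ^ a * iota N s (scale ((s ^ 2)⁻¹ ^ a) y) := by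
  have h0 : s ^ 2 ≠ 0 := pow_ne_zero _ Generic.ne_zero
  induction a generalizing y with
  | zero => simp [scale_one]
  | succ a ih =>
    rw [pow_succ (xFirst N s), ← mul_assoc, ih, mul_assoc, mul_assoc, xFirst_mul_iota, scale_scale]
    rw [mul_inv_pow_succ h0]

theorem iota_mul_tri [Generic s] (z : QSpace N s) (a : ℕ) (y : QSpace N s) (b : ℕ) :
    iota N s z * tri a y b = tri a (scale ((s ^ 2)⁻¹ ^ a) z * y) b := by
  rw [tri, ← mul_assoc, ← mul_assoc, iota_mul_xFirst_pow, tri, map_mul]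
  simp only [mul_assoc]

theorem xLast_mul_iota [Generic s] (y : QSpace N s) :
    xLast N s * iota N s y = iota N s (scale (s ^ 2)⁻¹ y) * xLast N s := by
  rw [iota_mul_xLast, scale_scale_inv _ (pow_ne_zero _ Generic.ne_zero)]

/-- The sum `1 + q ^ (-2) + ⋯ + q ^ (-2 (a - 1))`. -/
def geoSum (s : ℂ) (a : ℕ) : ℂ := ∑ i ∈ range a, ((s ^ 2)⁻¹ ^ i) ^ 2

theorem scale_qRadius (z : ℂ) : scale z (qRadius N s 0) = z ^ 2 • qRadius N s 0 := by
  rw [qRadius_zero, map_sum, Finset.smul_sum]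
  refine Finset.sum_congr rfl fun i _ => ?_
  rw [map_smul, map_mul, scale_gen, scale_gen, smul_mul_smul_comm, smul_comm, ← pow_two]

theorem geoSum_succ (s : ℂ) (a : ℕ) :
    geoSum s (a + 1) = geoSum s a + ((s ^ 2)⁻¹ ^ a) ^ 2 := by
  rw [geoSum, sum_range_succ, geoSum]

/-- Each exchange of x_N with a factor x_1 leaves one inner radius, and moving that past i further
factors x_1 costs q^(-2i). The costs add up to `geoSum`. -/
theorem xLast_mul_xFirst_pow [Generic s] (a : ℕ) :
    xLast N s * xFirst N s ^ (a + 1) = xFirst N s ^ (a + 1) * xLast N s +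
      (outerCoeff N s * geoSum s (a + 1)) • (xFirst N s ^ a * iota N s (qRadius N s 0)) := by
  induction a with
  | zero => simp [geoSum, xLast_mul_xFirst]
  | succ a ih =>
    rw [pow_succ' (xFirst N s) (a + 1), ← mul_assoc, xLast_mul_xFirst, add_mul, mul_assoc, ih,
      smul_mul_assoc, iota_mul_xFirst_pow, scale_qRadius, map_smul, mul_add, mul_smul_comm,
      mul_smul_comm, ← mul_assoc, ← mul_assoc, ← pow_succ', geoSum_succ s (a + 1),
      ← pow_succ' (xFirst N s) a]
    module

theorem xLast_mul_tri_succ [Generic s] (a : ℕ) (y : QSpace N s) (b : ℕ) :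
    xLast N s * tri (a + 1) y b = tri (a + 1) (scale (s ^ 2)⁻¹ y) (b + 1) +
      (outerCoeff N s * geoSum s (a + 1)) • tri a (qRadius N s 0 * y) b := by
  rw [tri, ← mul_assoc, ← mul_assoc, xLast_mul_xFirst_pow, add_mul, add_mul, mul_assoc _ (xLast N s),
    xLast_mul_iota, smul_mul_assoc, smul_mul_assoc, tri, tri, pow_succ' (xLast N s), map_mul]
  simp only [mul_assoc]

theorem xLast_mul_tri_zero [Generic s] (y : QSpace N s) (b : ℕ) :
    xLast N s * tri 0 y b = tri 0 (scale (s ^ 2)⁻¹ y) (b + 1) := by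
  rw [tri, pow_zero, one_mul, ← mul_assoc, xLast_mul_iota, tri, pow_zero, one_mul,
    pow_succ' (xLast N s), mul_assoc]

/-- The additive closure of the normally ordered elements contains 1 and is stable under left
multiplication by every generator, by the reordering formulas; hence it is everything. -/
theorem tri_induction [Generic s] {P : QSpace (N + 2) s → Prop} (ht : ∀ a y b, P (tri a y b))
    (ha : ∀ x y, P x → P y → P (x + y)) (p : QSpace (N + 2) s) : P p := by
  let S : AddSubmonoid (QSpace (N + 2) s) :=
    AddSubmonoid.closure {x | ∃ a y b, x = tri (N := N) (s := s) a y b}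
  have hS : ∀ a (y : QSpace N s) b, tri a y b ∈ S := fun a y b =>
    AddSubmonoid.subset_closure ⟨a, y, b, rfl⟩
  have hg : ∀ i, ∀ r ∈ S, gen (N + 2) s i * r ∈ S := by
    intro i r hr
    induction hr using AddSubmonoid.closure_induction with
    | mem x hx =>
      obtain ⟨a, y, b, rfl⟩ := hx
      induction i using index_cases with
      | h0 => rw [xFirst_mul_tri]; exact hS _ _ _
      | hl =>
        cases a with
        | zero => rw [xLast_mul_tri_zero]; exact hS _ _ _
        | succ a =>
          rw [xLast_mul_tri_succ, ← tri_smul]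
          exact S.add_mem (hS _ _ _) (hS _ _ _)
      | hi i => rw [← iota_gen, iota_mul_tri]; exact hS _ _ _
    | zero => rw [mul_zero]; exact S.zero_mem
    | add x y _ _ h1 h2 => rw [mul_add]; exact S.add_mem h1 h2
  have hz : ∀ (z : ℂ), ∀ r ∈ S, z • r ∈ S := by
    intro z r hr
    induction hr using AddSubmonoid.closure_induction with
    | mem x hx =>
      obtain ⟨a, y, b, rfl⟩ := hx
      rw [← tri_smul]; exact hS _ _ _
    | zero => rw [smul_zero]; exact S.zero_mem
    | add x y _ _ h1 h2 => rw [smul_add]; exact S.add_mem h1 h2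
  have hall : ∀ x, ∀ r ∈ S, x * r ∈ S := by
    intro x
    induction x using gen_induction with
    | hc z => intro r hr; rw [← Algebra.smul_def]; exact hz z r hr
    | hg i => exact hg i
    | hm x y h1 h2 => intro r hr; rw [mul_assoc]; exact h1 _ (h2 r hr)
    | ha x y h1 h2 => intro r hr; rw [add_mul]; exact S.add_mem (h1 r hr) (h2 r hr)
  have h1 : (1 : QSpace (N + 2) s) ∈ S := by
    have := hS 0 1 0
    rwa [← iota_eq_tri, map_one] at this
  have hp := hall p 1 h1
  rw [mul_one] at hp
  induction hp using AddSubmonoid.closure_induction with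
  | mem x hx =>
    obtain ⟨a, y, b, rfl⟩ := hx
    exact ht a y b
  | zero => rw [← tri_zero 0 0]; exact ht _ _ _
  | add x y _ _ h1 h2 => exact ha _ _ h1 h2

end Radius

/-! ### Uniqueness of the normal form -/

section Coeff

variable {N : ℕ} {s : ℂ}

/-- The action of the inner subalgebra on coefficient functions. -/
def innerAction (N : ℕ) (s : ℂ) : QSpace N s →ₐ[ℂ] Module.End ℂ (ℕ → ℕ → QSpace N s) :=
  AlgHom.ofLinearMap
    { toFun := fun y =>
        { toFun := fun f a b => scale ((s ^ 2)⁻¹ ^ a) y * f a b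
          map_add' := fun f g => by funext a b; exact mul_add _ _ _
          map_smul' := fun c f => by funext a b; exact mul_smul_comm c (scale _ y) (f a b) }
      map_add' := fun y z => by
        refine LinearMap.ext fun f => funext fun a => funext fun b => ?_
        change scale _ (y + z) * f a b = scale _ y * f a b + scale _ z * f a b
        rw [map_add, add_mul]
      map_smul' := fun c y => by
        refine LinearMap.ext fun f => funext fun a => funext fun b => ?_
        change scale _ (c • y) * f a b = c • (scale _ y * f a b)
        rw [map_smul, smul_mul_assoc] }
    (by
      refine LinearMap.ext fun f => funext fun a => funext fun b => ?_
      change scale _ 1 * f a b = f a b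
      rw [map_one, one_mul])
    (fun y z => by
      refine LinearMap.ext fun f => funext fun a => funext fun b => ?_
      change scale _ (y * z) * f a b = scale _ y * (scale _ z * f a b)
      rw [map_mul, mul_assoc])

theorem innerAction_apply (y : QSpace N s) (f : ℕ → ℕ → QSpace N s) (a b : ℕ) :
    innerAction N s y f a b = scale ((s ^ 2)⁻¹ ^ a) y * f a b := rfl

/-- The action of the first generator on coefficient functions. -/
def firstAction (N : ℕ) (s : ℂ) : Module.End ℂ (ℕ → ℕ → QSpace N s) where
  toFun f a b := match a with | 0 => 0 | a + 1 => f a b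
  map_add' f g := by
    funext a b
    cases a
    · exact (add_zero _).symm
    · rfl
  map_smul' c f := by
    funext a b
    cases a
    · exact (smul_zero c).symm
    · rfl

/-- The action of the last generator on coefficient functions. -/
def lastAction (N : ℕ) (s : ℂ) : Module.End ℂ (ℕ → ℕ → QSpace N s) where
  toFun f a b := scale (s ^ 2)⁻¹ (match b with | 0 => 0 | b + 1 => f a b) +
    (outerCoeff N s * geoSum s (a + 1)) • (qRadius N s 0 * f (a + 1) b)
  map_add' f g := by
    funext a b
    simp only [Pi.add_apply, mul_add, smul_add]
    cases b with
    | zero => simp only [map_zero, zero_add]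
    | succ b =>
      simp only [map_add]
      abel
  map_smul' c f := by
    funext a b
    simp only [Pi.smul_apply, mul_smul_comm, smul_add, RingHom.id_apply]
    rw [smul_comm]
    cases b with
    | zero => simp only [map_zero, smul_zero]
    | succ b => simp only [map_smul]

theorem firstAction_zero (f : ℕ → ℕ → QSpace N s) (b : ℕ) : firstAction N s f 0 b = 0 := rfl

theorem firstAction_succ (f : ℕ → ℕ → QSpace N s) (a b : ℕ) :
    firstAction N s f (a + 1) b = f a b := rfl

theorem lastAction_zero (f : ℕ → ℕ → QSpace N s) (a : ℕ) : lastAction N s f a 0 =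
    (outerCoeff N s * geoSum s (a + 1)) • (qRadius N s 0 * f (a + 1) 0) := by
  change scale _ 0 + _ = _
  rw [map_zero, zero_add]

theorem lastAction_succ (f : ℕ → ℕ → QSpace N s) (a b : ℕ) : lastAction N s f a (b + 1) =
    scale (s ^ 2)⁻¹ (f a b) +
      (outerCoeff N s * geoSum s (a + 1)) • (qRadius N s 0 * f (a + 1) (b + 1)) := rfl

/-- The operators imitate left multiplication on the coefficients of x_1^a y x_N^b. Checking the
relations makes the coefficient functions an honest module, without presupposing independence of the
normal forms. Centrality of the inner radius enters in the relation between x_N and the inner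
generators. -/
theorem exists_outerRep [Generic s] (N : ℕ) :
    ∃ ψ : QSpace (N + 2) s →ₐ[ℂ] Module.End ℂ (ℕ → ℕ → QSpace N s),
      ψ (xFirst N s) = firstAction N s ∧ ψ (xLast N s) = lastAction N s ∧
      ∀ y, ψ (iota N s y) = innerAction N s y := by
  have h0 : s ^ 2 ≠ 0 := pow_ne_zero _ Generic.ne_zero
  obtain ⟨ψ, h1, h2, h3⟩ := exists_liftStep (innerAction N s) (firstAction N s) (lastAction N s)
    (by
      intro i
      refine LinearMap.ext fun f => funext fun a => funext fun b => ?_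
      change firstAction N s (innerAction N s _ f) a b =
        s ^ 2 • innerAction N s _ (firstAction N s f) a b
      cases a with
      | zero => rw [firstAction_zero, innerAction_apply, firstAction_zero, mul_zero, smul_zero]
      | succ a =>
        rw [firstAction_succ, innerAction_apply, innerAction_apply, firstAction_succ, scale_gen,
          scale_gen, smul_mul_assoc, smul_mul_assoc, smul_smul, mul_inv_pow_succ h0])
    (by
      intro i
      refine LinearMap.ext fun f => funext fun a => funext fun b => ?_
      change innerAction N s _ (lastAction N s f) a b =
        s ^ 2 • lastAction N s (innerAction N s _ f) a b
      have hc : ∀ x : QSpace N s, gen N s i * (qRadius N s 0 * x) =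
          qRadius N s 0 * (gen N s i * x) := by
        intro x
        rw [← mul_assoc, ← mul_assoc, (commute_qRadius N (gen N s i)).eq]
      have h4 : s ^ 2 * (s ^ 2)⁻¹ ^ (a + 1) = (s ^ 2)⁻¹ ^ a := mul_inv_pow_succ h0 a
      cases b with
      | zero =>
        rw [innerAction_apply, lastAction_zero, lastAction_zero, innerAction_apply, scale_gen,
          scale_gen, smul_mul_assoc, mul_smul_comm, hc, smul_mul_assoc, mul_smul_comm, ← h4]
        module
      | succ b =>
        rw [innerAction_apply, lastAction_succ, lastAction_succ, innerAction_apply,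
          innerAction_apply, scale_gen, scale_gen, smul_mul_assoc, mul_add, mul_smul_comm, hc,
          smul_mul_assoc, smul_mul_assoc, mul_smul_comm, map_smul, map_mul, scale_gen,
          smul_mul_assoc, ← h4]
        rw [smul_add, smul_add, smul_smul, smul_smul, smul_smul, smul_smul, smul_smul]
        congr 1
        · congr 1
          field_simp
        · congr 1
          ring)
    (by
      refine LinearMap.ext fun f => funext fun a => funext fun b => ?_
      change lastAction N s (firstAction N s f) a b - firstAction N s (lastAction N s f) a b =
          outerCoeff N s • innerAction N s (qRadius N s 0) f a b
      rw [sub_eq_iff_eq_add', innerAction_apply, scale_qRadius]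
      rcases a with _ | a <;> rcases b with _ | b
      · rw [lastAction_zero, firstAction_zero, firstAction_succ]
        simp [geoSum]
      · rw [lastAction_succ, firstAction_zero, firstAction_succ, firstAction_zero]
        simp [geoSum]
      · rw [lastAction_zero, firstAction_succ, firstAction_succ, lastAction_zero,
          geoSum_succ s (a + 1), smul_mul_assoc]
        module
      · rw [lastAction_succ, firstAction_succ, firstAction_succ, firstAction_succ, lastAction_succ,
          geoSum_succ s (a + 1), smul_mul_assoc]
        module)
  refine ⟨ψ, h1, h2, fun y => ?_⟩
  induction y using gen_induction with
  | hc z => rw [AlgHom.commutes, AlgHom.commutes, AlgHom.commutes]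
  | hg i => rw [iota_gen, h3]
  | hm x y hx hy => rw [map_mul, map_mul, map_mul, hx, hy]
  | ha x y hx hy => rw [map_add, map_add, map_add, hx, hy]

/-- The representation of `𝒜` on coefficient functions. -/
def outerRep (N : ℕ) (s : ℂ) [Generic s] :
    QSpace (N + 2) s →ₐ[ℂ] Module.End ℂ (ℕ → ℕ → QSpace N s) :=
  (exists_outerRep N).choose

/-- The coefficient `y` of `x_1 ^ a y x_N ^ b`. -/
def coeff [Generic s] (a b : ℕ) : QSpace (N + 2) s →ₗ[ℂ] QSpace N s where
  toFun p := outerRep N s p (Pi.single 0 (Pi.single 0 1)) a b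
  map_add' p r := by rw [map_add]; rfl
  map_smul' c p := by rw [map_smul]; rfl

/-- Acting on the function with value 1 at (0, 0) and zero elsewhere, a normally ordered element
produces the function concentrated at its own exponents with value y. -/
theorem coeff_tri [Generic s] (a b a' b' : ℕ) (y : QSpace N s) :
    coeff a b (tri a' y b') = if a = a' ∧ b = b' then y else 0 := by
  obtain ⟨h1, h2, h3⟩ := (exists_outerRep (s := s) N).choose_spec
  change outerRep N s (xFirst N s) = _ at h1
  change outerRep N s (xLast N s) = _ at h2
  change ∀ y, outerRep N s (iota N s y) = _ at h3
  -- On functions supported at a = 0 the action of x_N only shifts b, since its second term reads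
  -- the value at a + 1.
  have hl : ∀ b : ℕ, (lastAction N s ^ b) (Pi.single 0 (Pi.single 0 1)) =
      Pi.single 0 (Pi.single b 1) := by
    intro b
    induction b with
    | zero => rfl
    | succ b ih =>
      rw [pow_succ', Module.End.mul_apply, ih]
      funext i j
      rcases j with _ | j
      · rw [lastAction_zero]
        rcases i with _ | i <;> simp
      · rw [lastAction_succ]
        rcases i with _ | i
        · simp only [Pi.single_eq_same, Pi.single_apply, zero_add, one_ne_zero,
            if_false, Pi.zero_apply, mul_zero, smul_zero, add_zero, Nat.add_right_cancel_iff]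
          split_ifs
          · exact map_one _
          · exact map_zero _
        · simp
  have hf : ∀ (a' : ℕ) (g : ℕ → QSpace N s), (firstAction N s ^ a') (Pi.single 0 g) =
      Pi.single a' g := by
    intro a' g
    induction a' with
    | zero => rfl
    | succ a' ih =>
      rw [pow_succ', Module.End.mul_apply, ih]
      funext i j
      rcases i with _ | i
      · rw [firstAction_zero]; simp
      · rw [firstAction_succ]
        simp [Pi.single_apply]
  have hi : innerAction N s y (Pi.single 0 (Pi.single b' 1)) = Pi.single 0 (Pi.single b' y) := by
    funext i j
    rw [innerAction_apply]
    rcases i with _ | i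
    · rw [pow_zero, scale_one, Pi.single_eq_same, Pi.single_eq_same]
      by_cases h : j = b'
      · subst h; simp
      · simp [h]
    · simp
  change outerRep N s (tri a' y b') (Pi.single 0 (Pi.single 0 1)) a b = _
  rw [tri, map_mul, map_mul, map_pow, map_pow, h1, h2, h3, Module.End.mul_apply,
    Module.End.mul_apply, hl, hi, hf]
  by_cases e1 : a = a'
  · subst e1
    by_cases e2 : b = b'
    · subst e2; simp
    · simp [e2]
  · simp [e1]

end Coeff

end QEuclid
end

/-! ### The basis of ordered monomials and the grading -/

noncomputable section
namespace QEuclid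

open Finset

section Basis

variable {N : ℕ} {s : ℂ}

/-- Apply to a vanishing combination the functional of an index of maximal height among those with
nonzero coefficient: only its own term survives. -/
theorem linearIndependent_of_triangular {ι V : Type*} [AddCommGroup V] [Module ℂ V] {v : ι → V}
    (ht : ι → ℕ) (f : ι → V →ₗ[ℂ] ℂ) (h0 : ∀ i j, i ≠ j → ht j ≤ ht i → f i (v j) = 0)
    (h1 : ∀ i, f i (v i) ≠ 0) : LinearIndependent ℂ v := by
  classical
  rw [linearIndependent_iff']
  intro t g hg
  by_contra! hne
  obtain ⟨i, hi, hmax⟩ := Finset.exists_max_image (t.filter fun i => g i ≠ 0) ht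
    (by obtain ⟨i, hi, hgi⟩ := hne; exact ⟨i, by simp [hi, hgi]⟩)
  rw [Finset.mem_filter] at hi
  have h := congrArg (f i) hg
  rw [map_sum, map_zero, Finset.sum_eq_single_of_mem i hi.1, map_smul, smul_eq_mul,
    mul_eq_zero] at h
  · exact h.elim hi.2 (h1 i)
  · intro j hj hji
    rw [map_smul, smul_eq_mul, mul_eq_zero]
    by_cases hgj : g j = 0
    · exact Or.inl hgj
    · exact Or.inr (h0 i j hji.symm (hmax j (by simp [hj, hgj])))

theorem linearIndependent_of_dual {ι V : Type*} [AddCommGroup V] [Module ℂ V] {v : ι → V}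
    (f : ι → V →ₗ[ℂ] ℂ) (h0 : ∀ i j, i ≠ j → f i (v j) = 0) (h1 : ∀ i, f i (v i) ≠ 0) :
    LinearIndependent ℂ v :=
  linearIndependent_of_triangular (fun _ => 0) f (fun i j hij _ => h0 i j hij) h1

theorem mono_eq_tri (ν : Fin (N + 2) → ℕ) :
    mono (N + 2) s ν = tri (ν 0) (mono N s fun i => ν (inner i)) (ν (Fin.last _)) := by
  rw [mono, List.ofFn_succ', List.concat_eq_append, List.prod_append, List.prod_singleton,
    List.ofFn_succ, List.prod_cons, tri, mono, map_list_prod, List.map_ofFn]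
  congr 4
  funext i
  rw [Function.comp_apply, map_pow, iota_gen]
  rfl

/-- The multi-index with outer entries `a`, `b` and inner entries `ν`. -/
def outerIndex (a : ℕ) (ν : Fin N → ℕ) (b : ℕ) : Fin (N + 2) → ℕ :=
  fun i => if h : i = 0 then a else if h' : i = Fin.last _ then b else
    ν ⟨i - 1, by
        have := Fin.val_ne_of_ne h'
        have := Fin.val_ne_of_ne h
        simp only [Fin.val_last, Fin.val_zero] at *
        omega⟩

@[simp] theorem outerIndex_zero (a : ℕ) (ν : Fin N → ℕ) (b : ℕ) : outerIndex a ν b 0 = a := by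
  simp [outerIndex]

@[simp] theorem outerIndex_last (a : ℕ) (ν : Fin N → ℕ) (b : ℕ) :
    outerIndex a ν b (Fin.last _) = b := by
  simp [outerIndex]

@[simp] theorem outerIndex_inner (a : ℕ) (ν : Fin N → ℕ) (b : ℕ) (i : Fin N) :
    outerIndex a ν b (inner i) = ν i := by
  simp [outerIndex]

theorem mono_outerIndex (a : ℕ) (ν : Fin N → ℕ) (b : ℕ) :
    mono (N + 2) s (outerIndex a ν b) = tri a (mono N s ν) b := by
  rw [mono_eq_tri]
  simp

theorem eq_outerIndex (ν : Fin (N + 2) → ℕ) :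
    ν = outerIndex (ν 0) (fun i => ν (inner i)) (ν (Fin.last _)) := by
  funext i
  induction i using index_cases <;> simp

/-- The embedding of the algebra for `N = 1` into the polynomial ring. -/
def toPoly (s : ℂ) : QSpace 1 s →ₐ[ℂ] Polynomial ℂ :=
  liftGen (fun _ => Polynomial.X) (by
    intro a b h
    cases h with
    | comm i j hij hne => exact absurd hij (by omega)
    | cross i hi => omega
    | odd i k hk hi => omega
    | even i hi => omega)

theorem mono_one (s : ℂ) (ν : Fin 1 → ℕ) : mono 1 s ν = gen 1 s 0 ^ ν 0 := by
  simp [mono]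

theorem mono_zero (s : ℂ) (ν : Fin 0 → ℕ) : mono 0 s ν = 1 := by
  simp [mono]

/-- In the inductive step a dual family is obtained by first taking the coefficient at the outer
exponents and then an inner coordinate; spanning is `tri_induction`. -/
theorem linearIndependent_mono [Generic s] (N : ℕ) : LinearIndependent ℂ (mono N s) ∧
    ⊤ ≤ Submodule.span ℂ (Set.range (mono N s)) := by
  induction N using Nat.twoStepInduction with
  | zero =>
    constructor
    · let f : QSpace 0 s →ₐ[ℂ] ℂ := liftGen (fun i => i.elim0) (by
        intro a b h
        cases h with
        | comm i j hij hne => exact i.elim0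
        | cross i hi => exact i.elim0
        | odd i k hk hi => exact i.elim0
        | even i hi => exact i.elim0)
      refine linearIndependent_of_dual (fun _ => f.toLinearMap) (fun i j h => ?_) (fun i => ?_)
      · exact absurd (Subsingleton.elim i j) h
      · rw [mono_zero]
        simp
    · intro p _
      induction p using gen_induction with
      | hc z =>
        rw [Algebra.algebraMap_eq_smul_one]
        exact Submodule.smul_mem _ _ (Submodule.subset_span ⟨0, mono_zero s 0⟩)
      | hg i => exact i.elim0
      | hm x y hx hy =>
        have hx := hx trivial
        have hy := hy trivial
        have e : Set.range (mono 0 s) = {1} := by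
          ext x
          simp [mono_zero, eq_comm]
        rw [e, Submodule.mem_span_singleton] at hx hy ⊢
        obtain ⟨a, rfl⟩ := hx
        obtain ⟨b, rfl⟩ := hy
        exact ⟨a * b, by rw [smul_mul_smul_comm, one_mul]⟩
      | ha x y hx hy => exact Submodule.add_mem _ (hx trivial) (hy trivial)
  | one =>
    constructor
    · refine linearIndependent_of_dual (fun ν => (Polynomial.lcoeff ℂ (ν 0)).comp
        (toPoly s).toLinearMap) (fun i j h => ?_) (fun i => ?_)
      · have hij : i 0 ≠ j 0 := fun e => h (funext fun k => by rw [Fin.fin_one_eq_zero k, e])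
        simp [mono_one, toPoly, liftGen_gen, Polynomial.coeff_X_pow, hij]
      · simp [mono_one, toPoly, liftGen_gen, Polynomial.coeff_X_pow]
    · have hk : ∀ k : ℕ, gen 1 s 0 ^ k ∈ Submodule.span ℂ (Set.range (mono 1 s)) := fun k =>
        Submodule.subset_span ⟨fun _ => k, mono_one s _⟩
      have hmul : ∀ p : QSpace 1 s, ∀ r ∈ Submodule.span ℂ (Set.range (mono 1 s)),
          p * r ∈ Submodule.span ℂ (Set.range (mono 1 s)) := by
        intro p
        induction p using gen_induction with
        | hc z => intro r hr; rw [← Algebra.smul_def]; exact Submodule.smul_mem _ _ hr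
        | hg i =>
          intro r hr
          induction hr using Submodule.span_induction with
          | mem x hx =>
            obtain ⟨ν, rfl⟩ := hx
            rw [mono_one, Fin.fin_one_eq_zero i, ← pow_succ']
            exact hk _
          | zero => rw [mul_zero]; exact Submodule.zero_mem _
          | add x y _ _ h1 h2 => rw [mul_add]; exact Submodule.add_mem _ h1 h2
          | smul a x _ h1 => rw [mul_smul_comm]; exact Submodule.smul_mem _ _ h1
        | hm x y h1 h2 => intro r hr; rw [mul_assoc]; exact h1 _ (h2 r hr)
        | ha x y h1 h2 => intro r hr; rw [add_mul]; exact Submodule.add_mem _ (h1 r hr) (h2 r hr)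
      intro p _
      have := hmul p _ (hk 0)
      rwa [pow_zero, mul_one] at this
  | more N ih _ =>
    let B : Module.Basis (Fin N → ℕ) ℂ (QSpace N s) := Module.Basis.mk ih.1 ih.2
    have hB : ∀ ν, B ν = mono N s ν := fun ν => Module.Basis.mk_apply ih.1 ih.2 ν
    constructor
    · refine linearIndependent_of_dual (fun ν => (B.coord fun i => ν (inner i)).comp
        (coeff (ν 0) (ν (Fin.last _)))) (fun μ ν h => ?_) (fun ν => ?_)
      · rw [LinearMap.comp_apply, mono_eq_tri, coeff_tri]
        split_ifs with h'
        · rw [← hB, Module.Basis.coord_apply, Module.Basis.repr_self, Finsupp.single_apply,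
            if_neg]
          intro e
          apply h
          rw [eq_outerIndex μ, eq_outerIndex ν, h'.1, h'.2, e]
        · exact map_zero _
      · rw [LinearMap.comp_apply, mono_eq_tri, coeff_tri, if_pos ⟨rfl, rfl⟩, ← hB,
          Module.Basis.coord_apply, Module.Basis.repr_self, Finsupp.single_apply, if_pos rfl]
        exact one_ne_zero
    · intro p _
      induction p using tri_induction with
      | ht a y b =>
        clear * - ih
        have hy := ih.2 (Submodule.mem_top (x := y))
        induction hy using Submodule.span_induction with
        | mem x hx =>
          obtain ⟨ν, rfl⟩ := hx
          rw [← mono_outerIndex]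
          exact Submodule.subset_span ⟨_, rfl⟩
        | zero => rw [tri_zero]; exact Submodule.zero_mem _
        | add x y _ _ h1 h2 => rw [tri_add]; exact Submodule.add_mem _ h1 h2
        | smul a x _ h1 => rw [tri_smul]; exact Submodule.smul_mem _ _ h1
      | ha x y hx hy => exact Submodule.add_mem _ (hx trivial) (hy trivial)

/-- The basis of ordered monomials. -/
def pbw (N : ℕ) (s : ℂ) [Generic s] : Module.Basis (Fin N → ℕ) ℂ (QSpace N s) :=
  Module.Basis.mk (linearIndependent_mono N).1 (linearIndependent_mono N).2

theorem pbw_apply [Generic s] (ν : Fin N → ℕ) : pbw N s ν = mono N s ν :=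
  Module.Basis.mk_apply _ _ ν

theorem constr_mono [Generic s] {M : Type*} [AddCommGroup M] [Module ℂ M]
    (f : (Fin N → ℕ) → M) (ν : Fin N → ℕ) : (pbw N s).constr ℂ f (mono N s ν) = f ν := by
  rw [← pbw_apply, Module.Basis.constr_basis]

theorem mono_induction [Generic s] {P : QSpace N s → Prop} (h : ∀ (c : ℂ) ν, P (c • mono N s ν))
    (ha : ∀ x y, P x → P y → P (x + y)) (p : QSpace N s) : P p := by
  rw [← (pbw N s).linearCombination_repr p, Finsupp.linearCombination_apply, Finsupp.sum]
  generalize ((pbw N s).repr p).support = t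
  induction t using Finset.induction_on with
  | empty => simpa using h 0 0
  | insert a t hat ih =>
    rw [Finset.sum_insert hat, pbw_apply]
    exact ha _ _ (h _ _) ih

theorem hom_induction [Generic s] {P : QSpace N s → Prop} (h : ∀ d p, Hom d p → P p)
    (ha : ∀ x y, P x → P y → P (x + y)) (p : QSpace N s) : P p :=
  mono_induction (fun c ν => h _ _ ((Hom.mono ν).smul c)) ha p

/-- The projection to the homogeneous component of degree `d`. -/
def proj [Generic s] (d : ℕ) : QSpace N s →ₗ[ℂ] QSpace N s :=
  (pbw N s).constr ℂ fun ν => if ∑ i, ν i = d then mono N s ν else 0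

theorem proj_mono [Generic s] (d : ℕ) (ν : Fin N → ℕ) :
    proj d (mono N s ν) = if ∑ i, ν i = d then mono N s ν else 0 :=
  constr_mono _ ν

theorem proj_hom [Generic s] (d : ℕ) (p : QSpace N s) : Hom d (proj d p) := by
  induction p using mono_induction with
  | h c ν =>
    rw [map_smul, proj_mono]
    split_ifs with h
    · exact (h ▸ Hom.mono ν).smul c
    · rw [smul_zero]; exact Hom.zero
  | ha x y hx hy => rw [map_add]; exact hx.add hy

theorem proj_scale [Generic s] (d : ℕ) (p : QSpace N s) :
    proj d (scale (s ^ 2) p) = (s ^ 2) ^ d • proj d p := by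
  induction p using mono_induction with
  | h c ν =>
    rw [map_smul, map_smul, map_smul, Hom.mono ν, map_smul, proj_mono]
    split_ifs with h
    · rw [h, smul_comm]
    · simp only [smul_zero]
  | ha x y hx hy => rw [map_add, map_add, map_add, hx, hy, smul_add]

theorem eq_of_proj_eq [Generic s] {p r : QSpace N s} (h : ∀ d, proj d p = proj d r) : p = r := by
  apply (pbw N s).repr.injective
  ext ν
  have key : ∀ x : QSpace N s, (pbw N s).repr (proj (∑ i, ν i) x) ν = (pbw N s).repr x ν := by
    intro x
    induction x using mono_induction with
    | h c μ =>
      rw [map_smul, map_smul, map_smul, proj_mono, Finsupp.smul_apply, Finsupp.smul_apply]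
      split_ifs with h
      · rfl
      · rw [map_zero, ← pbw_apply, Module.Basis.repr_self, Finsupp.single_apply, if_neg]
        · rfl
        · rintro rfl; exact h rfl
    | ha x y hx hy => 
      rw [map_add, map_add, map_add, Finsupp.add_apply, Finsupp.add_apply, hx, hy]
  rw [← key p, ← key r, h]

/-- Projection intertwines scaling by q, so the component of degree e is multiplied both by q^d and
by q^e. These differ because q is not a root of unity, which is why a single scaling detects the
degree. -/
theorem Hom.proj_of_ne [Generic s] {d e : ℕ} {p : QSpace N s} (hp : Hom d p) (he : e ≠ d) :
    proj e p = 0 := by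
  have h2 := proj_scale e p
  rw [hp, map_smul] at h2
  have h3 : ((s ^ 2) ^ d - (s ^ 2) ^ e) • proj e p = 0 := by
    rw [← smul_sub_smul_right, h2, sub_self]
  refine (smul_eq_zero.mp h3).resolve_left (sub_ne_zero.mpr ?_)
  have := Generic.zpow_ne_zpow s (k := 2 * d) (l := 2 * e) (by omega)
  rw [← pow_mul, ← pow_mul]
  exact_mod_cast this

theorem proj_proj [Generic s] (d : ℕ) (p : QSpace N s) : proj d (proj d p) = proj d p := by
  induction p using mono_induction with
  | h c ν =>
    rw [map_smul, map_smul, proj_mono]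
    split_ifs with h
    · rw [proj_mono, if_pos h]
    · rw [map_zero]
  | ha x y hx hy => rw [map_add, map_add, hx, hy]

theorem Hom.proj_self [Generic s] {d : ℕ} {p : QSpace N s} (hp : Hom d p) : proj d p = p := by
  apply eq_of_proj_eq
  intro k
  by_cases hk : k = d
  · rw [hk, proj_proj]
  · rw [(proj_hom d p).proj_of_ne hk, hp.proj_of_ne hk]

theorem mem_homogeneous_iff [Generic s] {d : ℕ} {p : QSpace N s} :
    p ∈ homogeneous N s d ↔ Hom d p := by
  constructor
  · intro h
    induction h using Submodule.span_induction with
    | mem x hx =>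
      obtain ⟨ν, rfl, rfl⟩ := hx
      exact Hom.mono ν
    | zero => exact Hom.zero
    | add x y _ _ h1 h2 => exact h1.add h2
    | smul a x _ h1 => exact h1.smul a
  · intro h
    rw [← h.proj_self]
    clear h
    induction p using mono_induction with
    | h c ν =>
      rw [map_smul, proj_mono]
      refine Submodule.smul_mem _ _ ?_
      split_ifs with h
      · exact Submodule.subset_span ⟨ν, h, rfl⟩
      · exact Submodule.zero_mem _
    | ha x y hx hy => rw [map_add]; exact Submodule.add_mem _ hx hy

theorem Hom.iota {d : ℕ} {y : QSpace N s} (hy : Hom d y) : Hom d (QEuclid.iota N s y) := by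
  have : ∀ y : QSpace N s, scale (s ^ 2) (QEuclid.iota N s y) = QEuclid.iota N s (scale (s ^ 2) y) := by
    intro y
    induction y using gen_induction with
    | hc z => simp only [AlgHom.commutes]
    | hg i => rw [iota_gen, scale_gen, scale_gen, map_smul, iota_gen]
    | hm x y hx hy => simp only [map_mul, hx, hy]
    | ha x y hx hy => simp only [map_add, hx, hy]
  rw [Hom, this, hy, map_smul]

theorem tri_hom_induction [Generic s] {P : QSpace (N + 2) s → Prop}
    (ht : ∀ a d y b, Hom d y → P (tri a y b)) (ha : ∀ x y, P x → P y → P (x + y))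
    (p : QSpace (N + 2) s) : P p := by
  refine tri_induction (fun a y b => ?_) ha p
  induction y using hom_induction with
  | h d p hp => exact ht a d p b hp
  | ha x y hx hy => rw [tri_add]; exact ha _ _ hx hy

theorem Hom.tri {d : ℕ} {y : QSpace N s} (hy : Hom d y) (a b : ℕ) :
    Hom (a + d + b) (QEuclid.tri a y b) := by
  have h1 := (Hom.gen (s := s) (0 : Fin (N + 2))).pow a
  have h2 := (Hom.gen (s := s) (Fin.last (N + 1))).pow b
  rw [mul_one] at h1 h2
  exact (h1.mul hy.iota).mul h2

end Basis

end QEuclid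
end

/-! ### The lowering operator and its relation to the Laplace operator -/

noncomputable section
namespace QEuclid

open Finset

section IndexSums

variable {N : ℕ} {M : Type*} [AddCommMonoid M]

theorem sum_eq_sum_ite_mem {ι : Type*} [Fintype ι] [DecidableEq ι] (t : Finset ι) (f : ι → M) :
    ∑ i ∈ t, f i = ∑ i, if i ∈ t then f i else 0 := by
  rw [Finset.sum_ite_mem, Finset.univ_inter]

theorem not_inner_lt_zero (i : Fin N) : ¬ inner i < 0 := not_lt.mpr (Fin.zero_le _)

theorem not_last_lt (i : Fin (N + 2)) : ¬ Fin.last (N + 1) < i := not_lt.mpr (Fin.le_last _)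

theorem inner_le_inner {i j : Fin N} : inner i ≤ inner j ↔ i ≤ j := by
  rw [← not_lt, inner_lt_inner, not_lt]

theorem sum_Iio_inner (j : Fin N) (f : Fin (N + 2) → M) :
    ∑ i ∈ Iio (inner j), f i = f 0 + ∑ i ∈ Iio j, f (inner i) := by
  rw [sum_eq_sum_ite_mem, sum_univ_inner, sum_eq_sum_ite_mem (Iio j)]
  simp [not_last_lt]

theorem sum_Ioi_inner (j : Fin N) (f : Fin (N + 2) → M) :
    ∑ i ∈ Ioi (inner j), f i = ∑ i ∈ Ioi j, f (inner i) + f (Fin.last _) := by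
  rw [sum_eq_sum_ite_mem, sum_univ_inner, sum_eq_sum_ite_mem (Ioi j)]
  simp

theorem sum_Ioi_zero (f : Fin (N + 2) → M) :
    ∑ i ∈ Ioi 0, f i = ∑ i, f (inner i) + f (Fin.last _) := by
  rw [sum_eq_sum_ite_mem, sum_univ_inner]
  simp

theorem sum_Ioi_last (f : Fin (N + 2) → M) : ∑ i ∈ Ioi (Fin.last (N + 1)), f i = 0 := by
  rw [sum_eq_sum_ite_mem, sum_univ_inner]
  simp [not_last_lt]

theorem sum_Iio_zero (f : Fin (N + 2) → M) : ∑ i ∈ Iio 0, f i = 0 := by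
  rw [sum_eq_sum_ite_mem, sum_univ_inner]
  simp

theorem sum_Ico_inner (j k : Fin N) (f : Fin (N + 2) → M) :
    ∑ i ∈ Ico (inner j) (inner k), f i = ∑ i ∈ Ico j k, f (inner i) := by
  rw [sum_eq_sum_ite_mem, sum_univ_inner, sum_eq_sum_ite_mem (Ico j k)]
  simp [not_last_lt, inner_le_inner]

theorem sum_Ico_zero_inner (k : Fin N) (f : Fin (N + 2) → M) :
    ∑ i ∈ Ico 0 (inner k), f i = f 0 + ∑ i ∈ Iio k, f (inner i) := by
  rw [sum_eq_sum_ite_mem, sum_univ_inner, sum_eq_sum_ite_mem (Iio k)]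
  simp [not_last_lt]

theorem sum_Ici_inner (j : Fin N) (f : Fin (N + 2) → M) :
    ∑ i ∈ Ici (inner j), f i = ∑ i ∈ Ici j, f (inner i) + f (Fin.last _) := by
  rw [sum_eq_sum_ite_mem, sum_univ_inner, sum_eq_sum_ite_mem (Ici j)]
  simp [inner_le_inner, Fin.le_last]

theorem sum_Ici_zero (f : Fin (N + 2) → M) :
    ∑ i ∈ Ici 0, f i = f 0 + ∑ i, f (inner i) + f (Fin.last _) := by
  rw [sum_eq_sum_ite_mem, sum_univ_inner]
  simp

theorem outerIndex_sub_single_zero (a : ℕ) (ν : Fin N → ℕ) (b k : ℕ) :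
    outerIndex a ν b - Pi.single 0 k = outerIndex (a - k) ν b := by
  funext i
  induction i using index_cases <;> simp

theorem outerIndex_add_single_zero (a : ℕ) (ν : Fin N → ℕ) (b k : ℕ) :
    outerIndex a ν b + Pi.single 0 k = outerIndex (a + k) ν b := by
  funext i
  induction i using index_cases <;> simp

theorem outerIndex_sub_single_last (a : ℕ) (ν : Fin N → ℕ) (b k : ℕ) :
    outerIndex a ν b - Pi.single (Fin.last _) k = outerIndex a ν (b - k) := by
  funext i
  induction i using index_cases <;> simp

theorem outerIndex_sub_single_inner (a : ℕ) (ν : Fin N → ℕ) (b : ℕ) (j : Fin N) (k : ℕ) :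
    outerIndex a ν b - Pi.single (inner j) k = outerIndex a (ν - Pi.single j k) b := by
  funext i
  induction i using index_cases <;> simp [Pi.single_apply]

theorem outerIndex_add_single_inner (a : ℕ) (ν : Fin N → ℕ) (b : ℕ) (j : Fin N) (k : ℕ) :
    outerIndex a ν b + Pi.single (inner j) k = outerIndex a (ν + Pi.single j k) b := by
  funext i
  induction i using index_cases <;> simp [Pi.single_apply]

end IndexSums

section Lowering

variable {N : ℕ} {s : ℂ}

/-- The value on ordered monomials of the degree-lowering operator proportional to the
`q`-Laplace operator on each homogeneous component. -/
def lowerMono (N : ℕ) (s : ℂ) (ν : Fin N → ℕ) : QSpace N s :=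
  ∑ j : Fin N with j < j.rev,
    (qNumber (s ^ 2) (ν j) * qNumber (s ^ 2) (ν j.rev) * s ^ (-rho2 N j)
      * (s ^ 2) ^ ((∑ i ∈ Iio j, ν i) + ∑ i ∈ Ioi j.rev, ν i)) •
      mono N s (ν - Pi.single j 1 - Pi.single j.rev 1)
  + ∑ j : Fin N with j = j.rev,
    (qBracket (s ^ 2) ((ν j : ℤ) - 1) * qBracket (s ^ 2) (ν j) / (1 + s ^ 2) * (s ^ 2) ^ 2
      * (s ^ 2) ^ ((∑ i, (ν i : ℤ)) - 2 * (ν j : ℤ))) •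
      mono N s (ν - Pi.single j 2)

variable [Generic s]

/-- The degree-lowering operator proportional to the `q`-Laplace operator on each homogeneous
component. -/
def lower (N : ℕ) (s : ℂ) [Generic s] : QSpace N s →ₗ[ℂ] QSpace N s :=
  (pbw N s).constr ℂ (lowerMono N s)

theorem lower_mono (ν : Fin N → ℕ) : lower N s (mono N s ν) = lowerMono N s ν :=
  constr_mono _ ν

/-- The number `(s ^ n - s ^ (-n)) / (q - q⁻¹)`. -/
def br (s : ℂ) (n : ℕ) : ℂ := (s ^ n - (s ^ n)⁻¹) / (s ^ 2 - (s ^ 2)⁻¹)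

omit [Generic s] in
theorem qNumber_eq_br (a : ℕ) : qNumber (s ^ 2) a = br s (2 * a) := by
  rw [qNumber, br, zpow_neg, zpow_natCast, pow_mul]

theorem qsq_ne_zero : s ^ 2 ≠ 0 := pow_ne_zero _ Generic.ne_zero

theorem pow_four_sub_one_ne_zero : s ^ 4 - 1 ≠ 0 := by
  have := Generic.pow_ne_one (s := s) 2 (by norm_num)
  rw [← pow_mul] at this
  exact sub_ne_zero.mpr this

/-- The outer pair gives the first term; every inner pair, and the middle index, only acquires the
factor q^(a+b). Later inductions on N use this recursion instead of the formula on monomials. -/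
theorem lower_tri (a b : ℕ) (y : QSpace N s) : lower (N + 2) s (tri a y b) =
    (br s (2 * a) * br s (2 * b) * (s ^ N)⁻¹) • tri (a - 1) y (b - 1) +
      (s ^ 2) ^ (a + b) • tri a (lower N s y) b := by
  have h0 : s ≠ 0 := Generic.ne_zero
  induction y using mono_induction with
  | h c ν =>
    rw [tri_smul, map_smul, map_smul, tri_smul, tri_smul, ← mono_outerIndex, lower_mono, lower_mono,
      smul_comm _ c, smul_comm _ c, ← smul_add]
    congr 1
    rw [lowerMono, Finset.sum_filter, Finset.sum_filter, sum_univ_inner, sum_univ_inner, lowerMono,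
      tri_add, tri_sum, tri_sum, smul_add, Finset.smul_sum, Finset.smul_sum, Finset.sum_filter,
      Finset.sum_filter]
    simp only [zero_rev, last_rev, inner_rev, inner_lt_inner, inner_inj, outerIndex_zero,
      outerIndex_last, outerIndex_inner, rho2_zero, rho2_inner, sum_Iio_zero, sum_Ioi_last,
      outerIndex_sub_single_zero, outerIndex_sub_single_last, outerIndex_sub_single_inner,
      mono_outerIndex, zero_ne_last, last_ne_zero, if_false, not_last_lt, Fin.last_pos, if_true,
      sum_Iio_inner, sum_Ioi_inner, sum_univ_inner, qNumber_eq_br, tri_smul, smul_smul, add_zero,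
      zero_add, pow_zero, mul_one, zpow_neg, zpow_natCast]
    rw [add_assoc]
    congr 2
    · refine Finset.sum_congr rfl fun j _ => ?_
      split_ifs
      · congr 1
        simp only [pow_add]
        ring
      · rfl
    · refine Finset.sum_congr rfl fun j _ => ?_
      split_ifs
      · congr 1
        rw [show (a : ℤ) + ∑ i, (ν i : ℤ) + b - 2 * (ν j : ℤ) =
          ((a + b : ℕ) : ℤ) + (∑ i, (ν i : ℤ) - 2 * (ν j : ℤ)) by push_cast; ring,
          zpow_add₀ qsq_ne_zero, zpow_natCast]
        ring
      · rfl
  | ha x y hx hy =>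
    rw [tri_add, map_add, hx, hy, map_add, tri_add, tri_add]
    module

theorem partialOp_mono (k : Fin N) (ν : Fin N → ℕ) :
    partialOp (pbw N s) k (mono N s ν) = partialMono N s k ν :=
  constr_mono _ ν

theorem partialOp_zero_tri (a b : ℕ) (y : QSpace N s) :
    partialOp (pbw (N + 2) s) 0 (tri a y b) =
      (br s (2 * a) * (s ^ 2) ^ b) • tri (a - 1) (scale (s ^ 2) y) b := by
  induction y using mono_induction with
  | h c ν =>
    rw [map_smul, tri_smul, tri_smul, map_smul, smul_comm _ c, Hom.mono ν, tri_smul,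
      ← mono_outerIndex, partialOp_mono]
    congr 1
    rw [partialMono, if_pos (by simp [Fin.lt_def]), outerIndex_sub_single_zero, mono_outerIndex, sum_Ioi_zero]
    simp only [outerIndex_zero, outerIndex_inner, outerIndex_last, qNumber_eq_br, smul_smul,
      pow_add]
    congr 1
    ring
  | ha x y hx hy => rw [tri_add, map_add, hx, hy, map_add, tri_add, smul_add]

/-- The correction sums in the last derivative assemble into x_1 times the lowering operator of the
inner factor. This is the origin of the coefficients in `lowerMono`. -/
theorem partialOp_last_tri (a b : ℕ) (y : QSpace N s) :
    partialOp (pbw (N + 2) s) (Fin.last _) (tri a y b) =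
      (br s (2 * b) * (s ^ 2) ^ a) • tri a y (b - 1) +
      ((s ^ 2 - (s ^ 2)⁻¹) * s ^ N * (s ^ 2) ^ (a + b)) • tri (a + 1) (lower N s y) b := by
  have h0 : s ≠ 0 := Generic.ne_zero
  induction y using mono_induction with
  | h c ν =>
    rw [map_smul, tri_smul, tri_smul, map_smul, tri_smul, smul_comm _ c, smul_comm _ c,
      ← mono_outerIndex, partialOp_mono, ← smul_add, lower_mono]
    congr 1
    rw [partialMono, if_neg (not_last_lt _), if_neg (by simp)]
    simp only [last_rev, outerIndex_zero, outerIndex_last, outerIndex_sub_single_last,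
      mono_outerIndex, sum_Ioi_last, add_zero, qNumber_eq_br]
    rw [add_assoc]
    congr 1
    rw [lowerMono, tri_add, tri_sum, tri_sum, smul_add, Finset.smul_sum, Finset.smul_sum,
      Finset.sum_filter, Finset.sum_filter, Finset.sum_filter, Finset.sum_filter, sum_univ_inner,
      sum_univ_inner]
    simp only [lt_irrefl, false_and, if_false, zero_add, zero_rev, last_rev, inner_rev,
      inner_lt_inner, inner_inj, zero_lt_inner, true_and, not_last_lt, and_false, zero_ne_last,
      last_ne_zero, add_zero, outerIndex_inner, outerIndex_zero, outerIndex_last, rho2_zero,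
      rho2_inner, sum_Ico_zero_inner, sum_Ioi_inner, sum_Ici_zero, outerIndex_add_single_zero,
      outerIndex_sub_single_inner, mono_outerIndex, qNumber_eq_br, tri_smul, smul_smul]
    congr 1
    · refine Finset.sum_congr rfl fun j _ => ?_
      split_ifs
      · congr 1
        rw [zpow_sub₀ h0, zpow_neg, zpow_natCast]
        simp only [pow_add]
        ring
      · rfl
    · refine Finset.sum_congr rfl fun j _ => ?_
      split_ifs
      · congr 1
        rw [show (a : ℤ) + ∑ i, (ν i : ℤ) + b - 2 * (ν j : ℤ) =
          ((a + b : ℕ) : ℤ) + (∑ i, (ν i : ℤ) - 2 * (ν j : ℤ)) by push_cast; ring,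
          zpow_add₀ qsq_ne_zero, zpow_natCast, zpow_natCast]
        ring
      · rfl
  | ha x y hx hy =>
    rw [tri_add, map_add, hx, hy, map_add, tri_add, tri_add]
    module

theorem partialOp_inner_tri (k : Fin N) (a b : ℕ) (y : QSpace N s) :
    partialOp (pbw (N + 2) s) (inner k) (tri a y b) =
      (s ^ 2) ^ b • tri a (partialOp (pbw N s) k y) b := by
  have h0 : s ≠ 0 := Generic.ne_zero
  induction y using mono_induction with
  | h c ν =>
    rw [map_smul, tri_smul, tri_smul, map_smul, smul_comm _ c, ← mono_outerIndex, partialOp_mono,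
      partialOp_mono]
    congr 1
    rw [partialMono, partialMono]
    simp only [inner_rev, inner_lt_inner, inner_inj]
    split_ifs
    · rw [sum_Ioi_inner, outerIndex_sub_single_inner, mono_outerIndex, tri_smul, smul_smul]
      simp only [outerIndex_inner, outerIndex_last, pow_add]
      congr 1
      ring
    · rw [sum_Ioi_inner, outerIndex_sub_single_inner, mono_outerIndex, tri_smul, smul_smul]
      simp only [outerIndex_inner, outerIndex_last, pow_add]
      congr 1
      ring
    · rw [tri_add, tri_add, tri_sum, tri_sum, smul_add, smul_add, Finset.smul_sum, Finset.smul_sum,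
        Finset.sum_filter, Finset.sum_filter, Finset.sum_filter, Finset.sum_filter, sum_univ_inner,
        sum_univ_inner]
      simp only [not_inner_lt_zero, false_and, if_false, zero_add, zero_rev, last_rev, inner_rev,
        inner_lt_inner, inner_inj, not_last_lt, and_false, zero_ne_last,
        last_ne_zero, add_zero, outerIndex_inner, outerIndex_last,
        rho2_inner, sum_Ico_inner, sum_Ioi_inner, sum_Ici_inner, outerIndex_add_single_inner,
        outerIndex_sub_single_inner, mono_outerIndex, tri_smul, smul_smul]
      congr 1
      · congr 1
        · congr 1
          simp only [pow_add]
          ring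
        · refine Finset.sum_congr rfl fun j _ => ?_
          split_ifs
          · congr 1
            simp only [pow_add]
            ring
          · rfl
      · refine Finset.sum_congr rfl fun j _ => ?_
        split_ifs
        · congr 1
          rw [show ∑ i ∈ Ici k.rev, (ν i : ℤ) + b - 2 * (ν j : ℤ) =
            (b : ℤ) + (∑ i ∈ Ici k.rev, (ν i : ℤ) - 2 * (ν j : ℤ)) by ring,
            zpow_add₀ qsq_ne_zero, zpow_natCast]
          ring
        · rfl
  | ha x y hx hy => rw [tri_add, map_add, hx, hy, map_add, tri_add, smul_add]

theorem lower_zero (p : QSpace 0 s) : lower 0 s p = 0 := by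
  induction p using mono_induction with
  | h c ν => rw [map_smul, lower_mono, lowerMono]; simp
  | ha x y hx hy => rw [map_add, hx, hy, add_zero]

theorem one_add_qsq_ne_zero : 1 + s ^ 2 ≠ 0 := by
  have := Generic.zpow_add_ne_zero s 0 2
  simpa using this

theorem lower_one_pow (m : ℕ) : lower 1 s (gen 1 s 0 ^ m) =
    (qBracket (s ^ 2) ((m : ℤ) - 1) * qBracket (s ^ 2) m / (1 + s ^ 2) * (s ^ 2) ^ 2
      * ((s ^ 2) ^ m)⁻¹) • gen 1 s 0 ^ (m - 2) := by
  have h := lower_mono (s := s) (fun _ : Fin 1 => m)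
  rw [mono_one] at h
  rw [h, lowerMono, Finset.sum_filter, Finset.sum_filter]
  simp only [univ_unique, Fin.default_eq_zero, sum_singleton, Fin.rev_zero, Fin.last_zero,
    lt_irrefl, if_false, if_true, zero_add, mono_one, Pi.sub_apply, Pi.single_eq_same]
  congr 2
  rw [show (m : ℤ) - 2 * m = -m by ring, zpow_neg, zpow_natCast]

theorem one_induction {P : QSpace 1 s → Prop} (h : ∀ (c : ℂ) m, P (c • gen 1 s 0 ^ m))
    (ha : ∀ x y, P x → P y → P (x + y)) (p : QSpace 1 s) : P p :=
  mono_induction (fun c ν => by rw [mono_one]; exact h c _) ha p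

omit [Generic s] in
theorem zero_induction {P : QSpace 0 s → Prop} (h : ∀ c : ℂ, P (c • 1)) (p : QSpace 0 s) : P p := by
  have : ∃ c : ℂ, p = c • 1 := by
    induction p using gen_induction with
    | hc z => exact ⟨z, Algebra.algebraMap_eq_smul_one z⟩
    | hg i => exact i.elim0
    | hm x y hx hy =>
      obtain ⟨a, rfl⟩ := hx
      obtain ⟨b, rfl⟩ := hy
      exact ⟨a * b, by rw [smul_mul_smul_comm, one_mul]⟩
    | ha x y hx hy =>
      obtain ⟨a, rfl⟩ := hx
      obtain ⟨b, rfl⟩ := hy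
      exact ⟨a + b, by rw [add_smul]⟩
  obtain ⟨c, rfl⟩ := this
  exact h c

omit [Generic s] in
theorem scale_iota (z : ℂ) (y : QSpace N s) : scale z (iota N s y) = iota N s (scale z y) := by
  induction y using gen_induction with
  | hc z => simp only [AlgHom.commutes]
  | hg i => rw [iota_gen, scale_gen, scale_gen, map_smul, iota_gen]
  | hm x y hx hy => simp only [map_mul, hx, hy]
  | ha x y hx hy => simp only [map_add, hx, hy]

omit [Generic s] in
theorem scale_tri (z : ℂ) (a b : ℕ) (y : QSpace N s) :
    scale z (tri a y b) = z ^ (a + b) • tri a (scale z y) b := by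
  rw [tri, map_mul, map_mul, map_pow, map_pow, scale_gen, scale_gen, scale_iota, smul_pow, smul_pow,
    smul_mul_assoc, mul_smul_comm, smul_mul_assoc, smul_smul, tri, ← pow_add, add_comm b a]

omit [Generic s] in
theorem br_zero : br s 0 = 0 := by simp [br]

/-- Expresses, also for inhomogeneous elements, that the degree drops by two. -/
theorem scale_lower (N : ℕ) (p : QSpace N s) :
    scale (s ^ 2) (lower N s p) = ((s ^ 2) ^ 2)⁻¹ • lower N s (scale (s ^ 2) p) := by
  have h0 : s ≠ 0 := Generic.ne_zero
  induction N using Nat.twoStepInduction with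
  | zero => simp [lower_zero]
  | one =>
    induction p using one_induction with
    | h c m =>
      simp only [map_smul, map_pow, scale_gen, smul_pow, lower_one_pow]
      rcases m with _ | _ | m
      · simp [qBracket]
      · simp [qBracket]
      · rw [show m + 1 + 1 - 2 = m by omega]
        simp only [smul_smul]
        congr 1
        field_simp
        ring
    | ha x y hx hy => simp only [map_add, smul_add, hx, hy]
  | more N ih _ =>
    induction p using tri_induction with
    | ht a y b =>
      rw [lower_tri, map_add, map_smul, map_smul, scale_tri, scale_tri, scale_tri, map_smul,
        lower_tri, ih, tri_smul]
      rcases a with _ | a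
      · simp only [mul_zero, br_zero, zero_mul, zero_smul, zero_add]
        module
      rcases b with _ | b
      · simp only [mul_zero, br_zero, zero_mul, zero_smul, zero_add]
        module
      rw [Nat.add_sub_cancel, Nat.add_sub_cancel]
      have : (s ^ 2) ^ (a + b) = ((s ^ 2) ^ 2)⁻¹ * (s ^ 2) ^ (a + 1 + (b + 1)) := by
        field_simp
        ring
      rw [this]
      module
    | ha x y hx hy => simp only [map_add, smul_add, hx, hy]

/-- The factor relating the Laplace operator and the lowering operator. -/
def laplaceFactor (N : ℕ) (s : ℂ) : ℂ := (s ^ 2)⁻¹ * (1 + (s ^ 2) ^ ((N : ℤ) - 2))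

/-- The inner summands form the Laplace operator of the smaller algebra, and the two outer summands
supply the rest of the recursion `lower_tri`. The scaling absorbs the degree-dependent powers of q.
-/
theorem laplace_eq (N : ℕ) (p : QSpace N s) :
    laplace (pbw N s) p = laplaceFactor N s • lower N s (scale (s ^ 2) p) := by
  have h0 : s ≠ 0 := Generic.ne_zero
  have hq := qsq_ne_zero (s := s)
  induction N using Nat.twoStepInduction with
  | zero => simp [lower_zero, laplace]
  | one =>
    induction p using one_induction with
    | h c m =>
      have hd : ∀ m : ℕ, partialOp (pbw 1 s) 0 (gen 1 s 0 ^ m) =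
          qBracket (s ^ 2) m • gen 1 s 0 ^ (m - 1) := by
        intro m
        have h := partialOp_mono (s := s) 0 (fun _ : Fin 1 => m)
        rw [mono_one] at h
        rw [h, partialMono]
        simp [mono_one]
      rw [laplace]
      simp only [univ_unique, Fin.default_eq_zero, sum_singleton, Fin.rev_zero, Fin.last_zero,
        LinearMap.smul_apply, LinearMap.comp_apply, map_smul, hd, map_pow, scale_gen, smul_pow,
        lower_one_pow]
      rcases m with _ | m
      · simp [qBracket]
      · rw [Nat.add_sub_cancel, laplaceFactor, show m + 1 - 2 = m - 1 by omega]
        simp only [smul_smul, rho2, Fin.rev_zero, Fin.last_zero, lt_irrefl, if_false, if_true]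
        congr 1
        have h1 := one_add_qsq_ne_zero (s := s)
        push_cast
        rw [zpow_neg_one, add_sub_cancel_right]
        field_simp
        ring
    | ha x y hx hy => simp only [map_add, smul_add, hx, hy]
  | more N ih _ =>
    have hsum : ∀ p, laplace (pbw (N + 2) s) p =
        s ^ N • partialOp (pbw (N + 2) s) 0 (partialOp (pbw (N + 2) s) (Fin.last _) p) +
        ∑ i : Fin N, s ^ rho2 N i • partialOp (pbw (N + 2) s) (inner i)
          (partialOp (pbw (N + 2) s) (inner i.rev) p) +
        (s ^ N)⁻¹ • partialOp (pbw (N + 2) s) (Fin.last _) (partialOp (pbw (N + 2) s) 0 p) := by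
      intro p
      rw [laplace, sum_univ_inner]
      simp only [zero_rev, last_rev, inner_rev, rho2_zero, rho2_last, rho2_inner, zpow_neg,
        zpow_natCast, LinearMap.add_apply, LinearMap.smul_apply, LinearMap.comp_apply,
        LinearMap.sum_apply]
    induction p using tri_induction with
    | ht a y b =>
      have hin : ∑ i : Fin N, s ^ rho2 N i • partialOp (pbw (N + 2) s) (inner i)
          (partialOp (pbw (N + 2) s) (inner i.rev) (tri a y b)) =
          ((s ^ 2) ^ b * (s ^ 2) ^ b) • tri a (laplace (pbw N s) y) b := by
        rw [laplace, LinearMap.sum_apply, tri_sum, Finset.smul_sum]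
        refine Finset.sum_congr rfl fun i _ => ?_
        rw [partialOp_inner_tri, map_smul, partialOp_inner_tri, LinearMap.smul_apply,
          LinearMap.comp_apply, tri_smul, smul_smul, smul_smul, smul_smul]
        congr 1
        ring
      have hsl : scale (s ^ 2) (lower N s y) = ((s ^ 2) ^ 2)⁻¹ • lower N s (scale (s ^ 2) y) :=
        scale_lower N y
      have hls : lower N s (scale (s ^ 2) y) = (s ^ 2) ^ 2 • scale (s ^ 2) (lower N s y) := by
        rw [hsl, smul_smul, mul_inv_cancel₀ (pow_ne_zero _ hq), one_smul]
      rw [hsum, hin, partialOp_last_tri, partialOp_zero_tri, map_add, map_smul, map_smul, map_smul,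
        partialOp_zero_tri, partialOp_zero_tri, partialOp_last_tri, ih, scale_tri, map_smul,
        lower_tri, hls, tri_smul, tri_smul, tri_smul, Nat.add_sub_cancel]
      simp only [smul_add, smul_smul]
      have e1 : (s ^ 2) ^ ((N : ℤ) - 2) = (s ^ N) ^ 2 * ((s ^ 2) ^ 2)⁻¹ := by
        rw [zpow_sub₀ hq, zpow_natCast]
        norm_cast
        ring
      have e2 : (s ^ 2) ^ (((N + 2 : ℕ) : ℤ) - 2) = (s ^ N) ^ 2 := by
        push_cast
        rw [add_sub_cancel_right, zpow_natCast]
        ring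
      have hN : s ^ N ≠ 0 := pow_ne_zero _ h0
      have hi := pow_four_sub_one_ne_zero (s := s)
      -- Both sides combine the same two vectors `u` and `v`, so the coefficients are compared
      -- separately.
      have hsc : ∀ (A B C D E F G : ℂ) (u v w : QSpace (N + 2) s), A + D = F → B + C + E = G →
          A • u + B • v + C • v + (D • u + E • v) = F • u + G • v := by
        intro A B C D E F G u v w h1 h2
        rw [← h1, ← h2]
        module
      -- A term with exponent (a - 1) + 1 occurs; for a = 0 the truncation is wrong but the
      -- coefficient vanishes.
      rcases a with _ | a
      · simp only [mul_zero, br_zero, zero_mul, zero_smul, zero_add, add_zero]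
        rw [← add_smul]
        congr 1
        rw [laplaceFactor, laplaceFactor, e1, e2, br]
        field_simp
        ring
      · rw [Nat.add_sub_cancel]
        refine hsc _ _ _ _ _ _ _ _ _ (tri a y b) ?_ ?_
        · rcases b with _ | b
          · simp only [mul_zero, br_zero, zero_mul, add_zero]
          rw [Nat.add_sub_cancel, laplaceFactor, e2]
          field_simp
          ring
        · rw [laplaceFactor, laplaceFactor, e1, e2, br, br]
          field_simp
          ring
    | ha x y hx hy => simp only [map_add, smul_add, hx, hy]

end Lowering

end QEuclid
end

/-! ### The commutator of the lowering operator with the squared radius -/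

noncomputable section
namespace QEuclid

open Finset

section Commutator

variable {N : ℕ} {s : ℂ} [Generic s]

theorem Hom.scale_inv {d : ℕ} {p : QSpace N s} (hp : Hom d p) :
    scale (s ^ 2)⁻¹ p = ((s ^ 2) ^ d)⁻¹ • p := by
  have h0 := qsq_ne_zero (s := s)
  have h : scale (s ^ 2)⁻¹ (scale (s ^ 2) p) = p := by
    rw [scale_scale, inv_mul_cancel₀ h0, scale_one]
  rw [hp, map_smul] at h
  rw [eq_inv_smul_iff₀ (pow_ne_zero _ h0), h]

/-- By centrality Q can be inserted after x_1^a; there only x_N has to be moved past y to restore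
normal order. -/
theorem qRadius_mul_tri (a b : ℕ) (y : QSpace N s) : qRadius (N + 2) s 0 * tri a y b =
    radFactor (N + 2) s • tri (a + 1) (scale (s ^ 2)⁻¹ y) (b + 1) +
      innerCoeff N s • tri a (qRadius N s 0 * y) b := by
  rw [tri, ← mul_assoc, ← mul_assoc, (commute_qRadius (N + 2) (xFirst N s ^ a)).eq,
    mul_assoc (xFirst N s ^ a), qRadius_step, add_mul, smul_mul_assoc, smul_mul_assoc,
    mul_assoc (xFirst N s) (xLast N s), xLast_mul_iota, mul_add, add_mul, mul_smul_comm, mul_smul_comm, smul_mul_assoc,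
    smul_mul_assoc, tri, tri, map_mul, pow_succ (xFirst N s), pow_succ' (xLast N s)]
  simp only [mul_assoc]

/-- `qRadius_mul_tri` solved for its first term. A pair x_1, x_N is traded for Q or the inner
radius, so properties stable under multiplication by Q need checking only when one outer exponent is
zero. -/
theorem tri_succ_succ {d : ℕ} {y : QSpace N s} (hy : Hom d y) (a b : ℕ) :
    tri (a + 1) y (b + 1) = ((s ^ 2) ^ d / radFactor (N + 2) s) •
      (qRadius (N + 2) s 0 * tri a y b + (-innerCoeff N s) • tri a (qRadius N s 0 * y) b) := by
  have h1 := radFactor_ne_zero (s := s) (N + 2)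
  have h2 : (s ^ 2) ^ d ≠ 0 := pow_ne_zero _ qsq_ne_zero
  rw [qRadius_mul_tri, hy.scale_inv, tri_smul]
  match_scalars
  · field_simp
  · ring

theorem zpow_sub_two (N : ℕ) : s ^ ((N : ℤ) - 2) = s ^ N * (s ^ 2)⁻¹ := by
  rw [zpow_sub₀ Generic.ne_zero, zpow_natCast]
  norm_cast

theorem radFactor_eq (N : ℕ) : radFactor N s = s ^ N * (s ^ 2)⁻¹ + s ^ 2 * (s ^ N)⁻¹ := by
  rw [radFactor, zpow_sub_two, zpow_sub₀ Generic.ne_zero, zpow_natCast]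
  norm_cast

omit [Generic s] in
theorem radFactor_add_two' (N : ℕ) : radFactor (N + 2) s = s ^ N + (s ^ N)⁻¹ := by
  rw [radFactor_add_two, zpow_neg, zpow_natCast]

/-- A quantum sl_2 relation: lowering operator, Q and scaling play the roles of the two root vectors
and the Cartan element. In the inductive step both sides are expanded in normal order. -/
theorem lower_qRadius_mul (N : ℕ) (p : QSpace N s) : lower N s (qRadius N s 0 * p) =
    qRadius N s 0 * lower N s p + (radFactor N s / (s ^ 2 - (s ^ 2)⁻¹)) •
      (s ^ N • scale (s ^ 2) p - (s ^ N)⁻¹ • scale (s ^ 2)⁻¹ p) := by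
  have h0 : s ≠ 0 := Generic.ne_zero
  have hq := qsq_ne_zero (s := s)
  have hi := pow_four_sub_one_ne_zero (s := s)
  induction N using Nat.twoStepInduction with
  | zero =>
    induction p using zero_induction with
    | h c => simp [lower_zero]
  | one =>
    induction p using one_induction with
    | h c m =>
      have hm : Hom m (gen 1 s 0 ^ m) := by simpa using (Hom.gen (s := s) (0 : Fin 1)).pow m
      simp only [map_smul, mul_smul_comm]
      rw [hm, hm.scale_inv, qRadius_one_zero, ← pow_add, lower_one_pow, lower_one_pow,
        add_comm 2 m, Nat.add_sub_cancel]
      -- The exponent m - 2 is truncated for m < 2, but there the coefficient vanishes.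
      have hx : ∀ e : ℂ, (m < 2 → e = 0) →
          gen 1 s 0 ^ 2 * (e • gen 1 s 0 ^ (m - 2)) = e • gen 1 s 0 ^ m := by
        intro e he
        by_cases h : m < 2
        · rw [he h, zero_smul, zero_smul, mul_zero]
        · rw [mul_smul_comm, ← pow_add]
          congr 2
          omega
      have h1 := one_add_qsq_ne_zero (s := s)
      have h2 : 1 - s ^ 2 ≠ 0 := by
        intro h
        apply hi
        linear_combination (-(1 + s ^ 2)) * h
      rw [hx]
      · have e1 : ∀ k : ℕ, qBracket (s ^ 2) ((k : ℤ) - 1) =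
            (1 - (s ^ 2) ^ k * (s ^ 2)⁻¹) / (1 - s ^ 2) := by
          intro k
          rw [qBracket, zpow_sub₀ hq, zpow_natCast, zpow_one, div_eq_mul_inv ((s ^ 2) ^ k)]
        have e2 : ∀ k : ℕ, qBracket (s ^ 2) k = (1 - (s ^ 2) ^ k) / (1 - s ^ 2) := by
          intro k
          rw [qBracket, zpow_natCast]
        rw [e1, e2, e1, e2, radFactor_eq]
        match_scalars
        field_simp
        ring
      · intro h
        have : m = 0 ∨ m = 1 := by omega
        rcases this with rfl | rfl <;> simp [qBracket]
    | ha x y hx hy =>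
      simp only [map_add, mul_add, hx, hy]
      module
  | more N ih _ =>
    induction p using tri_hom_induction with
    | ht a d y b hy =>
      have ih' := ih y
      rw [hy, hy.scale_inv, smul_smul, smul_smul, smul_sub_smul_right, smul_smul] at ih'
      have hsl : scale (s ^ 2)⁻¹ (lower N s y) = ((s ^ 2) ^ d)⁻¹ • (s ^ 2) ^ 2 • lower N s y := by
        have h := scale_lower N y
        rw [hy, map_smul] at h
        have h' := congrArg (scale (s ^ 2)⁻¹) h
        rw [map_smul, map_smul, scale_scale, inv_mul_cancel₀ hq, scale_one] at h'
        conv_rhs => rw [h', smul_smul, smul_smul, smul_smul]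
        rw [show ((s ^ 2) ^ d)⁻¹ * (s ^ 2) ^ 2 *
          ((s ^ 2) ^ 2)⁻¹ * (s ^ 2) ^ d = 1 by field_simp, one_smul]
      rw [qRadius_mul_tri, hy.scale_inv, lower_tri, map_add, map_smul, map_smul, lower_tri,
        lower_tri, ih', mul_add (qRadius (N + 2) s 0), mul_smul_comm _ (qRadius (N + 2) s 0),
        mul_smul_comm _ (qRadius (N + 2) s 0), qRadius_mul_tri, qRadius_mul_tri,
        hsl, hy.scale_inv, scale_tri, scale_tri, hy, hy.scale_inv]
      simp only [map_smul, tri_smul, tri_add, Nat.add_sub_cancel]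
      rw [innerCoeff, radFactor_add_two']
      have hr := radFactor_ne_zero (s := s) N
      -- Truncated subtraction is harmless here: if a or b is zero, so is the corresponding
      -- q-number.
      have hab : (br s (2 * a) * br s (2 * b)) • tri (a - 1 + 1) y (b - 1 + 1) =
          (br s (2 * a) * br s (2 * b)) • tri a y b := by
        rcases a with _ | a
        · simp [br_zero]
        rcases b with _ | b
        · simp [br_zero]
        rfl
      have hab' : (br s (2 * a) * br s (2 * b) * (s ^ N)⁻¹) • ((s ^ N + (s ^ N)⁻¹) •
          ((s ^ 2) ^ d)⁻¹ • tri (a - 1 + 1) y (b - 1 + 1)) =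
          (br s (2 * a) * br s (2 * b) * (s ^ N)⁻¹) • ((s ^ N + (s ^ N)⁻¹) •
          ((s ^ 2) ^ d)⁻¹ • tri a y b) := by
        have := congrArg (fun z => ((s ^ N)⁻¹ * (s ^ N + (s ^ N)⁻¹) * ((s ^ 2) ^ d)⁻¹) • z) hab
        simp only [smul_smul] at this ⊢
        convert this using 2 <;> ring
      rw [smul_add (br s (2 * a) * br s (2 * b) * (s ^ N)⁻¹), hab']
      match_scalars
      · simp only [br, inv_pow]
        field_simp
        ring
      · field_simp
        ring
      · field_simp
      · field_simp
    | ha x y hx hy =>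
      simp only [map_add, mul_add, hx, hy]
      module

end Commutator

end QEuclid
end

/-! ### The unnormalized invariant functional -/

noncomputable section
namespace QEuclid

open Finset

section Functional

variable {N : ℕ} {s : ℂ}

open Classical in
/-- The numerator of `haarValue`. -/
def haarNum (N : ℕ) (s : ℂ) (ν : Fin N → ℕ) : ℂ :=
  if (∀ i, ν i = ν i.rev) ∧ (∀ i : Fin N, i = i.rev → Even (ν i)) then
    (∏ i : Fin N with i < i.rev, qPoch ((s ^ 2) ^ (-2 : ℤ)) ((s ^ 2) ^ (-2 : ℤ)) (ν i))
      * qPoch ((s ^ 2)⁻¹) ((s ^ 2) ^ (-2 : ℤ)) (halfMid ν) * (1 + s ^ 2) ^ halfMid ν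
    / (s ^ (∑ i : Fin N with i < i.rev, rho2 N i * (ν i : ℤ)) * (s ^ 2) ^ halfMid ν)
  else 0

/-- The factor of the unnormalized functional coming from an outer pair of generators. -/
def outerNum (N : ℕ) (s : ℂ) (a : ℕ) : ℂ :=
  qPoch ((s ^ 2) ^ (-2 : ℤ)) ((s ^ 2) ^ (-2 : ℤ)) a * ((s ^ N) ^ a)⁻¹

theorem qPoch_succ (a b : ℂ) (k : ℕ) : qPoch a b (k + 1) = qPoch a b k * (1 - a * b ^ k) := by
  rw [qPoch, prod_range_succ, qPoch]

theorem qPoch_zero (a b : ℂ) : qPoch a b 0 = 1 := by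
  rw [qPoch, prod_range_zero]

theorem outerNum_zero (N : ℕ) (s : ℂ) : outerNum N s 0 = 1 := by
  simp [outerNum, qPoch_zero]

theorem outerNum_succ (N : ℕ) (s : ℂ) (a : ℕ) : outerNum N s (a + 1) =
    outerNum N s a * (1 - (((s ^ 2) ^ (a + 1)) ^ 2)⁻¹) * (s ^ N)⁻¹ := by
  have : ((s ^ 2) ^ (-2 : ℤ)) * ((s ^ 2) ^ (-2 : ℤ)) ^ a = (((s ^ 2) ^ (a + 1)) ^ 2)⁻¹ := by
    rw [← pow_succ', zpow_neg, inv_pow]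
    norm_cast
    congr 1
    ring
  rw [outerNum, qPoch_succ, this, pow_succ (s ^ N), mul_inv, outerNum]
  ring

theorem halfMid_outerIndex (a : ℕ) (ν : Fin N → ℕ) (b : ℕ) :
    halfMid (outerIndex a ν b) = halfMid ν := by
  rw [halfMid, halfMid, Finset.sum_filter, sum_univ_inner, Finset.sum_filter]
  simp

/-- The numerator factors over pairs of opposite indices, whereas the denominator of `haarValue`
depends on the total degree. This is why the inductions are run with the numerator alone. -/
theorem haarNum_outerIndex [Generic s] (a : ℕ) (ν : Fin N → ℕ) (b : ℕ) :
    haarNum (N + 2) s (outerIndex a ν b) =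
      if a = b then outerNum N s a * haarNum N s ν else 0 := by
  have h0 : s ≠ 0 := Generic.ne_zero
  have hc : ((∀ i, outerIndex a ν b i = outerIndex a ν b i.rev) ∧
      (∀ i : Fin (N + 2), i = i.rev → Even (outerIndex a ν b i))) ↔
      a = b ∧ ((∀ i, ν i = ν i.rev) ∧ (∀ i : Fin N, i = i.rev → Even (ν i))) := by
    constructor
    · rintro ⟨h1, h2⟩
      refine ⟨by simpa using h1 0, fun i => by simpa using h1 (inner i), fun i hi => ?_⟩
      have := h2 (inner i) (by rw [inner_rev, ← hi])
      simpa using this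
    · rintro ⟨h1, h2, h3⟩
      refine ⟨fun i => ?_, fun i => ?_⟩
      · induction i using index_cases with
        | h0 => simpa using h1
        | hl => simpa using h1.symm
        | hi i => simpa using h2 i
      · induction i using index_cases with
        | h0 => simp
        | hl => simp
        | hi i => simpa using h3 i
  rw [haarNum, haarNum]
  by_cases hab : a = b
  · rw [if_pos hab]
    by_cases hν : (∀ i, ν i = ν i.rev) ∧ (∀ i : Fin N, i = i.rev → Even (ν i))
    · rw [if_pos (hc.mpr ⟨hab, hν⟩), if_pos hν, halfMid_outerIndex, Finset.prod_filter,
        prod_univ_inner, Finset.sum_filter, sum_univ_inner, Finset.prod_filter, Finset.sum_filter]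
      simp only [zero_rev, last_rev, inner_rev, inner_lt_inner, outerIndex_zero, outerIndex_inner,
        not_last_lt, if_false, Fin.last_pos, if_true, mul_one, add_zero, rho2_zero, rho2_inner]
      rw [zpow_add₀ h0, zpow_mul, zpow_natCast, zpow_natCast, outerNum]
      have h1 : s ^ 2 ≠ 0 := qsq_ne_zero
      field_simp
    · rw [if_neg (fun h => hν (hc.mp h).2), if_neg hν, mul_zero]
  · rw [if_neg hab, if_neg (fun h => hab (hc.mp h).1)]

variable [Generic s]

/-- The unnormalized invariant functional on `𝒜`. -/
def numFun (N : ℕ) (s : ℂ) [Generic s] : QSpace N s →ₗ[ℂ] ℂ :=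
  (pbw N s).constr ℂ (haarNum N s)

theorem numFun_mono (ν : Fin N → ℕ) : numFun N s (mono N s ν) = haarNum N s ν :=
  constr_mono _ ν

theorem numFun_tri (a b : ℕ) (y : QSpace N s) : numFun (N + 2) s (tri a y b) =
    if a = b then outerNum N s a * numFun N s y else 0 := by
  induction y using mono_induction with
  | h c ν =>
    rw [tri_smul, map_smul, map_smul, ← mono_outerIndex, numFun_mono, numFun_mono,
      haarNum_outerIndex]
    split_ifs
    · simp only [smul_eq_mul]; ring
    · exact smul_zero c
  | ha x y hx hy =>
    rw [tri_add, map_add, hx, hy, map_add]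
    split_ifs <;> ring

theorem numFun_one_pow (m : ℕ) : numFun 1 s (gen 1 s 0 ^ m) =
    if Even m then qPoch ((s ^ 2)⁻¹) ((s ^ 2) ^ (-2 : ℤ)) (m / 2) * (1 + s ^ 2) ^ (m / 2)
      / (s ^ 2) ^ (m / 2) else 0 := by
  have h := numFun_mono (s := s) (fun _ : Fin 1 => m)
  rw [mono_one] at h
  rw [h, haarNum]
  have e : (Finset.univ.filter fun i : Fin 1 => i < i.rev) = ∅ := by
    ext i
    simp
  rw [e]
  have e2 : halfMid (fun _ : Fin 1 => m) = m / 2 := by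
    rw [halfMid, Finset.sum_filter]
    simp
  rw [e2]
  by_cases hm : Even m
  · rw [if_pos hm, if_pos ⟨fun _ => rfl, fun _ _ => hm⟩]
    simp
  · rw [if_neg hm, if_neg (fun h => hm (h.2 0 (by simp)))]

theorem numFun_one_add_two (m : ℕ) : numFun 1 s (gen 1 s 0 ^ (m + 2)) =
    (1 + (s ^ 2)⁻¹) * (1 - (s ^ 2)⁻¹ * ((s ^ 2) ^ m)⁻¹) * numFun 1 s (gen 1 s 0 ^ m) := by
  have hq := qsq_ne_zero (s := s)
  have h0 : s ≠ 0 := Generic.ne_zero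
  rw [numFun_one_pow, numFun_one_pow]
  by_cases hm : Even m
  · obtain ⟨r, rfl⟩ := hm
    rw [if_pos (by exact ⟨r + 1, by ring⟩), if_pos ⟨r, rfl⟩, show (r + r + 2) / 2 = r + 1 by omega,
      show (r + r) / 2 = r by omega, qPoch_succ]
    have : ((s ^ 2) ^ (-2 : ℤ)) ^ r = ((s ^ 2) ^ (r + r))⁻¹ := by
      rw [zpow_neg, inv_pow]
      norm_cast
      rw [← pow_mul]
      congr 2
      ring
    rw [this]
    generalize qPoch _ _ r = X
    generalize hY : (1 + s ^ 2) ^ r = Y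
    rw [pow_succ (1 + s ^ 2), hY]
    field_simp
    ring
  · rw [if_neg (fun h => hm (by simpa [Nat.even_add] using h)), if_neg hm, mul_zero]

/-- The value of `numFun` on a multiple of the squared radius. -/
theorem numFun_qRadius_mul (N : ℕ) (p : QSpace N s) : numFun N s (qRadius N s 0 * p) =
    (1 + (s ^ N * (s ^ 2)⁻¹) ^ 2) *
      (numFun N s p - ((s ^ N) ^ 2)⁻¹ * numFun N s (scale (s ^ 2)⁻¹ p)) := by
  have h0 : s ≠ 0 := Generic.ne_zero
  have hq := qsq_ne_zero (s := s)
  induction N using Nat.twoStepInduction with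
  | zero =>
    induction p using zero_induction with
    | h c => simp [qRadius_zero]
  | one =>
    induction p using one_induction with
    | h c m =>
      have hm : Hom m (gen 1 s 0 ^ m) := by simpa using (Hom.gen (s := s) (0 : Fin 1)).pow m
      simp only [map_smul, mul_smul_comm, smul_eq_mul]
      rw [hm.scale_inv, qRadius_one_zero, ← pow_add, add_comm 2 m, numFun_one_add_two, map_smul,
        smul_eq_mul]
      field_simp
    | ha x y hx hy =>
      simp only [map_add, mul_add, hx, hy]
      ring
  | more N ih _ =>
    induction p using tri_hom_induction with
    | ht a d y b hy =>
      have ih' := ih y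
      rw [hy.scale_inv, map_smul, smul_eq_mul] at ih'
      rw [qRadius_mul_tri, hy.scale_inv, scale_tri, hy.scale_inv]
      simp only [map_add, map_smul, tri_smul, numFun_tri, Nat.add_right_cancel_iff, smul_eq_mul]
      split_ifs with hab
      · subst hab
        have hN : s ^ N ≠ 0 := pow_ne_zero _ h0
        have hr := radFactor_ne_zero (s := s) N
        rw [ih', outerNum_succ, innerCoeff, radFactor_add_two']
        rw [radFactor_eq] at hr ⊢
        have hr' : (s ^ N) ^ 2 + (s ^ 2) ^ 2 ≠ 0 := by
          intro h
          apply hr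
          field_simp
          linear_combination h
        rw [inv_pow]
        have hrr : s ^ N * (s ^ 2)⁻¹ + s ^ 2 * (s ^ N)⁻¹ =
            ((s ^ N) ^ 2 + (s ^ 2) ^ 2) / (s ^ 2 * s ^ N) := by
          field_simp
        rw [hrr]
        have e : s ^ (N + 2) = s ^ N * s ^ 2 := pow_add _ _ _
        rw [e]
        generalize s ^ N = X at *
        generalize s ^ 2 = q at *
        field_simp
        ring
      · simp
    | ha x y hx hy =>
      simp only [map_add, mul_add, hx, hy]
      ring

theorem geoSum_mul (a : ℕ) :
    geoSum s a * (1 - ((s ^ 2) ^ 2)⁻¹) = 1 - (((s ^ 2) ^ a) ^ 2)⁻¹ := by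
  have h0 : s ≠ 0 := Generic.ne_zero
  induction a with
  | zero => simp [geoSum]
  | succ a ih =>
    rw [geoSum_succ, add_mul, ih, inv_pow, pow_succ (s ^ 2)]
    field_simp
    ring

/-- The functional is a trace up to rescaling the last generator. -/
theorem numFun_xLast_mul (p : QSpace (N + 2) s) : numFun (N + 2) s (xLast N s * p) =
    (s ^ 2) ^ N * numFun (N + 2) s (p * xLast N s) := by
  have h0 : s ≠ 0 := Generic.ne_zero
  have hq := qsq_ne_zero (s := s)
  induction p using tri_hom_induction with
  | ht a d y b hy =>
    rw [tri_mul_xLast, numFun_tri]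
    rcases a with _ | a
    -- With a = 0 both sides vanish: the last exponent b + 1 cannot equal the first.
    · rw [xLast_mul_tri_zero, numFun_tri, if_neg (by omega), if_neg (by omega), mul_zero]
    · rw [xLast_mul_tri_succ, map_add, map_smul, numFun_tri, numFun_tri, hy.scale_inv]
      simp only [Nat.add_right_cancel_iff, smul_eq_mul]
      split_ifs with hab
      · rw [numFun_qRadius_mul, hy.scale_inv, map_smul, smul_eq_mul, outerNum_succ,
          outerCoeff]
        have hN : s ^ N ≠ 0 := pow_ne_zero _ h0
        have hr := radFactor_ne_zero (s := s) N
        have hg := geoSum_mul (s := s) (a + 1)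
        have h4 : 1 - ((s ^ 2) ^ 2)⁻¹ ≠ 0 := by
          intro h
          apply pow_four_sub_one_ne_zero (s := s)
          field_simp at h
          linear_combination h
        have hg' : geoSum s (a + 1) =
            (1 - (((s ^ 2) ^ (a + 1)) ^ 2)⁻¹) / (1 - ((s ^ 2) ^ 2)⁻¹) := by
          rw [eq_div_iff h4, hg]
        have hrr : radFactor N s = ((s ^ N) ^ 2 + (s ^ 2) ^ 2) / (s ^ 2 * s ^ N) := by
          rw [radFactor_eq]
          field_simp
        rw [hrr] at hr
        have hr' : (s ^ N) ^ 2 + (s ^ 2) ^ 2 ≠ 0 := by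
          intro h
          apply hr
          rw [h, zero_div]
        have h4' : (1 - ((s ^ 2) ^ 2)⁻¹) = ((s ^ 2) ^ 2 - 1) / (s ^ 2) ^ 2 := by
          field_simp
        have h5 : (s ^ 2) ^ 2 - 1 ≠ 0 := by
          intro h
          apply h4
          rw [h4', h, zero_div]
        rw [hg', hrr, h4', ← pow_mul s 2 N, mul_comm 2 N, pow_mul s N 2]
        generalize s ^ N = X at *
        generalize s ^ 2 = q at *
        field_simp
        ring
      · simp
  | ha x y hx hy =>
    rw [mul_add, map_add, hx, hy, add_mul, map_add, mul_add]

end Functional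

end QEuclid
end

/-! ### Symmetry of the lowering operator and orthogonality of degrees -/

noncomputable section
namespace QEuclid

open Finset

section Balanced

variable {N : ℕ} {s : ℂ} [Generic s]

/-- The symmetry property of the lowering operator for the pair `p`, `r`. -/
def Balanced (p r : QSpace N s) : Prop :=
  numFun N s (scale (s ^ 2) p * r) - numFun N s (p * scale (s ^ 2) r) =
    (s ^ 2 - (s ^ 2)⁻¹) ^ 2 *
      (numFun N s (lower N s p * r) - numFun N s (p * lower N s r))

theorem Balanced.add_left {p p' r : QSpace N s} (h : Balanced p r) (h' : Balanced p' r) :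
    Balanced (p + p') r := by
  unfold Balanced at *
  simp only [map_add, add_mul]
  linear_combination h + h'

theorem Balanced.add_right {p r r' : QSpace N s} (h : Balanced p r) (h' : Balanced p r') :
    Balanced p (r + r') := by
  unfold Balanced at *
  simp only [map_add, mul_add]
  linear_combination h + h'

theorem Balanced.smul_left {p r : QSpace N s} (c : ℂ) (h : Balanced p r) :
    Balanced (c • p) r := by
  unfold Balanced at *
  simp only [map_smul, smul_mul_assoc, smul_eq_mul]
  linear_combination c * h

theorem Balanced.smul_right {p r : QSpace N s} (c : ℂ) (h : Balanced p r) :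
    Balanced p (c • r) := by
  unfold Balanced at *
  simp only [map_smul, mul_smul_comm, smul_eq_mul]
  linear_combination c * h

theorem Hom.lower_mul {d e : ℕ} {p r : QSpace N s} (hp : Hom d p) (hr : Hom e r) :
    scale (s ^ 2) (lower N s p * r) = (((s ^ 2) ^ 2)⁻¹ * (s ^ 2) ^ (d + e)) • (lower N s p * r) := by
  rw [map_mul, scale_lower, hp, hr, map_smul, smul_mul_smul_comm, smul_mul_assoc, smul_smul, pow_add]
  congr 1
  ring

theorem scale_inv_of_scale {c : ℂ} (hc : c ≠ 0) {p : QSpace N s} (hp : scale (s ^ 2) p = c • p) :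
    scale (s ^ 2)⁻¹ p = c⁻¹ • p := by
  have h : scale (s ^ 2)⁻¹ (scale (s ^ 2) p) = p := by
    rw [scale_scale, inv_mul_cancel₀ qsq_ne_zero, scale_one]
  rw [hp, map_smul] at h
  rw [eq_inv_smul_iff₀ hc, h]

theorem numFun_qRadius_mul_of_scale {c : ℂ} (hc : c ≠ 0) {p : QSpace N s}
    (hp : scale (s ^ 2) p = c • p) : numFun N s (qRadius N s 0 * p) =
      (1 + (s ^ N * (s ^ 2)⁻¹) ^ 2) * (1 - ((s ^ N) ^ 2)⁻¹ * c⁻¹) * numFun N s p := by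
  rw [numFun_qRadius_mul, scale_inv_of_scale hc hp, map_smul, smul_eq_mul]
  ring

theorem lower_qRadius_mul_of_hom {d : ℕ} {p : QSpace N s} (hp : Hom d p) :
    lower N s (qRadius N s 0 * p) = qRadius N s 0 * lower N s p +
      (radFactor N s * br s (2 * d + N)) • p := by
  rw [lower_qRadius_mul, hp, hp.scale_inv, br, pow_add, pow_mul]
  congr 1
  rw [smul_smul, smul_smul, smul_sub_smul_right, smul_smul, mul_inv]
  congr 1
  ring

/-- Inside the functional a factor Q is a scalar depending only on the degree of the remaining
product. The change of this scalar between the terms is matched by the commutator of the lowering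
operator with Q. -/
theorem Balanced.qRadius_left {d e : ℕ} {p r : QSpace N s} (hp : Hom d p) (hr : Hom e r)
    (h : Balanced p r) : Balanced (qRadius N s 0 * p) r := by
  have h0 : s ≠ 0 := Generic.ne_zero
  have hq := qsq_ne_zero (s := s)
  have hi := Generic.sub_inv_ne_zero s
  have hN : s ^ N ≠ 0 := pow_ne_zero _ h0
  have hd : (s ^ 2) ^ d ≠ 0 := pow_ne_zero _ hq
  have he : (s ^ 2) ^ e ≠ 0 := pow_ne_zero _ hq
  have hpr : scale (s ^ 2) (p * r) = ((s ^ 2) ^ d * (s ^ 2) ^ e) • (p * r) := by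
    rw [← pow_add]
    exact hp.mul hr
  have h1 := numFun_qRadius_mul_of_scale (mul_ne_zero hd he) hpr
  have h2 : numFun N s (qRadius N s 0 * (lower N s p * r)) = _ :=
    numFun_qRadius_mul_of_scale (c := ((s ^ 2) ^ 2)⁻¹ * (s ^ 2) ^ (d + e))
      (mul_ne_zero (inv_ne_zero (pow_ne_zero _ hq)) (pow_ne_zero _ hq)) (hp.lower_mul hr)
  have h3 : numFun N s (qRadius N s 0 * (p * lower N s r)) = _ :=
    numFun_qRadius_mul_of_scale (c := ((s ^ 2) ^ 2)⁻¹ * (s ^ 2) ^ (d + e))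
      (mul_ne_zero (inv_ne_zero (pow_ne_zero _ hq)) (pow_ne_zero _ hq)) (by
        rw [map_mul, scale_lower, hp, hr, map_smul, smul_mul_assoc, mul_smul_comm, mul_smul_comm,
          smul_smul, smul_smul, pow_add]
        congr 1
        ring)
  have hs : scale (s ^ 2) (qRadius N s 0 * p) =
      ((s ^ 2) ^ 2 * (s ^ 2) ^ d) • (qRadius N s 0 * p) := by
    rw [map_mul, scale_qRadius, hp, smul_mul_smul_comm]
  unfold Balanced at *
  rw [hp, hr] at h
  rw [hs, hr, lower_qRadius_mul_of_hom hp]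
  simp only [smul_mul_assoc, mul_smul_comm, map_smul, smul_eq_mul] at h
  simp only [smul_mul_assoc, mul_smul_comm, map_smul, smul_eq_mul, add_mul, map_add, mul_assoc]
  rw [h1, h2, h3, radFactor_eq, br, pow_add s (2 * d), pow_mul s 2 d, pow_add (s ^ 2) d e]
  generalize numFun N s (p * r) = L at *
  generalize numFun N s (lower N s p * r) = A at *
  generalize numFun N s (p * lower N s r) = B at *
  generalize (s ^ 2) ^ d = x at *
  generalize (s ^ 2) ^ e = y at *
  generalize s ^ N = X at *
  generalize s ^ 2 = q at *
  have e1 : (q - q⁻¹) ^ 2 * ((X * q⁻¹ + q * X⁻¹) * ((x * X - (x * X)⁻¹) / (q - q⁻¹)) * L) =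
      (q - q⁻¹) * ((X * q⁻¹ + q * X⁻¹) * ((x * X - (x * X)⁻¹)) * L) := by
    generalize q - q⁻¹ = w at *
    field_simp
  have e2 : ∀ Z : ℂ, Z * ((q - q⁻¹) ^ 2 * (A - B)) = Z * ((x - y) * L) := by
    intro Z
    linear_combination -Z * h
  have e3 := e2 ((1 + (X * q⁻¹) ^ 2) * (1 - (X ^ 2)⁻¹ * ((q ^ 2)⁻¹ * (x * y))⁻¹))
  linear_combination (norm := skip) -e3 - (e1)
  have e4 : ∀ u v w : ℂ, u / (v - w) = u * (v - w)⁻¹ := fun u v w => div_eq_mul_inv _ _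
  rw [e4]
  -- The terms containing this inverse cancel formally after `e1` is used, so it may be treated as a
  -- free variable.
  generalize (q - q⁻¹)⁻¹ = w at *
  field_simp
  ring

theorem Balanced.qRadius_right {d e : ℕ} {p r : QSpace N s} (hp : Hom d p) (hr : Hom e r)
    (h : Balanced p r) : Balanced p (qRadius N s 0 * r) := by
  have h0 : s ≠ 0 := Generic.ne_zero
  have hq := qsq_ne_zero (s := s)
  have hi := Generic.sub_inv_ne_zero s
  have hN : s ^ N ≠ 0 := pow_ne_zero _ h0
  have hd : (s ^ 2) ^ d ≠ 0 := pow_ne_zero _ hq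
  have he : (s ^ 2) ^ e ≠ 0 := pow_ne_zero _ hq
  have hpr : scale (s ^ 2) (p * r) = ((s ^ 2) ^ d * (s ^ 2) ^ e) • (p * r) := by
    rw [← pow_add]
    exact hp.mul hr
  have h1 := numFun_qRadius_mul_of_scale (mul_ne_zero hd he) hpr
  have h2 : numFun N s (qRadius N s 0 * (lower N s p * r)) = _ :=
    numFun_qRadius_mul_of_scale (c := ((s ^ 2) ^ 2)⁻¹ * (s ^ 2) ^ (d + e))
      (mul_ne_zero (inv_ne_zero (pow_ne_zero _ hq)) (pow_ne_zero _ hq)) (hp.lower_mul hr)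
  have h3 : numFun N s (qRadius N s 0 * (p * lower N s r)) = _ :=
    numFun_qRadius_mul_of_scale (c := ((s ^ 2) ^ 2)⁻¹ * (s ^ 2) ^ (d + e))
      (mul_ne_zero (inv_ne_zero (pow_ne_zero _ hq)) (pow_ne_zero _ hq)) (by
        rw [map_mul, scale_lower, hp, hr, map_smul, smul_mul_assoc, mul_smul_comm, mul_smul_comm,
          smul_smul, smul_smul, pow_add]
        congr 1
        ring)
  have hs : scale (s ^ 2) (qRadius N s 0 * r) =
      ((s ^ 2) ^ 2 * (s ^ 2) ^ e) • (qRadius N s 0 * r) := by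
    rw [map_mul, scale_qRadius, hr, smul_mul_smul_comm]
  have hc : ∀ w z, w * (qRadius N s 0 * z) = qRadius N s 0 * (w * z) := by
    intro w z
    rw [← mul_assoc, ← mul_assoc, (commute_qRadius N w).eq]
  unfold Balanced at *
  rw [hp, hr] at h
  rw [hs, hp, lower_qRadius_mul_of_hom hr]
  simp only [smul_mul_assoc, mul_smul_comm, map_smul, smul_eq_mul] at h
  simp only [smul_mul_assoc, mul_smul_comm, map_smul, smul_eq_mul, mul_add, map_add, mul_assoc, hc p,
    hc (lower N s p)]
  rw [h1, h2, h3, radFactor_eq, br, pow_add s (2 * e), pow_mul s 2 e, pow_add (s ^ 2) d e]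
  generalize numFun N s (p * r) = L at *
  generalize numFun N s (lower N s p * r) = A at *
  generalize numFun N s (p * lower N s r) = B at *
  generalize (s ^ 2) ^ d = x at *
  generalize (s ^ 2) ^ e = y at *
  generalize s ^ N = X at *
  generalize s ^ 2 = q at *
  have e1 : (q - q⁻¹) ^ 2 * ((X * q⁻¹ + q * X⁻¹) * ((y * X - (y * X)⁻¹) / (q - q⁻¹)) * L) =
      (q - q⁻¹) * ((X * q⁻¹ + q * X⁻¹) * ((y * X - (y * X)⁻¹)) * L) := by
    generalize q - q⁻¹ = w at *
    field_simp
  have e2 : ∀ Z : ℂ, Z * ((q - q⁻¹) ^ 2 * (A - B)) = Z * ((x - y) * L) := by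
    intro Z
    linear_combination -Z * h
  have e3 := e2 ((1 + (X * q⁻¹) ^ 2) * (1 - (X ^ 2)⁻¹ * ((q ^ 2)⁻¹ * (x * y))⁻¹))
  linear_combination (norm := skip) -e3 - (-e1)
  have e4 : ∀ u v w : ℂ, u / (v - w) = u * (v - w)⁻¹ := fun u v w => div_eq_mul_inv _ _
  rw [e4]
  generalize (q - q⁻¹)⁻¹ = w at *
  field_simp
  ring

/-- By `tri_succ_succ` both outer exponents can be decreased together, at the price of factors Q and
the inner radius. -/
theorem balanced_of_left {r : QSpace (N + 2) s} {e : ℕ} (hr : Hom e r)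
    (h1 : ∀ a d (v : QSpace N s), Hom d v → Balanced (tri a v 0) r)
    (h2 : ∀ a d (v : QSpace N s), Hom d v → Balanced (tri 0 v a) r) (p : QSpace (N + 2) s) :
    Balanced p r := by
  have key : ∀ a b d (y : QSpace N s), Hom d y → Balanced (tri a y b) r := by
    intro a
    induction a with
    | zero => exact h2
    | succ a ih =>
      intro b d y hy
      rcases b with _ | b
      · exact h1 _ _ _ hy
      · rw [tri_succ_succ hy]
        refine Balanced.smul_left _ ?_
        exact ((ih b d y hy).qRadius_left (hy.tri a b) hr).add_left
          ((ih b _ _ ((Hom.qRadius 0).mul hy)).smul_left _)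
  induction p using tri_hom_induction with
  | ht a d y b hy => exact key a b d y hy
  | ha x y hx hy => exact hx.add_left hy

theorem balanced_of_right {p : QSpace (N + 2) s} {e : ℕ} (hp : Hom e p)
    (h1 : ∀ a d (v : QSpace N s), Hom d v → Balanced p (tri a v 0))
    (h2 : ∀ a d (v : QSpace N s), Hom d v → Balanced p (tri 0 v a)) (r : QSpace (N + 2) s) :
    Balanced p r := by
  have key : ∀ a b d (y : QSpace N s), Hom d y → Balanced p (tri a y b) := by
    intro a
    induction a with
    | zero => exact h2
    | succ a ih =>
      intro b d y hy
      rcases b with _ | b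
      · exact h1 _ _ _ hy
      · rw [tri_succ_succ hy]
        refine Balanced.smul_right _ ?_
        exact ((ih b d y hy).qRadius_right hp (hy.tri a b)).add_right
          ((ih b _ _ ((Hom.qRadius 0).mul hy)).smul_right _)
  induction r using tri_hom_induction with
  | ht a d y b hy => exact key a b d y hy
  | ha x y hx hy => exact hx.add_right hy

theorem lower_tri_left (a : ℕ) (y : QSpace N s) :
    lower (N + 2) s (tri a y 0) = (s ^ 2) ^ a • tri a (lower N s y) 0 := by
  rw [lower_tri, mul_zero, br_zero, mul_zero, zero_mul, zero_smul, zero_add, add_zero]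

theorem lower_tri_right (a : ℕ) (y : QSpace N s) :
    lower (N + 2) s (tri 0 y a) = (s ^ 2) ^ a • tri 0 (lower N s y) a := by
  rw [lower_tri, mul_zero, br_zero, zero_mul, zero_mul, zero_smul, zero_add, zero_add]

theorem numFun_left_mul_right (a b : ℕ) (v u : QSpace N s) :
    numFun (N + 2) s (tri a v 0 * tri 0 u b) =
      if a = b then outerNum N s a * numFun N s (v * u) else 0 := by
  rw [← numFun_tri]
  congr 1
  simp only [tri, pow_zero, mul_one, one_mul, map_mul, mul_assoc]

theorem numFun_left_mul_left (a b : ℕ) (v u : QSpace N s) :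
    numFun (N + 2) s (tri a v 0 * tri b u 0) = if a + b = 0 then numFun N s (v * u) else 0 := by
  have : tri a v 0 * tri b u 0 = tri (a + b) (scale ((s ^ 2)⁻¹ ^ b) v * u) 0 := by
    rw [tri, pow_zero, mul_one, mul_assoc, iota_mul_tri, tri, tri, pow_add]
    simp only [mul_assoc]
  rw [this, numFun_tri]
  split_ifs with h
  · obtain ⟨rfl, rfl⟩ : a = 0 ∧ b = 0 := by omega
    rw [outerNum_zero, one_mul, pow_zero, scale_one]
  · rfl

omit [Generic s] in
theorem iota_mul_xLast_pow (a : ℕ) (v : QSpace N s) :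
    iota N s v * xLast N s ^ a = xLast N s ^ a * iota N s (scale ((s ^ 2) ^ a) v) := by
  induction a generalizing v with
  | zero => simp [scale_one]
  | succ a ih =>
    rw [pow_succ' (xLast N s), ← mul_assoc, iota_mul_xLast, mul_assoc, ih, scale_scale, mul_assoc,
      ← pow_succ]

theorem xLast_pow_mul_iota (a : ℕ) (v : QSpace N s) :
    xLast N s ^ a * iota N s v = iota N s (scale ((s ^ 2)⁻¹ ^ a) v) * xLast N s ^ a := by
  rw [iota_mul_xLast_pow, scale_scale, ← mul_pow, mul_inv_cancel₀ qsq_ne_zero, one_pow, scale_one]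

theorem numFun_right_mul_right (a b : ℕ) (v u : QSpace N s) :
    numFun (N + 2) s (tri 0 v a * tri 0 u b) = if a + b = 0 then numFun N s (v * u) else 0 := by
  have : tri 0 v a * tri 0 u b = tri 0 (v * scale ((s ^ 2)⁻¹ ^ a) u) (a + b) := by
    simp only [tri, pow_zero, one_mul, map_mul, mul_assoc, pow_add]
    congr 1
    rw [← mul_assoc, ← mul_assoc, xLast_pow_mul_iota]
  rw [this, numFun_tri]
  split_ifs with h1 h2 h2
  · obtain ⟨rfl, rfl⟩ : a = 0 ∧ b = 0 := by omega
    rw [outerNum_zero, one_mul, pow_zero, scale_one]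
  · omega
  · omega
  · rfl

theorem numFun_xLast_pow_mul (a : ℕ) (p : QSpace (N + 2) s) :
    numFun (N + 2) s (xLast N s ^ a * p) =
      ((s ^ 2) ^ N) ^ a * numFun (N + 2) s (p * xLast N s ^ a) := by
  induction a generalizing p with
  | zero => simp
  | succ a ih =>
    rw [pow_succ (xLast N s), mul_assoc, ih, mul_assoc (xLast N s), numFun_xLast_mul, mul_assoc p,
      pow_succ]
    ring

/-- The power of x_N stands to the left of that of x_1. The twisted trace property carries it to the
right end, which avoids expanding the commutators. -/
theorem numFun_right_mul_left (a b : ℕ) (v u : QSpace N s) :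
    numFun (N + 2) s (tri 0 v a * tri b u 0) =
      if a = b then ((s ^ 2) ^ N) ^ a * outerNum N s a * numFun N s (v * u) else 0 := by
  have : tri 0 v a * tri b u 0 =
      xLast N s ^ a * tri b (scale ((s ^ 2)⁻¹ ^ b) (scale ((s ^ 2) ^ a) v) * u) 0 := by
    rw [← iota_mul_tri, ← mul_assoc, ← iota_mul_xLast_pow]
    simp only [tri, pow_zero, one_mul]
  have h2 : ∀ z : QSpace N s, tri b z 0 * xLast N s ^ a = tri b z a := by
    intro z
    simp only [tri, pow_zero, mul_one]
  rw [this, numFun_xLast_pow_mul, h2, numFun_tri]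
  by_cases h : a = b
  · subst h
    rw [if_pos rfl, if_pos rfl, scale_scale, ← mul_pow, inv_mul_cancel₀ qsq_ne_zero, one_pow,
      scale_one]
    ring
  · rw [if_neg h, if_neg (Ne.symm h), mul_zero]

theorem balanced_zero (p r : QSpace 0 s) : Balanced p r := by
  induction p using zero_induction with
  | h c =>
    induction r using zero_induction with
    | h e => simp [Balanced, lower_zero]

theorem balanced_one_pow (m k : ℕ) : Balanced (gen 1 s 0 ^ m) (gen 1 s 0 ^ k) := by
  have hq := qsq_ne_zero (s := s)
  have hm : ∀ m, Hom m (gen 1 s 0 ^ m) := fun m => by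
    simpa using (Hom.gen (s := s) (0 : Fin 1)).pow m
  have e1 : ∀ k : ℕ, qBracket (s ^ 2) ((k : ℤ) - 1) =
      (1 - (s ^ 2) ^ k * (s ^ 2)⁻¹) / (1 - s ^ 2) := by
    intro k
    rw [qBracket, zpow_sub₀ hq, zpow_natCast, zpow_one, div_eq_mul_inv ((s ^ 2) ^ k)]
  have e2 : ∀ k : ℕ, qBracket (s ^ 2) k = (1 - (s ^ 2) ^ k) / (1 - s ^ 2) := by
    intro k
    rw [qBracket, zpow_natCast]
  have hs1 : ∀ e : ℂ, ∀ m k : ℕ, (m < 2 → e = 0) →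
      e * numFun 1 s (gen 1 s 0 ^ (m - 2) * gen 1 s 0 ^ k) =
        e * numFun 1 s (gen 1 s 0 ^ (m + k - 2)) := by
    intro e m k he
    by_cases h : m < 2
    · rw [he h, zero_mul, zero_mul]
    · rw [← pow_add]
      congr 3
      omega
  have hs2 : ∀ e : ℂ, ∀ m k : ℕ, (k < 2 → e = 0) →
      e * numFun 1 s (gen 1 s 0 ^ m * gen 1 s 0 ^ (k - 2)) =
        e * numFun 1 s (gen 1 s 0 ^ (m + k - 2)) := by
    intro e m k he
    by_cases h : k < 2
    · rw [he h, zero_mul, zero_mul]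
    · rw [← pow_add]
      congr 3
      omega
  unfold Balanced
  rw [hm, hm, lower_one_pow, lower_one_pow]
  simp only [smul_mul_assoc, mul_smul_comm, map_smul, smul_eq_mul]
  have hz : ∀ m : ℕ, m < 2 → qBracket (s ^ 2) ((m : ℤ) - 1) * qBracket (s ^ 2) m / (1 + s ^ 2) *
      (s ^ 2) ^ 2 * ((s ^ 2) ^ m)⁻¹ = 0 := by
    intro m h
    have : m = 0 ∨ m = 1 := by omega
    rcases this with rfl | rfl <;> simp [qBracket]
  rw [hs1 _ _ _ (hz m), hs2 _ _ _ (hz k), ← pow_add]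
  by_cases h2 : m + k < 2
  · have : ¬ Even (m + k) ∨ (m = 0 ∧ k = 0) := by
      by_cases h : m + k = 0
      · right; omega
      · left
        rw [show m + k = 1 by omega]
        decide
    rcases this with h | ⟨rfl, rfl⟩
    · rw [hz m (by omega), hz k (by omega), numFun_one_pow, if_neg h]
      ring
    · rw [hz 0 (by omega)]
      simp
  · have h3 : m + k = (m + k - 2) + 2 := by omega
    have h4 : (s ^ 2) ^ (m + k - 2) = (s ^ 2) ^ m * (s ^ 2) ^ k * ((s ^ 2) ^ 2)⁻¹ := by
      rw [← pow_add, eq_mul_inv_iff_mul_eq₀ (pow_ne_zero _ hq), ← pow_add, ← h3]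
    rw [h3, numFun_one_add_two, Nat.add_sub_cancel, h4, e1, e2, e1, e2]
    generalize numFun 1 s (gen 1 s 0 ^ (m + k - 2)) = L
    have hm0 : (s ^ 2) ^ m ≠ 0 := pow_ne_zero _ hq
    have hk0 : (s ^ 2) ^ k ≠ 0 := pow_ne_zero _ hq
    have h1 := one_add_qsq_ne_zero (s := s)
    have h2 : 1 - s ^ 2 ≠ 0 := by
      have := Generic.pow_ne_one (s := s) 1 one_pos
      rw [pow_one] at this
      exact sub_ne_zero.mpr this.symm
    generalize (s ^ 2) ^ m = x at *
    generalize (s ^ 2) ^ k = y at *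
    generalize s ^ 2 = q at *
    field_simp
    ring

/-- Both arguments reduce to elements with at most one kind of outer generator. On their products
the functional is zero or a multiple of the inner functional, and the identity becomes a multiple of
the inner one. -/
theorem balanced (N : ℕ) (p r : QSpace N s) : Balanced p r := by
  have hq := qsq_ne_zero (s := s)
  induction N using Nat.twoStepInduction with
  | zero => exact balanced_zero p r
  | one =>
    induction p using one_induction with
    | h c m =>
      induction r using one_induction with
      | h e k => exact ((balanced_one_pow m k).smul_left c).smul_right e
      | ha x y hx hy => exact hx.add_right hy
    | ha x y hx hy => exact hx.add_left hy
  | more N ih _ =>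
    induction r using hom_induction with
    | ha x y hx hy => exact hx.add_right hy
    | h e r hr =>
      refine balanced_of_left hr (fun a d v hv => ?_) (fun a d v hv => ?_) p
      · refine balanced_of_right (hv.tri a 0) (fun b e u hu => ?_) (fun b e u hu => ?_) r
        · have h := ih v u
          unfold Balanced at h ⊢
          rw [scale_tri, scale_tri, lower_tri_left, lower_tri_left]
          simp only [smul_mul_assoc, mul_smul_comm, map_smul, smul_eq_mul, numFun_left_mul_left]
          split_ifs with hab
          · obtain ⟨rfl, rfl⟩ : a = 0 ∧ b = 0 := by omega
            simpa using h
          · simp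
        · have h := ih v u
          unfold Balanced at h ⊢
          rw [scale_tri, scale_tri, lower_tri_left, lower_tri_right]
          simp only [smul_mul_assoc, mul_smul_comm, map_smul, smul_eq_mul, numFun_left_mul_right]
          split_ifs with hab
          · subst hab
            simp only [add_zero, zero_add]
            linear_combination (s ^ 2) ^ a * outerNum N s a * h
          · simp
      · refine balanced_of_right (hv.tri 0 a) (fun b e u hu => ?_) (fun b e u hu => ?_) r
        · have h := ih v u
          unfold Balanced at h ⊢
          rw [scale_tri, scale_tri, lower_tri_left, lower_tri_right]
          simp only [smul_mul_assoc, mul_smul_comm, map_smul, smul_eq_mul, numFun_right_mul_left]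
          split_ifs with hab
          · subst hab
            simp only [add_zero, zero_add]
            linear_combination (s ^ 2) ^ a * (((s ^ 2) ^ N) ^ a * outerNum N s a) * h
          · simp
        · have h := ih v u
          unfold Balanced at h ⊢
          rw [scale_tri, scale_tri, lower_tri_right, lower_tri_right]
          simp only [smul_mul_assoc, mul_smul_comm, map_smul, smul_eq_mul, numFun_right_mul_right]
          split_ifs with hab
          · obtain ⟨rfl, rfl⟩ : a = 0 ∧ b = 0 := by omega
            simpa using h
          · simp

/-- Harmonic polynomials of different degrees are orthogonal. -/
theorem numFun_mul_eq_zero {d e : ℕ} (hde : d ≠ e) {p r : QSpace N s} (hp : Hom d p)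
    (hr : Hom e r) (hp0 : lower N s p = 0) (hr0 : lower N s r = 0) : numFun N s (p * r) = 0 := by
  have h := balanced N p r
  unfold Balanced at h
  rw [hp, hr, hp0, hr0, smul_mul_assoc, mul_smul_comm, map_smul, map_smul, zero_mul, mul_zero,
    map_zero, sub_zero, mul_zero, smul_eq_mul, smul_eq_mul, ← sub_mul] at h
  refine (mul_eq_zero.mp h).resolve_left (sub_ne_zero.mpr ?_)
  have := Generic.zpow_ne_zpow s (k := 2 * d) (l := 2 * e) (by omega)
  rw [← pow_mul, ← pow_mul]
  exact_mod_cast this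

end Balanced

end QEuclid
end

/-! ### The star operation -/

noncomputable section
namespace QEuclid

open Finset

section Conj

variable {N : ℕ} {s : ℂ} [Generic s] {c : ℂ →+* ℂ} (hc : c s = s)

/-- The `*`-operation as a map from the quantum Euclidean space to itself. -/
def conj (N : ℕ) (hc : c s = s) (p : QSpace N s) : QSpace N s :=
  (starHom N s c Generic.ne_zero hc p).unop

theorem conj_add (p r : QSpace N s) : conj N hc (p + r) = conj N hc p + conj N hc r := by
  simp only [conj, map_add, MulOpposite.unop_add]

theorem conj_mul (p r : QSpace N s) : conj N hc (p * r) = conj N hc r * conj N hc p := by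
  simp only [conj, map_mul, MulOpposite.unop_mul]

theorem conj_one : conj N hc (1 : QSpace N s) = 1 := by
  simp only [conj, map_one, MulOpposite.unop_one]

theorem conj_zero : conj N hc (0 : QSpace N s) = 0 := by
  simp only [conj, map_zero, MulOpposite.unop_zero]

theorem conj_pow (p : QSpace N s) (k : ℕ) : conj N hc (p ^ k) = conj N hc p ^ k := by
  simp only [conj, map_pow, MulOpposite.unop_pow]

theorem conj_smul (z : ℂ) (p : QSpace N s) : conj N hc (z • p) = c z • conj N hc p :=
  starHom_smul N s c Generic.ne_zero hc z p

theorem conj_sum {ι : Type*} (t : Finset ι) (f : ι → QSpace N s) :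
    conj N hc (∑ i ∈ t, f i) = ∑ i ∈ t, conj N hc (f i) := by
  classical
  induction t using Finset.induction_on with
  | empty => exact conj_zero hc
  | insert i t hi ih => rw [Finset.sum_insert hi, Finset.sum_insert hi, conj_add, ih]

theorem conj_gen (i : Fin N) : conj N hc (gen N s i) = s ^ rho2 N i.rev • gen N s i.rev :=
  starHom_gen N s c Generic.ne_zero hc i

theorem conj_algebraMap (z : ℂ) : conj N hc (algebraMap ℂ _ z) = algebraMap ℂ _ (c z) := by
  rw [Algebra.algebraMap_eq_smul_one, conj_smul, conj_one, Algebra.algebraMap_eq_smul_one]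

theorem scale_conj (p : QSpace N s) : scale (s ^ 2) (conj N hc p) = conj N hc (scale (s ^ 2) p) := by
  induction p using gen_induction with
  | hc z => rw [conj_algebraMap, AlgHom.commutes, AlgHom.commutes, conj_algebraMap]
  | hg i =>
    rw [conj_gen, map_smul, scale_gen, scale_gen, conj_smul, conj_gen, map_pow, hc, smul_comm]
  | hm x y hx hy => rw [conj_mul, map_mul, hx, hy, map_mul, conj_mul]
  | ha x y hx hy => rw [conj_add, map_add, hx, hy, map_add, conj_add]

theorem Hom.conj {d : ℕ} {p : QSpace N s} (hp : Hom d p) : Hom d (QEuclid.conj N hc p) := by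
  unfold Hom at *
  rw [scale_conj, hp, conj_smul, map_pow, map_pow, hc]

theorem conj_iota (y : QSpace N s) : conj (N + 2) hc (iota N s y) = iota N s (conj N hc y) := by
  induction y using gen_induction with
  | hc z => rw [conj_algebraMap, AlgHom.commutes, AlgHom.commutes, conj_algebraMap]
  | hg i => rw [iota_gen, conj_gen, conj_gen, map_smul, iota_gen, inner_rev, rho2_inner]
  | hm x y hx hy => rw [conj_mul, map_mul, map_mul, conj_mul, hx, hy]
  | ha x y hx hy => rw [conj_add, map_add, map_add, conj_add, hx, hy]

theorem conj_xFirst : conj (N + 2) hc (xFirst N s) = (s ^ N)⁻¹ • xLast N s := by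
  rw [conj_gen, zero_rev, rho2_last, zpow_neg, zpow_natCast]

theorem conj_xLast : conj (N + 2) hc (xLast N s) = s ^ N • xFirst N s := by
  rw [conj_gen, last_rev, rho2_zero, zpow_natCast]

theorem conj_tri (a : ℕ) (y : QSpace N s) (b : ℕ) : conj (N + 2) hc (tri a y b) =
    ((s ^ N) ^ b * ((s ^ N)⁻¹) ^ a) • tri b (conj N hc y) a := by
  rw [tri, conj_mul, conj_mul, conj_pow, conj_pow, conj_xFirst, conj_xLast, conj_iota, smul_pow,
    smul_pow, mul_smul_comm, smul_mul_smul_comm, tri, mul_assoc]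

omit [Generic s] in
theorem conj_br (hc : c s = s) (n : ℕ) : c (br s n) = br s n := by
  simp only [br, map_div₀, map_sub, map_inv₀, map_pow, hc]

/-- The star exchanges the outer generators up to scalars, while the coefficients in `lower_tri` are
symmetric in a, b and fixed by c. Hence the star of a harmonic element is harmonic. -/
theorem lower_conj (N : ℕ) (p : QSpace N s) :
    lower N s (conj N hc p) = conj N hc (lower N s p) := by
  induction N using Nat.twoStepInduction with
  | zero => rw [lower_zero, lower_zero, conj_zero]
  | one =>
    induction p using one_induction with
    | h z m =>
      have h1 : conj 1 hc (gen 1 s 0) = gen 1 s 0 := by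
        rw [conj_gen]
        simp [rho2]
      rw [conj_smul, map_smul, map_smul, conj_smul, conj_pow, h1, lower_one_pow, conj_smul,
        conj_pow, h1]
      congr 2
      simp only [qBracket, map_mul, map_div₀, map_sub, map_add, map_one, map_inv₀, map_pow,
        map_zpow₀, hc]
    | ha x y hx hy => rw [conj_add, map_add, hx, hy, map_add, conj_add]
  | more N ih _ =>
    induction p using tri_induction with
    | ht a y b =>
      rw [conj_tri, map_smul, lower_tri, lower_tri, conj_add, conj_smul, conj_smul, conj_tri,
        conj_tri, ih, smul_add]
      simp only [map_mul, map_inv₀, map_pow, conj_br hc, hc]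
      congr 1
      · rcases a with _ | a
        · simp [br_zero]
        rcases b with _ | b
        · simp [br_zero]
        have hN : s ^ N ≠ 0 := pow_ne_zero _ Generic.ne_zero
        rw [smul_smul, smul_smul]
        congr 1
        simp only [Nat.add_sub_cancel, inv_pow, pow_succ _ a, pow_succ _ b]
        field_simp
      · rw [smul_smul, smul_smul]
        congr 1
        ring
    | ha x y hx hy => rw [conj_add, map_add, hx, hy, map_add, conj_add]

end Conj

end QEuclid
end

/-! ### Harmonic systems -/

noncomputable section
namespace QEuclid

open Finset

section Harmonic

theorem exists_dual {ι V : Type*} [AddCommGroup V] [Module ℂ V] {v : ι → V}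
    (hv : LinearIndependent ℂ v) :
    ∃ f : ι → V →ₗ[ℂ] ℂ, (∀ i j, i ≠ j → f i (v j) = 0) ∧ ∀ i, f i (v i) = 1 := by
  classical
  choose f hf using fun i =>
    LinearMap.exists_extend ((Finsupp.lapply i : (ι →₀ ℂ) →ₗ[ℂ] ℂ) ∘ₗ hv.repr)
  have h : ∀ i j, f i (v j) = Finsupp.single j (1 : ℂ) i := by
    intro i j
    have := LinearMap.congr_fun (hf i) ⟨v j, Submodule.subset_span ⟨j, rfl⟩⟩
    simp only [LinearMap.comp_apply, Submodule.subtype_apply, Finsupp.lapply_apply] at this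
    rw [this, hv.repr_eq_single j _ rfl]
  refine ⟨f, fun i j hij => ?_, fun i => ?_⟩
  · rw [h, Finsupp.single_eq_of_ne hij]
  · rw [h, Finsupp.single_eq_same]

variable {N : ℕ} {s : ℂ} [Generic s]

omit [Generic s] in
theorem Hom.qRadius_pow_mul {d : ℕ} {p : QSpace N s} (hp : Hom d p) (k : ℕ) :
    Hom (d + 2 * k) (QEuclid.qRadius N s 0 ^ k * p) := by
  rw [add_comm, mul_comm]
  exact ((Hom.qRadius 0).pow k).mul hp

theorem br_ne_zero {n : ℕ} (hn : 0 < n) : br s n ≠ 0 := by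
  rw [br]
  refine div_ne_zero ?_ (Generic.sub_inv_ne_zero s)
  have := Generic.zpow_ne_zpow s (k := n) (l := -n) (by omega)
  rw [zpow_neg, zpow_natCast] at this
  exact sub_ne_zero.mpr this

/-- The q-number identity that sums the commutator scalars met when the lowering operator passes
successive factors Q. -/
theorem br_mul_add (k m : ℕ) : br s (2 * (k + 1)) * br s (m + 2 * k) + br s (m + 4 * (k + 1)) =
    br s (2 * (k + 1 + 1)) * br s (m + 2 * (k + 1)) := by
  have h0 : s ≠ 0 := Generic.ne_zero
  have hi := Generic.sub_inv_ne_zero s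
  have e : ∀ n, br s n = (s ^ n - (s ^ n)⁻¹) / (s ^ 2 - (s ^ 2)⁻¹) := fun n => rfl
  simp only [e, pow_add, pow_mul, mul_add, mul_one]
  have hm : s ^ m ≠ 0 := pow_ne_zero _ h0
  have hk : (s ^ 2) ^ k ≠ 0 := pow_ne_zero _ qsq_ne_zero
  have h4 : (s ^ 4) ^ k = ((s ^ 2) ^ k) ^ 2 := by rw [← pow_mul, ← pow_mul, ← pow_mul]; ring
  rw [h4]
  generalize s ^ m = x at *
  generalize (s ^ 2) ^ k = y at *
  have : ∀ w : ℂ, w ≠ 0 → w = s ^ 2 - (s ^ 2)⁻¹ →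
      (s ^ 2 * y - (s ^ 2 * y)⁻¹) / w * ((x * y - (x * y)⁻¹) / w) +
        (x * (s ^ 4 * y ^ 2) - (x * (s ^ 4 * y ^ 2))⁻¹) / w =
      (s ^ 2 * (s ^ 2 * y) - (s ^ 2 * (s ^ 2 * y))⁻¹) / w *
        ((x * (s ^ 2 * y) - (x * (s ^ 2 * y))⁻¹) / w) := by
    intro w hw hws
    rw [div_mul_div_comm, div_mul_div_comm, div_add_div _ _ (mul_ne_zero hw hw) hw, div_eq_div_iff
      (mul_ne_zero (mul_ne_zero hw hw) hw) (mul_ne_zero hw hw), hws]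
    field_simp
    ring
  have := this _ hi rfl
  convert this using 2 <;> ring

theorem lower_qRadius_pow_succ_mul {d : ℕ} {p : QSpace N s} (hp : Hom d p) (k : ℕ) :
    lower N s (qRadius N s 0 ^ (k + 1) * p) = qRadius N s 0 ^ (k + 1) * lower N s p +
      (radFactor N s * (br s (2 * (k + 1)) * br s (2 * d + N + 2 * k))) •
        (qRadius N s 0 ^ k * p) := by
  induction k with
  | zero =>
    have h : br s 2 = 1 := div_self (Generic.sub_inv_ne_zero s)
    rw [zero_add, pow_one, lower_qRadius_mul_of_hom hp, mul_one, mul_zero, add_zero, h, one_mul,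
      pow_zero, one_mul]
  | succ k ih =>
    rw [pow_succ' _ (k + 1), mul_assoc, lower_qRadius_mul_of_hom (hp.qRadius_pow_mul _), ih,
      mul_add, mul_smul_comm, ← mul_assoc _ _ p, ← pow_succ', ← mul_assoc _ _ (lower N s p),
      ← pow_succ', add_assoc, ← add_smul, ← mul_add, ← br_mul_add]
    congr 5
    ring

/-- The factor in `lower (Q ^ (k + 1) p) = c Q ^ k p` for harmonic `p` of degree `d`. -/
def lowerFactor (N : ℕ) (s : ℂ) (d k : ℕ) : ℂ :=
  radFactor N s * (br s (2 * (k + 1)) * br s (2 * d + N + 2 * k))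

/-- For N = 0 the factor with d = k = 0 vanishes, so the hypothesis is essential and N = 0 cannot
start the induction. -/
theorem lowerFactor_ne_zero (hN : 0 < N) (d k : ℕ) : lowerFactor N s d k ≠ 0 :=
  mul_ne_zero (radFactor_ne_zero N) (mul_ne_zero (br_ne_zero (by omega)) (br_ne_zero (by omega)))

/-- A family of homogeneous, linearly independent and pairwise orthogonal elements in the kernel
of the lowering operator which generates the whole space over the powers of the squared radius. -/
structure HarmonicSystem (N : ℕ) (s : ℂ) [Generic s] {I : Type*} (deg : I → ℕ)
    (Ξ : I → QSpace N s) : Prop where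
  hom : ∀ i, Hom (deg i) (Ξ i)
  low : ∀ i, lower N s (Ξ i) = 0
  li : LinearIndependent ℂ Ξ
  span : ∀ p, p ∈ Submodule.span ℂ (Set.range fun x : ℕ × I => qRadius N s 0 ^ x.1 * Ξ x.2)
  orth : ∀ (c : ℂ →+* ℂ) (hc : c s = s) (i j : I), i ≠ j →
    numFun N s (conj N hc (Ξ i) * Ξ j) = 0

namespace HarmonicSystem

variable {I : Type*} {deg : I → ℕ} {Ξ : I → QSpace N s} (H : HarmonicSystem N s deg Ξ)
include H

theorem lower_succ (k : ℕ) (i : I) : lower N s (qRadius N s 0 ^ (k + 1) * Ξ i) =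
    lowerFactor N s (deg i) k • (qRadius N s 0 ^ k * Ξ i) := by
  rw [lower_qRadius_pow_succ_mul (H.hom i), H.low, mul_zero, zero_add, lowerFactor]

theorem lower_zero (i : I) : lower N s (qRadius N s 0 ^ 0 * Ξ i) = 0 := by
  rw [pow_zero, one_mul, H.low]

theorem lower_pow_of_lt (i : I) : ∀ {k l : ℕ}, l < k →
    (lower N s ^ k) (qRadius N s 0 ^ l * Ξ i) = 0
  | k + 1, 0, _ => by rw [pow_succ, Module.End.mul_apply, H.lower_zero, map_zero]
  | k + 1, l + 1, h => by
    rw [pow_succ, Module.End.mul_apply, H.lower_succ, map_smul,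
      lower_pow_of_lt i (Nat.lt_of_succ_lt_succ h), smul_zero]

theorem lower_pow_self (hN : 0 < N) (i : I) (k : ℕ) :
    ∃ z : ℂ, z ≠ 0 ∧ (lower N s ^ k) (qRadius N s 0 ^ k * Ξ i) = z • Ξ i := by
  induction k with
  | zero => exact ⟨1, one_ne_zero, by simp⟩
  | succ k ih =>
    obtain ⟨z, hz, h⟩ := ih
    refine ⟨_, mul_ne_zero (lowerFactor_ne_zero (s := s) hN (deg i) k) hz, ?_⟩
    rw [pow_succ, Module.End.mul_apply, H.lower_succ, map_smul, h, smul_smul]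

/-- The k-th power of the lowering operator kills lower powers of Q and returns a nonzero multiple
of `Ξ i` from the k-th power. The family is thus triangular in the exponent of Q. -/
theorem linearIndependent_mul (hN : 0 < N) :
    LinearIndependent ℂ fun x : ℕ × I => qRadius N s 0 ^ x.1 * Ξ x.2 := by
  obtain ⟨f, hf0, hf1⟩ := exists_dual H.li
  refine linearIndependent_of_triangular Prod.fst (fun x => f x.2 ∘ₗ (lower N s ^ x.1)) ?_ ?_
  · rintro ⟨k, i⟩ ⟨l, j⟩ hne hle
    rw [LinearMap.comp_apply]
    rcases hle.lt_or_eq with h | h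
    · rw [H.lower_pow_of_lt j h, map_zero]
    · dsimp only at h
      subst h
      obtain ⟨z, -, hz⟩ := H.lower_pow_self hN j l
      rw [hz, map_smul, hf0 _ _ (fun e => hne (congrArg (Prod.mk l) e)), smul_zero]
  · rintro ⟨k, i⟩
    obtain ⟨z, hz0, hz⟩ := H.lower_pow_self hN i k
    rw [LinearMap.comp_apply, hz, map_smul, hf1, smul_eq_mul, mul_one]
    exact hz0

/-- Lowering kills the terms without Q and shifts the others, up to nonzero factors, to distinct
members of an independent family. All coefficients with a positive power of Q therefore vanish. -/
theorem mem_span_of_lower_eq_zero (hN : 0 < N) {p : QSpace N s} (hp : lower N s p = 0) :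
    p ∈ Submodule.span ℂ (Set.range Ξ) := by
  obtain ⟨f, hf0, hf1⟩ := exists_dual (H.linearIndependent_mul hN)
  obtain ⟨F, rfl⟩ := (Finsupp.mem_span_range_iff_exists_finsupp).mp (H.span p)
  rw [Finsupp.sum] at hp ⊢
  have key : ∀ k i, F (k + 1, i) = 0 := by
    intro k i
    by_contra hne
    have h := congrArg (f (k, i)) hp
    rw [map_zero, map_sum, map_sum, Finset.sum_eq_single_of_mem (k + 1, i) (by simpa using hne)] at h
    · rw [map_smul, H.lower_succ, map_smul, map_smul, hf1 (k, i), smul_eq_mul, smul_eq_mul,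
        mul_one] at h
      exact mul_ne_zero hne (lowerFactor_ne_zero hN _ _) h
    · rintro ⟨l, j⟩ - hlj
      rw [map_smul, map_smul]
      rcases l with _ | l
      · rw [H.lower_zero, map_zero, smul_zero]
      · rw [H.lower_succ, map_smul, hf0 (k, i) (l, j), smul_zero, smul_zero]
        rintro ⟨⟩
        exact hlj rfl
  refine Submodule.sum_mem _ ?_
  rintro ⟨k, i⟩ -
  rcases k with _ | k
  · rw [pow_zero, one_mul]
    exact Submodule.smul_mem _ _ (Submodule.subset_span ⟨i, rfl⟩)
  · rw [key, zero_smul]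
    exact Submodule.zero_mem _

theorem mem_span_of_hom (hN : 0 < N) {d : ℕ} {p : QSpace N s} (hd : Hom d p)
    (hp : lower N s p = 0) : p ∈ Submodule.span ℂ (Ξ '' {i | deg i = d}) := by
  have h := Submodule.mem_map_of_mem (f := proj d) (H.mem_span_of_lower_eq_zero hN hp)
  rw [hd.proj_self, Submodule.map_span] at h
  refine Submodule.span_le.mpr ?_ h
  rintro _ ⟨_, ⟨i, rfl⟩, rfl⟩
  by_cases hi : deg i = d
  · have := (H.hom i).proj_self
    rw [hi] at this
    rw [this]
    exact Submodule.subset_span ⟨i, hi, rfl⟩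
  · rw [(H.hom i).proj_of_ne (Ne.symm hi)]
    exact Submodule.zero_mem _

end HarmonicSystem

end Harmonic

end QEuclid
end

/-! ### The associated spherical polynomials -/

noncomputable section
namespace QEuclid

open Finset

section Spherical

variable {N : ℕ} {s : ℂ}

/-- The coefficients of the associated spherical polynomials in `Nj` coordinates. -/
def tCoeff (s : ℂ) (Nj : ℤ) (M a b k : ℕ) : ℂ :=
  qPoch ((s ^ 2) ^ (-2 * (a : ℤ))) ((s ^ 2) ^ 2) k
        * qPoch ((s ^ 2) ^ (-2 * (b : ℤ))) ((s ^ 2) ^ 2) k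
      / (qPoch ((s ^ 2) ^ 2) ((s ^ 2) ^ 2) k
        * qPoch ((s ^ 2) ^ (-Nj - 2 * (M : ℤ) + 4)) ((s ^ 2) ^ 2) k)
      * (s ^ ((2 - Nj) * (k : ℤ)) * (s ^ 2) ^ ((-2 * ((M : ℤ) - a - b) + 2) * (k : ℤ))
      / (1 + (s ^ 2) ^ (Nj - 2)) ^ k)

theorem tPoly_eq (j : Fin N) (M a b : ℕ) : tPoly N s j M a b =
    ∑ k ∈ range (min a b + 1), tCoeff s ((N : ℤ) - 2 * (j : ℤ)) M a b k •
      (qRadius N s j ^ k * gen N s j ^ (a - k) * gen N s j.rev ^ (b - k)) := rfl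

theorem tCoeff_zero (Nj : ℤ) (M a b : ℕ) : tCoeff s Nj M a b 0 = 1 := by
  simp [tCoeff, qPoch]

variable [Generic s]

theorem tCoeff_succ (Nj : ℤ) (M a b k : ℕ) : tCoeff s Nj M a b (k + 1) = tCoeff s Nj M a b k *
    ((1 - (s ^ 2) ^ (-2 * (a : ℤ)) * ((s ^ 2) ^ 2) ^ k) *
      (1 - (s ^ 2) ^ (-2 * (b : ℤ)) * ((s ^ 2) ^ 2) ^ k) /
      ((1 - (s ^ 2) ^ 2 * ((s ^ 2) ^ 2) ^ k) *
        (1 - (s ^ 2) ^ (-Nj - 2 * (M : ℤ) + 4) * ((s ^ 2) ^ 2) ^ k)) *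
      (s ^ (2 - Nj) * (s ^ 2) ^ (-2 * ((M : ℤ) - a - b) + 2) / (1 + (s ^ 2) ^ (Nj - 2)))) := by
  have h0 : s ≠ 0 := Generic.ne_zero
  have hz : ∀ e : ℤ, ∀ z : ℂ, z ≠ 0 → z ^ (e * ((k + 1 : ℕ) : ℤ)) = z ^ (e * (k : ℤ)) * z ^ e := by
    intro e z hz
    rw [← zpow_add₀ hz]
    congr 1
    push_cast
    ring
  rw [tCoeff, tCoeff, qPoch_succ, qPoch_succ, qPoch_succ, qPoch_succ, hz _ _ h0,
    hz _ _ qsq_ne_zero, pow_succ (1 + (s ^ 2) ^ (Nj - 2))]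
  simp only [div_eq_mul_inv, mul_inv]
  ring

/-- The two-term recursion that makes neighbouring terms cancel in `lower_extend`. Writing the
parameters as k + 1 + a and k + 1 + b avoids truncated subtraction. -/
theorem tCoeff_step (N l k a b : ℕ) :
    tCoeff s ((N + 2 : ℕ) : ℤ) (k + 1 + a + (k + 1 + b) + l) (k + 1 + a) (k + 1 + b) (k + 1) *
        (s ^ 2) ^ l * (radFactor (N + 2) s * (br s (2 * (k + 1)) *
          br s (2 * (k + 1 + a + b + l) + N))) =
      -(tCoeff s ((N + 2 : ℕ) : ℤ) (k + 1 + a + (k + 1 + b) + l) (k + 1 + a) (k + 1 + b) k *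
        (br s (2 * (a + 1)) * br s (2 * (b + 1)) * (s ^ N)⁻¹)) := by
  have h0 : s ≠ 0 := Generic.ne_zero
  have hq := qsq_ne_zero (s := s)
  have hi := Generic.sub_inv_ne_zero s
  have hN : s ^ N ≠ 0 := pow_ne_zero _ h0
  rw [tCoeff_succ]
  generalize tCoeff s ((N + 2 : ℕ) : ℤ) (k + 1 + a + (k + 1 + b) + l) (k + 1 + a) (k + 1 + b) k = C
  have ha : ∀ a : ℕ, (s ^ 2) ^ (-2 * ((k + 1 + a : ℕ) : ℤ)) * ((s ^ 2) ^ 2) ^ k =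
      (((s ^ 2) ^ (a + 1)) ^ 2)⁻¹ := by
    intro a
    generalize s ^ 2 = q at hq ⊢
    rw [← pow_mul, ← pow_mul, ← zpow_natCast, ← zpow_natCast, ← zpow_neg, ← zpow_add₀ hq]
    congr 1
    push_cast
    ring
  have hM : (s ^ 2) ^ (-((N + 2 : ℕ) : ℤ) - 2 * ((k + 1 + a + (k + 1 + b) + l : ℕ) : ℤ) + 4) *
      ((s ^ 2) ^ 2) ^ k = (s ^ (2 * (2 * (k + 1 + a + b + l) + N)))⁻¹ := by
    rw [← pow_mul, ← pow_mul, ← zpow_natCast, ← zpow_natCast, ← zpow_natCast, ← zpow_mul,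
      ← zpow_neg, ← zpow_add₀ h0]
    congr 1
    push_cast
    ring
  have hl : (s ^ 2) ^ (-2 * (((k + 1 + a + (k + 1 + b) + l : ℕ) : ℤ) - ((k + 1 + a : ℕ) : ℤ) -
      ((k + 1 + b : ℕ) : ℤ)) + 2) = (s ^ 2) ^ 2 * (((s ^ 2) ^ l) ^ 2)⁻¹ := by
    generalize s ^ 2 = q at hq ⊢
    rw [← pow_mul, ← zpow_natCast, ← zpow_natCast, ← zpow_neg, ← zpow_add₀ hq]
    congr 1
    push_cast
    ring
  have hs : s ^ (2 - ((N + 2 : ℕ) : ℤ)) = (s ^ N)⁻¹ := by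
    rw [← zpow_natCast, ← zpow_neg]
    congr 1
    push_cast
    ring
  have hd : (s ^ 2) ^ (((N + 2 : ℕ) : ℤ) - 2) = (s ^ N) ^ 2 := by
    rw [← pow_mul, ← zpow_natCast, ← zpow_natCast, ← zpow_mul]
    congr 1
    push_cast
    ring
  rw [ha, ha, hM, hl, hs, hd, radFactor_add_two' N]
  have hk : (1 : ℂ) - (s ^ 2) ^ 2 * ((s ^ 2) ^ 2) ^ k = 1 - ((s ^ 2) ^ (k + 1)) ^ 2 := by ring
  have e1 : ∀ n, br s (2 * n) = ((s ^ 2) ^ n - ((s ^ 2) ^ n)⁻¹) / (s ^ 2 - (s ^ 2)⁻¹) := by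
    intro n
    rw [br, pow_mul]
  have e2 : br s (2 * (k + 1 + a + b + l) + N) =
      ((s ^ 2) ^ (k + 1 + a + b + l) * s ^ N - ((s ^ 2) ^ (k + 1 + a + b + l) * s ^ N)⁻¹) /
        (s ^ 2 - (s ^ 2)⁻¹) := by
    rw [br, pow_add, pow_mul]
  have e3 : s ^ (2 * (2 * (k + 1 + a + b + l) + N)) =
      ((s ^ 2) ^ (k + 1 + a + b + l) * s ^ N) ^ 2 := by
    rw [← pow_mul, ← pow_add, ← pow_mul]
    congr 1
    ring
  have e4 : (s ^ 2) ^ (k + 1 + a + b + l) =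
      (s ^ 2) ^ k * s ^ 2 * (s ^ 2) ^ a * (s ^ 2) ^ b * (s ^ 2) ^ l := by
    simp only [pow_add, pow_one]
  rw [hk, e1, e1, e1, e2, e3]
  have n1 : 1 - ((s ^ 2) ^ (k + 1)) ^ 2 ≠ 0 := by
    rw [← pow_mul]
    exact sub_ne_zero.mpr (Generic.pow_ne_one _ (by positivity)).symm
  have n2 : 1 + (s ^ N) ^ 2 ≠ 0 := by
    have := Generic.zpow_add_ne_zero s 0 ((2 * N : ℕ) : ℤ)
    rw [zpow_zero, zpow_natCast, mul_comm, pow_mul] at this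
    exact this
  have n3 : ((s ^ 2) ^ (k + 1 + a + b + l) * s ^ N) ^ 2 - 1 ≠ 0 := by
    rw [← e3]
    have := Generic.zpow_ne_one s (k := ((2 * (2 * (k + 1 + a + b + l) + N) : ℕ) : ℤ))
      (by exact_mod_cast (by positivity : 2 * (2 * (k + 1 + a + b + l) + N) ≠ 0))
    rw [zpow_natCast] at this
    exact sub_ne_zero.mpr this
  rw [e4] at n3 ⊢
  rw [pow_succ _ k] at n1 ⊢
  rw [pow_succ _ a, pow_succ _ b]
  have hk0 : (s ^ 2) ^ k ≠ 0 := pow_ne_zero _ hq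
  have ha0 : (s ^ 2) ^ a ≠ 0 := pow_ne_zero _ hq
  have hb0 : (s ^ 2) ^ b ≠ 0 := pow_ne_zero _ hq
  have hl0 : (s ^ 2) ^ l ≠ 0 := pow_ne_zero _ hq
  generalize (s ^ 2) ^ k = K at *
  generalize (s ^ 2) ^ a = A at *
  generalize (s ^ 2) ^ b = B at *
  generalize (s ^ 2) ^ l = L at *
  generalize s ^ N = X at *
  generalize s ^ 2 = q at *
  have n4 : 1 - ((K * q * A * B * L * X) ^ 2)⁻¹ ≠ 0 := by
    intro h
    apply n3
    have hz : (K * q * A * B * L * X) ^ 2 ≠ 0 := by positivity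
    field_simp at h
    linear_combination h
  generalize hw : q - q⁻¹ = w at *
  rw [show X + X⁻¹ = (1 + X ^ 2) / X by field_simp; ring]
  have f1 : K * q - (K * q)⁻¹ = -(1 - (K * q) ^ 2) / (K * q) := by field_simp; ring
  have f2 : K * q * A * B * L * X - (K * q * A * B * L * X)⁻¹ =
      (1 - ((K * q * A * B * L * X) ^ 2)⁻¹) * (K * q * A * B * L * X) := by field_simp
  have f3 : A * q - (A * q)⁻¹ = (1 - ((A * q) ^ 2)⁻¹) * (A * q) := by field_simp
  have f4 : B * q - (B * q)⁻¹ = (1 - ((B * q) ^ 2)⁻¹) * (B * q) := by field_simp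
  rw [f1, f2, f3, f4]
  generalize 1 - (K * q) ^ 2 = Z1 at *
  generalize 1 - ((K * q * A * B * L * X) ^ 2)⁻¹ = Z2 at *
  generalize 1 - ((A * q) ^ 2)⁻¹ = Z3 at *
  generalize 1 - ((B * q) ^ 2)⁻¹ = Z4 at *
  generalize 1 + X ^ 2 = Z5 at *
  field_simp

/-- In the recursion the factor multiplying the preceding coefficient stays nonzero up to k = min a
b. The last coefficient is the one needed for independence. -/
theorem tCoeff_ne_zero (N l : ℕ) {a b k : ℕ} (hk : k ≤ min a b) :
    tCoeff s ((N + 2 : ℕ) : ℤ) (a + b + l) a b k ≠ 0 := by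
  induction k with
  | zero => rw [tCoeff_zero]; exact one_ne_zero
  | succ k ih =>
    have ih := ih (by omega)
    obtain ⟨a, rfl⟩ : ∃ a', a = k + 1 + a' := ⟨a - (k + 1), by omega⟩
    obtain ⟨b, rfl⟩ : ∃ b', b = k + 1 + b' := ⟨b - (k + 1), by omega⟩
    intro h
    have := tCoeff_step (s := s) N l k a b
    rw [h, zero_mul, zero_mul, eq_comm, neg_eq_zero] at this
    refine mul_ne_zero ih (mul_ne_zero (mul_ne_zero (br_ne_zero (by omega)) (br_ne_zero (by omega)))
      (inv_ne_zero (pow_ne_zero _ Generic.ne_zero))) this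

/-- The product of an associated spherical polynomial with an element of degree `l` of the inner
quantum Euclidean space. -/
def extend (N : ℕ) (s : ℂ) (a b l : ℕ) (y : QSpace N s) : QSpace (N + 2) s :=
  tPoly (N + 2) s 0 (a + b + l) a b * iota N s y

theorem Hom.scale_inv_pow {l : ℕ} {y : QSpace N s} (hy : Hom l y) (m : ℕ) :
    scale ((s ^ 2)⁻¹ ^ m) y = ((s ^ 2) ^ (l * m))⁻¹ • y := by
  induction m with
  | zero => rw [pow_zero, scale_one, mul_zero, pow_zero, inv_one, one_smul]
  | succ m ih =>
    rw [pow_succ, ← scale_scale, hy.scale_inv, map_smul, ih, smul_smul, mul_add, pow_add,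
      mul_inv, mul_one, mul_comm]

/-- Moving y to the left of x_N^(b-k) costs q^(-l(b-k)). The part depending on k joins the
coefficient and accounts for the power q^l in `tCoeff_step`. -/
theorem extend_eq {l : ℕ} {y : QSpace N s} (hy : Hom l y) (a b : ℕ) :
    extend N s a b l y = ((s ^ 2) ^ (l * b))⁻¹ • ∑ k ∈ range (min a b + 1),
      (tCoeff s ((N + 2 : ℕ) : ℤ) (a + b + l) a b k * ((s ^ 2) ^ l) ^ k) •
        (qRadius (N + 2) s 0 ^ k * tri (a - k) y (b - k)) := by
  have hq := qsq_ne_zero (s := s)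
  rw [extend, tPoly_eq, Finset.sum_mul, Finset.smul_sum]
  refine Finset.sum_congr rfl fun k hk => ?_
  have hk : k ≤ b := by
    have := Finset.mem_range.mp hk
    omega
  simp only [Fin.val_zero, zero_rev]
  rw [smul_mul_assoc, mul_assoc, xLast_pow_mul_iota, hy.scale_inv_pow, map_smul, smul_mul_assoc, mul_smul_comm,
    smul_smul, smul_smul, mul_assoc (qRadius _ _ _ ^ k), ← mul_assoc (gen _ _ 0 ^ (a - k)), tri,
    Nat.cast_zero, mul_zero, sub_zero]
  congr 1
  have : (s ^ 2) ^ (l * b) = (s ^ 2) ^ (l * (b - k)) * ((s ^ 2) ^ l) ^ k := by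
    generalize s ^ 2 = q
    rw [← pow_mul, ← pow_add, ← mul_add, Nat.sub_add_cancel hk]
  rw [this]
  have h1 : (s ^ 2) ^ (l * (b - k)) ≠ 0 := pow_ne_zero _ hq
  have h2 : ((s ^ 2) ^ l) ^ k ≠ 0 := pow_ne_zero _ (pow_ne_zero _ hq)
  field_simp

theorem Hom.extend {l : ℕ} {y : QSpace N s} (hy : Hom l y) (a b : ℕ) :
    Hom (a + b + l) (QEuclid.extend N s a b l y) := by
  rw [extend_eq hy]
  refine Hom.smul _ (Hom.sum fun k hk => Hom.smul _ ?_)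
  have := Finset.mem_range.mp hk
  have h := (hy.tri (a - k) (b - k)).qRadius_pow_mul k
  rwa [show a - k + l + (b - k) + 2 * k = a + b + l by omega] at h

theorem lower_tri_harmonic {y : QSpace N s} (hy : lower N s y = 0) (a b : ℕ) :
    lower (N + 2) s (tri a y b) =
      (br s (2 * a) * br s (2 * b) * (s ^ N)⁻¹) • tri (a - 1) y (b - 1) := by
  rw [lower_tri, hy, tri_zero, smul_zero, add_zero]

/-- Lowering the k-th term acts either on the power of Q or on the outer pair. The first
contribution cancels the second contribution of term k - 1, so the sum telescopes. -/
theorem lower_extend {l : ℕ} {y : QSpace N s} (hy : Hom l y) (hy0 : lower N s y = 0) (a b : ℕ) :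
    lower (N + 2) s (extend N s a b l y) = 0 := by
  rw [extend_eq hy, map_smul, map_sum]
  simp only [map_smul]
  set Q := qRadius (N + 2) s 0
  set n := min a b with hn
  let C : ℕ → ℂ := fun k => tCoeff s ((N + 2 : ℕ) : ℤ) (a + b + l) a b k * ((s ^ 2) ^ l) ^ k
  have h0 : lower (N + 2) s (Q ^ 0 * tri (a - 0) y (b - 0)) =
      (br s (2 * (a - 0)) * br s (2 * (b - 0)) * (s ^ N)⁻¹) • (Q ^ 0 * tri (a - (0 + 1)) y
        (b - (0 + 1))) := by
    rw [pow_zero, one_mul, one_mul, lower_tri_harmonic hy0]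
    rfl
  have hk : ∀ k, k + 1 ≤ n → C (k + 1) • lower (N + 2) s (Q ^ (k + 1) * tri (a - (k + 1)) y
      (b - (k + 1))) = (C (k + 1) * (br s (2 * (a - (k + 1))) * br s (2 * (b - (k + 1))) *
        (s ^ N)⁻¹)) • (Q ^ (k + 1) * tri (a - (k + 1 + 1)) y (b - (k + 1 + 1))) -
      (C k * (br s (2 * (a - k)) * br s (2 * (b - k)) * (s ^ N)⁻¹)) •
        (Q ^ k * tri (a - (k + 1)) y (b - (k + 1))) := by
    intro k hkn
    rw [lower_qRadius_pow_succ_mul (hy.tri _ _), lower_tri_harmonic hy0, mul_smul_comm, smul_add,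
      smul_smul, smul_smul, Nat.sub_sub, Nat.sub_sub, sub_eq_add_neg, ← neg_one_smul ℂ
        ((C k * _) • (Q ^ k * _)), smul_smul]
    congr 2
    obtain ⟨a', rfl⟩ : ∃ a', a = k + 1 + a' := ⟨a - (k + 1), by omega⟩
    obtain ⟨b', rfl⟩ : ∃ b', b = k + 1 + b' := ⟨b - (k + 1), by omega⟩
    have := tCoeff_step (s := s) N l k a' b'
    simp only [C]
    rw [show k + 1 + a' - k = a' + 1 by omega, show k + 1 + b' - k = b' + 1 by omega,
      Nat.add_sub_cancel_left, Nat.add_sub_cancel_left,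
      show 2 * (a' + l + b') + (N + 2) + 2 * k = 2 * (k + 1 + a' + b' + l) + N by ring, pow_succ]
    linear_combination ((s ^ 2) ^ l) ^ k * this
  have key : ∀ r, r ≤ n → ∑ k ∈ range (r + 1), C k • lower (N + 2) s (Q ^ k * tri (a - k) y (b - k))
      = (C r * (br s (2 * (a - r)) * br s (2 * (b - r)) * (s ^ N)⁻¹)) •
        (Q ^ r * tri (a - (r + 1)) y (b - (r + 1))) := by
    intro r
    induction r with
    | zero =>
      intro _
      rw [Finset.sum_range_one, h0, smul_smul]
    | succ r ih =>
      intro hr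
      rw [Finset.sum_range_succ, ih (by omega), hk r hr, add_sub_cancel]
  rw [key n le_rfl]
  -- The only uncancelled contribution is at k = min a b, where one outer exponent, and with it a
  -- q-number, is zero.
  rcases min_choice a b with h | h
  · rw [show a - n = 0 by omega, mul_zero, br_zero]
    simp
  · rw [show b - n = 0 by omega, mul_zero, br_zero]
    simp

end Spherical

end QEuclid
end

/-! ### From N to N + 2: independence, spanning and orthogonality -/

noncomputable section
namespace QEuclid

open Finset

section Step

variable {N : ℕ} {s : ℂ} [Generic s]

/-- The part x_1 x_N of Q raises both exponents and cannot contribute where one of them is zero. -/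
theorem coeff_qRadius_mul {u v : ℕ} (huv : u = 0 ∨ v = 0) (p : QSpace (N + 2) s) :
    coeff u v (qRadius (N + 2) s 0 * p) =
      innerCoeff N s • (qRadius N s 0 * coeff u v p) := by
  induction p using tri_induction with
  | ht a y b =>
    rw [qRadius_mul_tri, map_add, map_smul, map_smul, coeff_tri, coeff_tri, coeff_tri,
      if_neg (by omega), smul_zero, zero_add, mul_ite, mul_zero]
  | ha x y hx hy => rw [mul_add, map_add, hx, hy, map_add, mul_add, smul_add]

theorem coeff_qRadius_pow_mul {u v : ℕ} (huv : u = 0 ∨ v = 0) (k : ℕ) (p : QSpace (N + 2) s) :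
    coeff u v (qRadius (N + 2) s 0 ^ k * p) =
      innerCoeff N s ^ k • (qRadius N s 0 ^ k * coeff u v p) := by
  induction k with
  | zero => simp
  | succ k ih =>
    rw [pow_succ', mul_assoc, coeff_qRadius_mul huv, ih, mul_smul_comm, smul_smul, ← mul_assoc,
      ← pow_succ', ← pow_succ']

theorem coeff_extend_of_ne {l a b u v : ℕ} {y : QSpace N s} (hy : Hom l y) (huv : u = 0 ∨ v = 0)
    (h : ¬ (u = a - b ∧ v = b - a)) : coeff u v (extend N s a b l y) = 0 := by
  rw [extend_eq hy, map_smul, map_sum, Finset.sum_eq_zero, smul_zero]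
  intro k hk
  have := Finset.mem_range.mp hk
  rw [map_smul, coeff_qRadius_pow_mul huv, coeff_tri, if_neg (by omega), mul_zero, smul_zero,
    smul_zero]

/-- Only the term k = min a b has an outer exponent zero, so it alone is seen here. The truncated
differences and the power of the inner radius together determine a and b. -/
theorem coeff_extend_self {l : ℕ} {y : QSpace N s} (hy : Hom l y) (a b : ℕ) :
    ∃ z : ℂ, z ≠ 0 ∧ coeff (a - b) (b - a) (extend N s a b l y) =
      z • (qRadius N s 0 ^ min a b * y) := by
  have huv : a - b = 0 ∨ b - a = 0 := by omega
  have hq := qsq_ne_zero (s := s)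
  refine ⟨((s ^ 2) ^ (l * b))⁻¹ * ((tCoeff s ((N + 2 : ℕ) : ℤ) (a + b + l) a b (min a b) *
    ((s ^ 2) ^ l) ^ min a b) * innerCoeff N s ^ min a b), ?_, ?_⟩
  · exact mul_ne_zero (inv_ne_zero (pow_ne_zero _ hq)) (mul_ne_zero (mul_ne_zero
      (tCoeff_ne_zero N l le_rfl) (pow_ne_zero _ (pow_ne_zero _ hq)))
      (pow_ne_zero _ (innerCoeff_ne_zero N)))
  · rw [extend_eq hy, map_smul, map_sum, Finset.sum_eq_single_of_mem (min a b) (by simp)]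
    · rw [map_smul, coeff_qRadius_pow_mul huv, coeff_tri, if_pos (by omega), smul_smul, smul_smul,
        mul_assoc]
    · intro k hk hne
      have := Finset.mem_range.mp hk
      rw [map_smul, coeff_qRadius_pow_mul huv, coeff_tri, if_neg (by omega), mul_zero, smul_zero,
        smul_zero]

/-- Scaling x_1 by s and x_N by s⁻¹ respects the relations, since products of x_1 and x_N are
unchanged. It detects the weight a - b. -/
theorem exists_torus (N : ℕ) : ∃ θ : QSpace (N + 2) s →ₐ[ℂ] QSpace (N + 2) s,
    ∀ a y b, θ (tri a y b) = (s ^ a * s⁻¹ ^ b) • tri a y b := by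
  have h0 : s ≠ 0 := Generic.ne_zero
  obtain ⟨θ, h1, h2, h3⟩ := exists_liftStep (iota N s) (s • xFirst N s) (s⁻¹ • xLast N s)
    (fun i => by
      rw [smul_mul_assoc, xFirst_mul_iota, scale_gen, map_smul, smul_mul_assoc, mul_smul_comm,
        smul_comm])
    (fun i => by
      rw [mul_smul_comm, iota_mul_xLast, scale_gen, map_smul, mul_smul_comm, smul_mul_assoc,
        smul_comm])
    (by
      rw [smul_mul_smul_comm, smul_mul_smul_comm, inv_mul_cancel₀ h0, mul_inv_cancel₀ h0,
        xLast_mul_xFirst]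
      module)
  have h4 : ∀ y, θ (iota N s y) = iota N s y := by
    intro y
    have : θ.comp (iota N s) = iota N s := algHom_ext fun i => by
      rw [AlgHom.comp_apply, iota_gen, h3, iota_gen]
    exact DFunLike.congr_fun this y
  refine ⟨θ, fun a y b => ?_⟩
  rw [tri, map_mul, map_mul, map_pow, map_pow, h1, h2, h4, smul_pow, smul_pow, smul_mul_assoc,
    smul_mul_smul_comm]

variable {θ : QSpace (N + 2) s →ₐ[ℂ] QSpace (N + 2) s}
  (hθ : ∀ a y b, θ (tri a y b) = (s ^ a * s⁻¹ ^ b) • tri a y b)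
include hθ

theorem torus_qRadius : θ (qRadius (N + 2) s 0) = qRadius (N + 2) s 0 := by
  have h1 : xFirst N s * xLast N s = tri 1 1 1 := by
    simp [tri]
  rw [qRadius_step, h1, iota_eq_tri, map_add, map_smul, map_smul, hθ, hθ]
  simp [mul_inv_cancel₀ (Generic.ne_zero (s := s))]

theorem torus_extend {l : ℕ} {y : QSpace N s} (hy : Hom l y) (a b : ℕ) :
    θ (extend N s a b l y) = (s ^ a * s⁻¹ ^ b) • extend N s a b l y := by
  rw [extend_eq hy, map_smul, map_sum, smul_comm]
  congr 1
  rw [Finset.smul_sum]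
  refine Finset.sum_congr rfl fun k hk => ?_
  have hk := Finset.mem_range.mp hk
  have h0 : s ^ k ≠ 0 := pow_ne_zero _ Generic.ne_zero
  rw [map_smul, map_mul, map_pow, torus_qRadius hθ, hθ, mul_smul_comm, smul_comm]
  congr 1
  have ha : s ^ a = s ^ (a - k) * s ^ k := by rw [← pow_add]; congr 1; omega
  have hb : s⁻¹ ^ b = s⁻¹ ^ (b - k) * s⁻¹ ^ k := by rw [← pow_add]; congr 1; omega
  rw [ha, hb, inv_pow s k]
  field_simp

/-- The star exchanges x_1 and x_N and therefore inverts weights. -/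
theorem torus_conj {c : ℂ →+* ℂ} (hc : c s = s) (p : QSpace (N + 2) s) :
    θ (conj (N + 2) hc (θ p)) = conj (N + 2) hc p := by
  induction p using tri_induction with
  | ht a y b =>
    rw [hθ, conj_smul, conj_tri, map_smul, map_smul, hθ, smul_smul, smul_smul]
    congr 1
    have ha : s ^ a ≠ 0 := pow_ne_zero _ Generic.ne_zero
    have hb : s ^ b ≠ 0 := pow_ne_zero _ Generic.ne_zero
    simp only [map_mul, map_pow, map_inv₀, hc, inv_pow]
    field_simp
  | ha x y hx hy => rw [map_add, conj_add, map_add, hx, hy, conj_add]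

theorem numFun_torus (p : QSpace (N + 2) s) : numFun (N + 2) s (θ p) = numFun (N + 2) s p := by
  induction p using tri_induction with
  | ht a y b =>
    rw [hθ, map_smul, numFun_tri, smul_eq_mul]
    split_ifs with h
    · rw [h, inv_pow, mul_inv_cancel₀ (pow_ne_zero _ Generic.ne_zero), one_mul]
    · rw [mul_zero]
  | ha x y hx hy => rw [map_add, map_add, hx, hy, map_add]

-- The functional is torus invariant and the star inverts weights. If the value were nonzero, the
-- weights s^(a-b) and s^(a'-b') would coincide.
omit hθ in
theorem numFun_conj_extend_of_weight {c : ℂ →+* ℂ} (hc : c s = s) {l m a b a' b' : ℕ}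
    {y z : QSpace N s} (hy : Hom l y) (hz : Hom m z) (hab : a + b' ≠ a' + b) :
    numFun (N + 2) s (conj (N + 2) hc (extend N s a b l y) * extend N s a' b' m z) = 0 := by
  obtain ⟨θ, hθ⟩ := exists_torus (s := s) N
  have h0 : s ≠ 0 := Generic.ne_zero
  have h1 := torus_conj hθ hc (extend N s a b l y)
  rw [torus_extend hθ hy, conj_smul, map_smul] at h1
  have h2 := torus_extend hθ hz a' b'
  have h3 := numFun_torus hθ (conj (N + 2) hc (extend N s a b l y) * extend N s a' b' m z)
  rw [map_mul, h2, mul_smul_comm, map_smul, smul_eq_mul] at h3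
  have h4 := congrArg (fun w => numFun (N + 2) s (w * extend N s a' b' m z)) h1
  simp only [smul_mul_assoc, map_smul, smul_eq_mul, map_mul, map_pow, map_inv₀, hc] at h4
  rw [← h3] at h4
  have hw : s ^ a * s⁻¹ ^ b ≠ s ^ a' * s⁻¹ ^ b' := by
    have h := Generic.zpow_ne_zpow s (k := (a : ℤ) - b) (l := (a' : ℤ) - b') (by omega)
    rwa [zpow_sub₀ h0, zpow_sub₀ h0, zpow_natCast, zpow_natCast, zpow_natCast, zpow_natCast,
      div_eq_mul_inv, div_eq_mul_inv, ← inv_pow, ← inv_pow] at h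
  rw [← h3]
  generalize numFun (N + 2) s (θ (conj (N + 2) hc (extend N s a b l y)) * extend N s a' b' m z) = X
    at *
  generalize s ^ a * s⁻¹ ^ b = w at *
  generalize s ^ a' * s⁻¹ ^ b' = w' at *
  have : (w - w') * X = 0 := by linear_combination h4
  rw [(mul_eq_zero.mp this).resolve_left (sub_ne_zero.mpr hw), mul_zero]

omit hθ

omit [Generic s] in
theorem qRadius_mul_mem_span {I : Type*} {Ξ : I → QSpace N s} {w : QSpace N s}
    (hw : w ∈ Submodule.span ℂ (Set.range fun x : ℕ × I => qRadius N s 0 ^ x.1 * Ξ x.2)) :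
    qRadius N s 0 * w ∈
      Submodule.span ℂ (Set.range fun x : ℕ × I => qRadius N s 0 ^ x.1 * Ξ x.2) := by
  induction hw using Submodule.span_induction with
  | mem w hw =>
    obtain ⟨⟨k, x⟩, rfl⟩ := hw
    dsimp only
    rw [← mul_assoc, ← pow_succ']
    exact Submodule.subset_span ⟨(k + 1, x), rfl⟩
  | zero => rw [mul_zero]; exact Submodule.zero_mem _
  | add u v _ _ hu hv => rw [mul_add]; exact Submodule.add_mem _ hu hv
  | smul z u _ hu => rw [mul_smul_comm]; exact Submodule.smul_mem _ z hu

omit [Generic s] in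
theorem scale_qRadius_pow (z : ℂ) (k : ℕ) :
    scale z (qRadius N s 0 ^ k) = (z ^ 2) ^ k • qRadius N s 0 ^ k := by
  rw [map_pow, scale_qRadius, smul_pow]

/-- The subalgebra generated by the outer coordinates and the inner squared radius. -/
def outerSubalgebra (N : ℕ) (s : ℂ) : Subalgebra ℂ (QSpace (N + 2) s) :=
  Algebra.adjoin ℂ {xFirst N s, xLast N s, iota N s (qRadius N s 0)}

/-- Reordering x_N past x_1 creates only the inner radius, so the span of these normal forms is
stable under left multiplication by the generators of the subalgebra. -/
theorem mem_span_tri {T : QSpace (N + 2) s} (hT : T ∈ outerSubalgebra N s) :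
    T ∈ Submodule.span ℂ (Set.range fun x : ℕ × ℕ × ℕ =>
      tri x.1 (qRadius N s 0 ^ x.2.1) x.2.2) := by
  set W := Submodule.span ℂ (Set.range fun x : ℕ × ℕ × ℕ =>
      (tri x.1 (qRadius N s 0 ^ x.2.1) x.2.2 : QSpace (N + 2) s)) with hW
  have htri : ∀ a k b, (tri a (qRadius N s 0 ^ k) b : QSpace (N + 2) s) ∈ W := fun a k b =>
    Submodule.subset_span ⟨(a, k, b), rfl⟩
  have hgen : ∀ x : QSpace (N + 2) s, (∀ a k b, x * tri a (qRadius N s 0 ^ k) b ∈ W) →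
      ∀ w ∈ W, x * w ∈ W := by
    intro x hx w hw
    induction hw using Submodule.span_induction with
    | mem w hw =>
      obtain ⟨⟨a, k, b⟩, rfl⟩ := hw
      exact hx a k b
    | zero => rw [mul_zero]; exact W.zero_mem
    | add u v _ _ hu hv => rw [mul_add]; exact W.add_mem hu hv
    | smul z u _ hu => rw [mul_smul_comm]; exact W.smul_mem z hu
  have key : ∀ w ∈ W, T * w ∈ W := by
    unfold outerSubalgebra at hT
    induction hT using Algebra.adjoin_induction with
    | mem x hx =>
      refine hgen x fun a k b => ?_
      rcases hx with rfl | rfl | rfl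
      · rw [xFirst_mul_tri]
        exact htri _ _ _
      · rcases a with _ | a
        · rw [xLast_mul_tri_zero, scale_qRadius_pow, tri_smul]
          exact W.smul_mem _ (htri _ _ _)
        · rw [xLast_mul_tri_succ, scale_qRadius_pow, tri_smul, ← pow_succ']
          exact W.add_mem (W.smul_mem _ (htri _ _ _)) (W.smul_mem _ (htri _ _ _))
      · rw [iota_mul_tri, scale_qRadius, smul_mul_assoc, ← pow_succ', tri_smul]
        exact W.smul_mem _ (htri _ _ _)
    | algebraMap z =>
      intro w hw
      rw [← Algebra.smul_def]
      exact W.smul_mem z hw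
    | add x y _ _ hx hy => exact fun w hw => by rw [add_mul]; exact W.add_mem (hx w hw) (hy w hw)
    | mul x y _ _ hx hy => exact fun w hw => by rw [mul_assoc]; exact hx _ (hy w hw)
  have h1 : (1 : QSpace (N + 2) s) ∈ W := by
    have := htri 0 0 0
    simpa [tri] using this
  simpa using key 1 h1

theorem conj_qRadius {c : ℂ →+* ℂ} (hc : c s = s) : conj N hc (qRadius N s 0) = qRadius N s 0 := by
  have h0 : s ≠ 0 := Generic.ne_zero
  rw [qRadius_zero, conj_sum]
  refine Finset.sum_congr rfl fun i _ => ?_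
  rw [conj_smul, conj_mul, conj_gen, conj_gen, Fin.rev_rev, smul_mul_smul_comm, rho2_rev,
    ← zpow_add₀ h0, add_neg_cancel, zpow_zero, one_smul, map_zpow₀, hc]

theorem conj_mem_outerSubalgebra {c : ℂ →+* ℂ} (hc : c s = s) {T : QSpace (N + 2) s}
    (hT : T ∈ outerSubalgebra N s) : conj (N + 2) hc T ∈ outerSubalgebra N s := by
  have hg : ∀ x ∈ ({xFirst N s, xLast N s, iota N s (qRadius N s 0)} : Set (QSpace (N + 2) s)),
      x ∈ outerSubalgebra N s := fun x hx => Algebra.subset_adjoin hx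
  nth_rewrite 1 [outerSubalgebra] at hT
  induction hT using Algebra.adjoin_induction with
  | mem x hx =>
    rcases hx with rfl | rfl | rfl
    · rw [conj_xFirst]
      exact Subalgebra.smul_mem _ (hg _ (by simp)) _
    · rw [conj_xLast]
      exact Subalgebra.smul_mem _ (hg _ (by simp)) _
    · rw [conj_iota, conj_qRadius]
      exact hg _ (by simp)
  | algebraMap z =>
    rw [conj_algebraMap]
    exact Subalgebra.algebraMap_mem _ _
  | add x y _ _ hx hy => rw [conj_add]; exact add_mem hx hy
  | mul x y _ _ hx hy => rw [conj_mul]; exact mul_mem hy hx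

theorem tPoly_mem_outerSubalgebra (M a b : ℕ) :
    tPoly (N + 2) s 0 M a b ∈ outerSubalgebra N s := by
  have hg : ∀ x ∈ ({xFirst N s, xLast N s, iota N s (qRadius N s 0)} : Set (QSpace (N + 2) s)),
      x ∈ outerSubalgebra N s := fun x hx => Algebra.subset_adjoin hx
  have hQ : qRadius (N + 2) s 0 ∈ outerSubalgebra N s := by
    rw [qRadius_step]
    exact add_mem (Subalgebra.smul_mem _ (mul_mem (hg _ (by simp)) (hg _ (by simp))) _)
      (Subalgebra.smul_mem _ (hg _ (by simp)) _)
  rw [tPoly_eq]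
  refine sum_mem fun k _ => Subalgebra.smul_mem _ ?_ _
  rw [zero_rev]
  exact mul_mem (mul_mem (pow_mem hQ _) (pow_mem (hg _ (by simp)) _)) (pow_mem (hg _ (by simp)) _)

theorem numFun_qRadius_pow_mul_eq_zero {d : ℕ} {p : QSpace N s} (hp : Hom d p)
    (h : numFun N s p = 0) (k : ℕ) : numFun N s (qRadius N s 0 ^ k * p) = 0 := by
  induction k with
  | zero => rwa [pow_zero, one_mul]
  | succ k ih =>
    rw [pow_succ', mul_assoc, numFun_qRadius_mul_of_scale (pow_ne_zero _ qsq_ne_zero)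
      (hp.qRadius_pow_mul k), ih, mul_zero]

/-- For T = x_1^a Q'^k x_N^b the value is zero or a multiple of the inner functional at Q'^k u v, by
centrality of Q'. That in turn is a multiple of the value at u v. -/
theorem numFun_iota_mul_iota {d e : ℕ} {u v : QSpace N s} (hu : Hom d u) (hv : Hom e v)
    (h : numFun N s (u * v) = 0) {T : QSpace (N + 2) s} (hT : T ∈ outerSubalgebra N s) :
    numFun (N + 2) s (iota N s u * T * iota N s v) = 0 := by
  replace hT := mem_span_tri hT
  induction hT using Submodule.span_induction with
  | mem w hw =>
    obtain ⟨⟨a, k, b⟩, rfl⟩ := hw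
    dsimp only
    rw [iota_mul_tri, tri, mul_assoc, xLast_pow_mul_iota, ← mul_assoc, mul_assoc (xFirst N s ^ a),
      ← map_mul, ← tri, numFun_tri, hu.scale_inv_pow, hv.scale_inv_pow, smul_mul_assoc,
      smul_mul_smul_comm, map_smul, ← ((commute_qRadius N u).pow_left k).eq, mul_assoc,
      numFun_qRadius_pow_mul_eq_zero (hu.mul hv) h, smul_zero, mul_zero, ite_self]
  | zero => rw [mul_zero, zero_mul, map_zero]
  | add x y _ _ hx hy => rw [mul_add, add_mul, map_add, hx, hy, add_zero]
  | smul z x _ hx => rw [mul_smul_comm, smul_mul_assoc, map_smul, hx, smul_zero]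

namespace HarmonicSystem

variable {I : Type*} {deg : I → ℕ} {Ξ : I → QSpace N s} (H : HarmonicSystem N s deg Ξ)
include H

theorem linearIndependent_extend (hN : 0 < N) : LinearIndependent ℂ
    fun x : ℕ × ℕ × I => extend N s x.1 x.2.1 (deg x.2.2) (Ξ x.2.2) := by
  obtain ⟨f, hf0, hf1⟩ := exists_dual (H.linearIndependent_mul hN)
  refine linearIndependent_of_dual (fun x : ℕ × ℕ × I =>
    f (min x.1 x.2.1, x.2.2) ∘ₗ coeff (x.1 - x.2.1) (x.2.1 - x.1)) ?_ ?_
  · rintro ⟨a, b, i⟩ ⟨a', b', j⟩ hne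
    rw [LinearMap.comp_apply]
    dsimp only
    by_cases h : a - b = a' - b' ∧ b - a = b' - a'
    · rw [h.1, h.2]
      obtain ⟨z, -, hz⟩ := coeff_extend_self (H.hom j) a' b'
      rw [hz, map_smul]
      have := hf0 (min a b, i) (min a' b', j) (by
        intro e
        rw [Prod.mk.injEq] at e
        apply hne
        rw [Prod.mk.injEq, Prod.mk.injEq]
        exact ⟨by omega, by omega, e.2⟩)
      dsimp only at this
      rw [this, smul_zero]
    · rw [coeff_extend_of_ne (H.hom j) (by omega) h, map_zero]
  · rintro ⟨a, b, i⟩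
    obtain ⟨z, hz0, hz⟩ := coeff_extend_self (H.hom i) a b
    have := hf1 (min a b, i)
    dsimp only at this
    rw [LinearMap.comp_apply, hz, map_smul, this, smul_eq_mul, mul_one]
    exact hz0

/-- The term k = 0 of an extended element is proportional to x_1^a Ξ_i x_N^b, and the others have a
smaller exponent of x_1. Strong induction gives the normal forms without inner radius; its powers
are then produced by multiplying with Q. -/
theorem span_extend (p : QSpace (N + 2) s) : p ∈ Submodule.span ℂ (Set.range
    fun x : ℕ × ℕ × ℕ × I => qRadius (N + 2) s 0 ^ x.1 *
      extend N s x.2.1 x.2.2.1 (deg x.2.2.2) (Ξ x.2.2.2)) := by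
  set S := Submodule.span ℂ (Set.range fun x : ℕ × ℕ × ℕ × I => qRadius (N + 2) s 0 ^ x.1 *
      extend N s x.2.1 x.2.2.1 (deg x.2.2.2) (Ξ x.2.2.2)) with hS
  have hq := qsq_ne_zero (s := s)
  have hQ : ∀ w ∈ S, qRadius (N + 2) s 0 * w ∈ S := fun w hw =>
    qRadius_mul_mem_span (Ξ := fun x : ℕ × ℕ × I => extend N s x.1 x.2.1 (deg x.2.2) (Ξ x.2.2)) hw
  have hQk : ∀ k, ∀ w ∈ S, qRadius (N + 2) s 0 ^ k * w ∈ S := by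
    intro k
    induction k with
    | zero => intro w hw; rwa [pow_zero, one_mul]
    | succ k ih => intro w hw; rw [pow_succ', mul_assoc]; exact hQ _ (ih w hw)
  have hbase : ∀ a b i, tri a (Ξ i) b ∈ S := by
    intro a
    induction a using Nat.strong_induction_on with
    | _ a ih =>
      intro b i
      have h : extend N s a b (deg i) (Ξ i) ∈ S :=
        Submodule.subset_span ⟨(0, a, b, i), by dsimp only; rw [pow_zero, one_mul]⟩
      rw [extend_eq (H.hom i)] at h
      have h := (Submodule.smul_mem_iff _ (inv_ne_zero (pow_ne_zero _ hq))).mp h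
      rw [Finset.sum_range_succ'] at h
      rw [tCoeff_zero, pow_zero, pow_zero, one_mul, one_mul, one_smul] at h
      refine (S.add_mem_iff_right (S.sum_mem fun k hk => S.smul_mem _ (hQk _ _ ?_))).mp h
      have := Finset.mem_range.mp hk
      exact ih _ (by omega) _ _
  have hpow : ∀ k a b i, tri a (qRadius N s 0 ^ k * Ξ i) b ∈ S := by
    intro k
    induction k with
    | zero => intro a b i; rw [pow_zero, one_mul]; exact hbase a b i
    | succ k ih =>
      intro a b i
      have h := hQ _ (ih a b i)
      -- Of the two terms of the product with Q, the one with raised outer exponents is already in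
      -- the span, and the other has the nonzero coefficient `innerCoeff`.
      rw [qRadius_mul_tri, ((H.hom i).qRadius_pow_mul k).scale_inv, tri_smul, ← mul_assoc,
        ← pow_succ'] at h
      have h := (S.add_mem_iff_right (S.smul_mem _ (S.smul_mem _ (ih _ _ i)))).mp h
      exact (Submodule.smul_mem_iff _ (innerCoeff_ne_zero N)).mp h
  induction p using tri_induction with
  | ht a y b =>
    induction H.span y using Submodule.span_induction with
    | mem w hw =>
      obtain ⟨⟨k, i⟩, rfl⟩ := hw
      exact hpow k a b i
    | zero => rw [tri_zero]; exact S.zero_mem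
    | add u v _ _ hu hv => rw [tri_add]; exact S.add_mem hu hv
    | smul z u _ hu => rw [tri_smul]; exact S.smul_mem z hu
  | ha x y hx hy => exact S.add_mem hx hy

/-- For orthogonality with the same inner element, equal total degree together with equal weight a -
b would force equal indices. So either the degrees differ, and harmonicity applies, or the weights
do. Different inner elements are handled by enclosing the polynomial factors between them. -/
theorem step (hN : 0 < N) : HarmonicSystem (N + 2) s
    (fun x : ℕ × ℕ × I => x.1 + x.2.1 + deg x.2.2)
    (fun x : ℕ × ℕ × I => extend N s x.1 x.2.1 (deg x.2.2) (Ξ x.2.2)) where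
  hom x := (H.hom _).extend _ _
  low x := lower_extend (H.hom _) (H.low _) _ _
  li := H.linearIndependent_extend hN
  span p := H.span_extend p
  orth := by
    rintro c hc ⟨a, b, i⟩ ⟨a', b', j⟩ hne
    dsimp only
    by_cases hij : i = j
    · subst hij
      by_cases hd : a + b + deg i = a' + b' + deg i
      · refine numFun_conj_extend_of_weight hc (H.hom i) (H.hom i) fun h => hne ?_
        rw [Prod.mk.injEq, Prod.mk.injEq]
        exact ⟨by omega, by omega, rfl⟩
      · refine numFun_mul_eq_zero hd (((H.hom _).extend _ _).conj hc) ((H.hom _).extend _ _) ?_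
          (lower_extend (H.hom _) (H.low _) _ _)
        rw [lower_conj, lower_extend (H.hom _) (H.low _), conj_zero]
    · rw [extend, extend, conj_mul, conj_iota, mul_assoc, ← mul_assoc (conj _ hc (tPoly _ _ _ _ _ _)),
        ← mul_assoc]
      exact numFun_iota_mul_iota ((H.hom i).conj hc) (H.hom j) (H.orth c hc i j hij)
        (mul_mem (conj_mem_outerSubalgebra hc (tPoly_mem_outerSubalgebra _ _ _))
          (tPoly_mem_outerSubalgebra _ _ _))

end HarmonicSystem

end Step

end QEuclid
end

/-! ### Iterating the step, and the starting cases N = 1 and N = 2 -/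

noncomputable section
namespace QEuclid

open Finset

section Chain

variable {N : ℕ} {s : ℂ}

theorem iota_qRadius (j : ℕ) : iota N s (qRadius N s j) = qRadius (N + 2) s (j + 1) := by
  rw [qRadius, qRadius, Finset.sum_filter, Finset.sum_filter, sum_univ_inner, map_sum]
  have h0 : ¬ (j + 1 ≤ ((0 : Fin (N + 2)) : ℕ) ∧ j + 1 ≤ ((0 : Fin (N + 2)).rev : ℕ)) := by
    rw [Fin.val_zero]
    omega
  have hl : ¬ (j + 1 ≤ (Fin.last (N + 1) : ℕ) ∧ j + 1 ≤ ((Fin.last (N + 1)).rev : ℕ)) := by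
    rw [last_rev, Fin.val_zero]
    omega
  rw [if_neg h0, if_neg hl, zero_add, add_zero]
  refine Finset.sum_congr rfl fun i _ => ?_
  rw [inner_rev, inner_val, inner_val, rho2_inner]
  simp only [Nat.add_le_add_iff_right]
  split_ifs
  · rw [map_smul, map_mul, iota_gen, iota_gen]
  · rw [map_zero]

theorem iota_tPoly (j : Fin N) (M a b : ℕ) :
    iota N s (tPoly N s j M a b) = tPoly (N + 2) s (inner j) M a b := by
  rw [tPoly_eq, tPoly_eq, map_sum]
  refine Finset.sum_congr rfl fun k _ => ?_
  rw [map_smul, map_mul, map_mul, map_pow, map_pow, map_pow, iota_qRadius, iota_gen, iota_gen,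
    inner_rev, inner_val]
  congr 2
  push_cast
  ring

/-- The iterated inclusion of a smaller quantum Euclidean space. -/
def iotaPow (N : ℕ) (s : ℂ) : ∀ r : ℕ, QSpace N s →ₐ[ℂ] QSpace (N + 2 * r) s
  | 0 => AlgHom.id ℂ _
  | r + 1 => (iota (N + 2 * r) s).comp (iotaPow N s r)

theorem iotaPow_gen (i : Fin N) : ∀ r : ℕ, iotaPow N s r (gen N s i) =
    gen (N + 2 * r) s ⟨i + r, by omega⟩
  | 0 => rfl
  | r + 1 => by
    rw [iotaPow, AlgHom.comp_apply, iotaPow_gen i r, iota_gen]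
    rfl

/-- The ordered product of `r` associated spherical polynomials and a last factor. -/
def xi (N r : ℕ) (hr : 2 * r ≤ N) (s : ℂ) (m : ℕ) (a b : Fin r → ℕ) (y : QSpace N s) :
    QSpace N s :=
  (List.ofFn fun j : Fin r => tPoly N s ⟨j, by omega⟩ (remDeg m a b j) (a j) (b j)).prod * y

theorem remDeg_zero {r : ℕ} (m : ℕ) (a b : Fin (r + 1) → ℕ) : remDeg m a b 0 = m := by
  rw [remDeg, show Iio (0 : Fin (r + 1)) = ∅ by ext i; simp, Finset.sum_empty, Nat.sub_zero]

theorem sum_Iio_succ {r : ℕ} (f : Fin (r + 1) → ℕ) (j : Fin r) :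
    ∑ i ∈ Iio j.succ, f i = f 0 + ∑ i ∈ Iio j, f i.succ := by
  rw [sum_eq_sum_ite_mem, sum_eq_sum_ite_mem (Iio j), Fin.sum_univ_succ]
  simp

theorem remDeg_succ {r : ℕ} (m : ℕ) (a b : Fin (r + 1) → ℕ) (j : Fin r) :
    remDeg m a b j.succ = remDeg (m - (a 0 + b 0)) (Fin.tail a) (Fin.tail b) j := by
  rw [remDeg, remDeg, sum_Iio_succ, Nat.sub_sub]
  rfl

theorem xi_succ (N r : ℕ) (hr : 2 * r ≤ N) (s : ℂ) (m : ℕ) (a b : Fin (r + 1) → ℕ)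
    (y : QSpace N s) (hr' : 2 * (r + 1) ≤ N + 2) :
    xi (N + 2) (r + 1) hr' s m a b (iota N s y) =
      tPoly (N + 2) s 0 m (a 0) (b 0) *
        iota N s (xi N r hr s (m - (a 0 + b 0)) (Fin.tail a) (Fin.tail b) y) := by
  rw [xi, xi, List.ofFn_succ, List.prod_cons, map_mul, map_list_prod, List.map_ofFn, mul_assoc,
    remDeg_zero]
  congr 4
  funext j
  rw [Function.comp_apply, iota_tPoly, remDeg_succ]
  rfl

variable [Generic s]

namespace HarmonicSystem

theorem congr {I : Type*} {deg deg' : I → ℕ} {Ξ Ξ' : I → QSpace N s}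
    (H : HarmonicSystem N s deg Ξ) (hdeg : ∀ i, deg' i = deg i) (hΞ : ∀ i, Ξ' i = Ξ i) :
    HarmonicSystem N s deg' Ξ' := by
  rwa [funext hdeg, funext hΞ]

theorem reindex {I J : Type*} {deg : I → ℕ} {Ξ : I → QSpace N s}
    (H : HarmonicSystem N s deg Ξ) (e : J ≃ I) :
    HarmonicSystem N s (fun j => deg (e j)) (fun j => Ξ (e j)) where
  hom j := H.hom (e j)
  low j := H.low (e j)
  li := H.li.comp e e.injective
  span p := by
    have h := H.span p
    rwa [← (Equiv.prodCongr (Equiv.refl ℕ) e).surjective.range_comp] at h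
  orth c hc i j hij := H.orth c hc _ _ fun h => hij (e.injective h)

/-- Splitting off the first entries of two tuples. -/
def splitFirst (r : ℕ) (I : Type*) : (Fin (r + 1) → ℕ) × (Fin (r + 1) → ℕ) × I ≃
    ℕ × ℕ × ((Fin r → ℕ) × (Fin r → ℕ) × I) where
  toFun x := (x.1 0, x.2.1 0, Fin.tail x.1, Fin.tail x.2.1, x.2.2)
  invFun x := (Fin.cons x.1 x.2.2.1, Fin.cons x.2.1 x.2.2.2.1, x.2.2.2.2)
  left_inv x := by simp
  right_inv x := by simp

/-- The parameter M of each factor is the degree of that factor times everything to its right. This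
is a + b + l in `extend`, and `remDeg` computes it from the total degree. -/
theorem chain {I : Type*} {deg : I → ℕ} {Ξ : I → QSpace N s} (H : HarmonicSystem N s deg Ξ)
    (hN : 0 < N) : ∀ r : ℕ, HarmonicSystem (N + 2 * r) s
      (fun x : (Fin r → ℕ) × (Fin r → ℕ) × I => ∑ i, (x.1 i + x.2.1 i) + deg x.2.2)
      (fun x => xi (N + 2 * r) r (by omega) s (∑ i, (x.1 i + x.2.1 i) + deg x.2.2) x.1 x.2.1
        (iotaPow N s r (Ξ x.2.2)))
  | 0 => by
    refine (H.reindex ((Equiv.uniqueProd ((Fin 0 → ℕ) × I) (Fin 0 → ℕ)).trans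
      (Equiv.uniqueProd I (Fin 0 → ℕ)))).congr (fun x => ?_) (fun x => ?_)
    · simp
    · exact one_mul _
  | r + 1 => by
    have hdeg : ∀ x : (Fin (r + 1) → ℕ) × (Fin (r + 1) → ℕ) × I,
        ∑ i, (x.1 i + x.2.1 i) + deg x.2.2 = x.1 0 + x.2.1 0 +
          (∑ i, (Fin.tail x.1 i + Fin.tail x.2.1 i) + deg x.2.2) := by
      intro x
      rw [Fin.sum_univ_succ, add_assoc]
      rfl
    refine (((chain H hN r).step (by omega)).reindex (splitFirst r I)).congr hdeg (fun x => ?_)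
    · rw [hdeg]
      refine (xi_succ (N + 2 * r) r (by omega) s _ _ _ _ _).trans ?_
      rw [Nat.add_sub_cancel_left]
      rfl

theorem one : HarmonicSystem 1 s (fun σ : Fin 2 => (σ : ℕ)) (fun σ => gen 1 s 0 ^ (σ : ℕ)) where
  hom σ := by simpa using (Hom.gen (s := s) (0 : Fin 1)).pow (σ : ℕ)
  low σ := by
    rw [lower_one_pow]
    fin_cases σ <;> simp [qBracket]
  li := by
    have h := (pbw 1 s).linearIndependent.comp (fun σ : Fin 2 => fun _ => (σ : ℕ)) (by
      intro σ τ h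
      exact Fin.val_injective (congrFun h 0))
    convert h using 1
    funext σ
    rw [Function.comp_apply, pbw_apply, mono_one]
  span p := by
    induction p using one_induction with
    | h c m =>
      refine Submodule.smul_mem _ _ (Submodule.subset_span ⟨(m / 2, ⟨m % 2, by omega⟩), ?_⟩)
      dsimp only
      rw [qRadius_one_zero, ← pow_mul, ← pow_add, Nat.div_add_mod]
    | ha x y hx hy => exact Submodule.add_mem _ hx hy
  orth c hc σ τ h := by
    have h1 : conj 1 hc (gen 1 s 0) = gen 1 s 0 := by
      rw [conj_gen]
      simp [rho2]
    rw [conj_pow, h1, ← pow_add, numFun_one_pow, if_neg]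
    have := Fin.val_ne_of_ne h
    rw [Nat.even_iff]
    omega

/-- Here Q is a multiple of x_1 x_2, so modulo Q only pure powers remain. Opposite powers of equal
degree are orthogonal because the star turns one into the same generator as the other, and the
functional vanishes on positive pure powers. -/
theorem two : HarmonicSystem (0 + 2) s Int.natAbs
    (fun k => tri k.toNat (1 : QSpace 0 s) (-k).toNat) := by
  have hhom : ∀ k : ℤ, Hom k.natAbs (tri k.toNat (1 : QSpace 0 s) (-k).toNat) := by
    intro k
    have h := (Hom.one (N := 0) (s := s)).tri k.toNat (-k).toNat
    rwa [show k.toNat + 0 + (-k).toNat = k.natAbs by omega] at h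
  have hlow : ∀ k : ℤ, lower (0 + 2) s (tri k.toNat (1 : QSpace 0 s) (-k).toNat) = 0 := by
    intro k
    have h : k.toNat = 0 ∨ (-k).toNat = 0 := by omega
    rw [lower_tri, QEuclid.lower_zero, tri_zero, smul_zero, add_zero]
    rcases h with h | h <;> rw [h, mul_zero, br_zero] <;> simp
  refine ⟨hhom, hlow, ?_, ?_, ?_⟩
  · have h := (pbw (0 + 2) s).linearIndependent.comp (fun k : ℤ =>
      outerIndex k.toNat (fun _ : Fin 0 => 0) (-k).toNat) (by
        intro k l h
        have h1 := congrFun h 0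
        have h2 := congrFun h (Fin.last _)
        simp only [outerIndex_zero, outerIndex_last] at h1 h2
        omega)
    convert h using 1
    funext k
    rw [Function.comp_apply, pbw_apply, mono_outerIndex, mono_zero]
  · intro p
    have hQ0 : qRadius 0 s 0 = 0 := by simp [qRadius]
    have key : ∀ a b : ℕ, (tri a (1 : QSpace 0 s) b : QSpace (0 + 2) s) ∈ Submodule.span ℂ
        (Set.range fun x : ℕ × ℤ =>
          qRadius (0 + 2) s 0 ^ x.1 * tri x.2.toNat (1 : QSpace 0 s) (-x.2).toNat) := by
      intro a
      induction a with
      | zero =>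
        refine fun b => Submodule.subset_span ⟨(0, -(b : ℤ)), ?_⟩
        dsimp only
        rw [pow_zero, one_mul, show (-(b : ℤ)).toNat = 0 by omega,
          show (- -(b : ℤ)).toNat = b by omega]
      | succ a ih =>
        rintro (_ | b)
        · refine Submodule.subset_span ⟨(0, ((a + 1 : ℕ) : ℤ)), ?_⟩
          dsimp only
          rw [pow_zero, one_mul, show (-((a + 1 : ℕ) : ℤ)).toNat = 0 by omega, Int.toNat_natCast]
        · rw [tri_succ_succ Hom.one, hQ0, zero_mul, tri_zero, smul_zero, add_zero]
          exact Submodule.smul_mem _ _ (qRadius_mul_mem_span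
            (Ξ := fun k : ℤ => tri k.toNat (1 : QSpace 0 s) (-k).toNat) (ih b))
    induction p using tri_induction with
    | ht a y b =>
      induction y using zero_induction with
      | h c => rw [tri_smul]; exact Submodule.smul_mem _ _ (key a b)
    | ha x y hx hy => exact Submodule.add_mem _ hx hy
  · intro c hc k l hkl
    by_cases hd : k.natAbs = l.natAbs
    · obtain rfl : l = -k := by omega
      rw [conj_tri, conj_one, smul_mul_assoc, map_smul, neg_neg]
      rcases lt_trichotomy k 0 with h | h | h
      · rw [show k.toNat = 0 by omega, numFun_left_mul_left, if_neg (by omega), smul_zero]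
      · omega
      · rw [show (-k).toNat = 0 by omega, numFun_right_mul_right, if_neg (by omega), smul_zero]
    · refine numFun_mul_eq_zero hd ((hhom k).conj hc) (hhom l) ?_ (hlow l)
      rw [lower_conj, hlow, conj_zero]

end HarmonicSystem

end Chain

end QEuclid
end

/-! ### Normalizing the functional and descending to the sphere -/

noncomputable section
namespace QEuclid

open Finset

section Functional

variable {N : ℕ} {s : ℂ}

/-- Identifies the number u in the denominator of the functional as half the degree. -/
theorem sum_eq_two_mul {ν : Fin N → ℕ} (h : ∀ i, ν i = ν i.rev)
    (hm : ∀ i : Fin N, i = i.rev → Even (ν i)) :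
    ∑ i, ν i = 2 * ((∑ i : Fin N with i < i.rev, ν i) + halfMid ν) := by
  have h1 : ∑ i : Fin N with i.rev < i, ν i = ∑ i : Fin N with i < i.rev, ν i := by
    refine Finset.sum_nbij' Fin.rev Fin.rev ?_ ?_ ?_ ?_ ?_ <;> simp [← h]
  have h2 : 2 * halfMid ν = ∑ i : Fin N with i = i.rev, ν i := by
    rw [halfMid]
    refine Nat.mul_div_cancel' ?_
    exact Finset.dvd_sum fun i hi => (hm i (Finset.mem_filter.mp hi).2).two_dvd
  have h3 : ∑ i, ν i = ∑ i : Fin N with i < i.rev, ν i + ∑ i : Fin N with i = i.rev, ν i +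
      ∑ i : Fin N with i.rev < i, ν i := by
    rw [Finset.sum_filter, Finset.sum_filter, Finset.sum_filter, ← Finset.sum_add_distrib,
      ← Finset.sum_add_distrib]
    refine Finset.sum_congr rfl fun i _ => ?_
    rcases lt_trichotomy i i.rev with h | h | h
    · rw [if_pos h, if_neg h.ne, if_neg h.not_gt]; rfl
    · rw [if_neg (fun e => e.ne h), if_pos h, if_neg (fun e => e.ne h.symm), zero_add, add_zero]
    · rw [if_neg h.not_gt, if_neg h.ne', if_pos h, zero_add, zero_add]
  rw [h3, h1, ← h2]
  ring

/-- The degree-dependent denominator of the values of the invariant functional. -/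
def haarDen (N : ℕ) (s : ℂ) (u : ℕ) : ℂ :=
  (1 + (s ^ 2) ^ ((N : ℤ) - 2)) ^ u * qPoch ((s ^ 2) ^ (-(N : ℤ))) ((s ^ 2) ^ (-2 : ℤ)) u

theorem haarValue_eq (ν : Fin N → ℕ) :
    haarValue N s ν = haarNum N s ν / haarDen N s ((∑ i, ν i) / 2) := by
  rw [haarValue, haarNum]
  split_ifs with h
  · rw [sum_eq_two_mul h.1 h.2, Nat.mul_div_cancel_left _ two_pos, haarDen, div_div]
    congr 1
    ring
  · rw [zero_div]

theorem haarNum_of_odd {ν : Fin N → ℕ} (h : ¬ Even (∑ i, ν i)) : haarNum N s ν = 0 := by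
  rw [haarNum, if_neg]
  rintro ⟨h1, h2⟩
  rw [sum_eq_two_mul h1 h2] at h
  exact h (even_two_mul _)

variable [Generic s]

/-- The ratio of consecutive denominators is exactly the scalar by which Q multiplies the
unnormalized functional in degree 2u. -/
theorem haarDen_succ (N u : ℕ) : haarDen N s (u + 1) = haarDen N s u *
    ((1 + (s ^ N * (s ^ 2)⁻¹) ^ 2) * (1 - ((s ^ N) ^ 2)⁻¹ * ((s ^ 2) ^ (2 * u))⁻¹)) := by
  have hq := qsq_ne_zero (s := s)
  have h1 : (s ^ 2) ^ ((N : ℤ) - 2) = (s ^ N * (s ^ 2)⁻¹) ^ 2 := by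
    rw [zpow_sub₀ hq, zpow_natCast, ← pow_mul, mul_comm 2 N, pow_mul, mul_pow, inv_pow,
      div_eq_mul_inv]
    norm_cast
  have h2 : (s ^ 2) ^ (-(N : ℤ)) * ((s ^ 2) ^ (-2 : ℤ)) ^ u =
      ((s ^ N) ^ 2)⁻¹ * ((s ^ 2) ^ (2 * u))⁻¹ := by
    rw [zpow_neg, zpow_natCast, ← pow_mul s 2 N, mul_comm 2 N, pow_mul s N 2, zpow_neg, inv_pow,
      pow_mul _ 2 u]
    norm_cast
  rw [haarDen, haarDen, qPoch_succ, h2, h1, pow_succ]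
  ring

theorem one_add_qsq_zpow_ne_zero (k : ℤ) : 1 + (s ^ 2) ^ k ≠ 0 := by
  have h := Generic.zpow_add_ne_zero s 0 (2 * k)
  rw [zpow_zero, zpow_mul] at h
  exact_mod_cast h

theorem laplaceFactor_ne_zero (N : ℕ) : laplaceFactor N s ≠ 0 :=
  mul_ne_zero (inv_ne_zero qsq_ne_zero) (one_add_qsq_zpow_ne_zero _)

theorem haarDen_ne_zero (hN : 0 < N) (u : ℕ) : haarDen N s u ≠ 0 := by
  induction u with
  | zero => simp [haarDen, qPoch]
  | succ u ih =>
    have h0 : s ≠ 0 := Generic.ne_zero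
    rw [haarDen_succ]
    refine mul_ne_zero ih (mul_ne_zero ?_ ?_)
    · have h := Generic.zpow_add_ne_zero s 0 (2 * N - 4)
      rw [zpow_zero, zpow_sub₀ h0, mul_comm, zpow_mul, zpow_natCast] at h
      rw [mul_pow, inv_pow, ← pow_mul s 2 2]
      exact_mod_cast h
    · rw [← mul_inv, ← pow_mul, ← pow_mul, ← pow_add, sub_ne_zero]
      have h := Generic.zpow_ne_one s (k := ((N * 2 + 2 * (2 * u) : ℕ) : ℤ))
        (by exact_mod_cast (by omega : N * 2 + 2 * (2 * u) ≠ 0))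
      rw [zpow_natCast] at h
      exact fun e => h (inv_eq_one.mp e.symm)

/-- The invariant functional as a functional on the quantum Euclidean space. -/
def haarFun (N : ℕ) (s : ℂ) [Generic s] : QSpace N s →ₗ[ℂ] ℂ :=
  (pbw N s).constr ℂ (haarValue N s)

theorem haarFun_of_hom {d : ℕ} {p : QSpace N s} (hp : Hom d p) :
    haarFun N s p = (haarDen N s (d / 2))⁻¹ * numFun N s p := by
  have h : haarFun N s ∘ₗ proj d = (haarDen N s (d / 2))⁻¹ • (numFun N s ∘ₗ proj d) := by
    refine (pbw N s).ext fun ν => ?_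
    rw [pbw_apply, LinearMap.smul_apply, LinearMap.comp_apply, LinearMap.comp_apply, proj_mono]
    split_ifs with h
    · rw [haarFun, constr_mono, numFun_mono, haarValue_eq, h, smul_eq_mul, div_eq_inv_mul]
    · rw [map_zero, map_zero, smul_zero]
  have h2 := LinearMap.congr_fun h p
  rwa [LinearMap.smul_apply, LinearMap.comp_apply, LinearMap.comp_apply, hp.proj_self] at h2

theorem numFun_of_odd {d : ℕ} (hd : ¬ Even d) {p : QSpace N s} (hp : Hom d p) :
    numFun N s p = 0 := by
  have h : numFun N s ∘ₗ proj d = 0 := by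
    refine (pbw N s).ext fun ν => ?_
    rw [pbw_apply, LinearMap.comp_apply, proj_mono]
    split_ifs with h
    · rw [numFun_mono, haarNum_of_odd (by rwa [h]), LinearMap.zero_apply]
    · rw [map_zero, LinearMap.zero_apply]
  have h2 := LinearMap.congr_fun h p
  rwa [LinearMap.comp_apply, hp.proj_self] at h2

/-- The normalization compensates the scalar produced by Q in even degrees; in odd degrees both
sides vanish. -/
theorem haarFun_qRadius_mul (hN : 0 < N) (p : QSpace N s) :
    haarFun N s (qRadius N s 0 * p) = haarFun N s p := by
  induction p using hom_induction with
  | h d p hp =>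
    rw [haarFun_of_hom ((Hom.qRadius 0).mul hp), haarFun_of_hom hp,
      numFun_qRadius_mul_of_scale (pow_ne_zero _ qsq_ne_zero) hp]
    by_cases hd : Even d
    · obtain ⟨u, rfl⟩ := hd.two_dvd
      rw [show (2 + 2 * u) / 2 = u + 1 by omega, Nat.mul_div_cancel_left _ two_pos, haarDen_succ]
      have h1 := haarDen_ne_zero (s := s) hN (u + 1)
      rw [haarDen_succ] at h1
      rw [mul_inv, mul_assoc, inv_mul_cancel_left₀ (right_ne_zero_of_mul h1)]
    · rw [numFun_of_odd hd hp, mul_zero, mul_zero, mul_zero]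
  | ha x y hx hy => rw [mul_add, map_add, hx, hy, map_add]

/-- By centrality the multiples of Q - 1 form a two-sided ideal, so the sphere algebra acts on the
quotient by it. The functional factors through this quotient and is evaluated on the image of 1
under the action. -/
theorem exists_sphere_functional (f : QSpace N s →ₗ[ℂ] ℂ)
    (hf : ∀ p, f (qRadius N s 0 * p) = f p) :
    ∃ h : QSphere N s →ₗ[ℂ] ℂ, ∀ p, h (restrict N s p) = f p := by
  let I : Submodule ℂ (QSpace N s) :=
    LinearMap.range (LinearMap.mulLeft ℂ (qRadius N s 0) - LinearMap.id)
  have hI : ∀ p, qRadius N s 0 * p - p ∈ I := fun p => ⟨p, rfl⟩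
  have hmul : ∀ p, I ≤ I.comap (LinearMap.mulLeft ℂ p) := by
    rintro p _ ⟨r, rfl⟩
    refine ⟨p * r, ?_⟩
    simp only [LinearMap.sub_apply, LinearMap.mulLeft_apply, LinearMap.id_apply]
    rw [mul_sub, ← mul_assoc, ← mul_assoc, (commute_qRadius N p).eq]
  let φ : QSpace N s →ₐ[ℂ] Module.End ℂ (QSpace N s ⧸ I) :=
    AlgHom.ofLinearMap
      { toFun := fun p => I.mapQ I (LinearMap.mulLeft ℂ p) (hmul p)
        map_add' := fun p r => by
          ext x
          simp [add_mul]
        map_smul' := fun z p => by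
          ext x
          simp }
      (by ext x; simp)
      (fun p r => by ext x; simp)
  have hφ : ∀ p r, φ p (I.mkQ r) = I.mkQ (p * r) := fun p r => rfl
  let ψ : QSphere N s →ₐ[ℂ] Module.End ℂ (QSpace N s ⧸ I) :=
    RingQuot.liftAlgHom ℂ ⟨φ, by
      rintro _ _ ⟨rfl, rfl⟩
      refine LinearMap.ext fun x => ?_
      obtain ⟨r, rfl⟩ := I.mkQ_surjective x
      rw [hφ, hφ, one_mul]
      exact (Submodule.Quotient.eq I).mpr (hI r)⟩
  have hψ : ∀ p, ψ (restrict N s p) = φ p := fun p => RingQuot.liftAlgHom_mkAlgHom_apply ..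
  let g : (QSpace N s ⧸ I) →ₗ[ℂ] ℂ := I.liftQ f (by
    rintro _ ⟨r, rfl⟩
    rw [LinearMap.mem_ker, LinearMap.sub_apply, map_sub, LinearMap.mulLeft_apply,
      LinearMap.id_apply, hf, sub_self])
  refine ⟨g ∘ₗ (LinearMap.applyₗ (I.mkQ 1)) ∘ₗ ψ.toLinearMap, fun p => ?_⟩
  simp only [LinearMap.comp_apply, LinearMap.applyₗ_apply_apply, AlgHom.toLinearMap_apply]
  rw [hψ, hφ, mul_one]
  exact I.liftQ_apply f p

theorem exists_invariantFunctional (hN : 0 < N) : ∃ h : QSphere N s →ₗ[ℂ] ℂ,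
    IsInvariantFunctional h ∧ ∀ p, h (restrict N s p) = haarFun N s p := by
  obtain ⟨h, hh⟩ := exists_sphere_functional (haarFun N s) (haarFun_qRadius_mul hN)
  exact ⟨h, fun ν => by rw [hh, haarFun, constr_mono], hh⟩

theorem mem_harmonic_iff {m : ℕ} {p : QSpace N s} :
    p ∈ harmonic (pbw N s) m ↔ Hom m p ∧ lower N s p = 0 := by
  rw [harmonic, Submodule.mem_inf, mem_homogeneous_iff, LinearMap.mem_ker]
  refine and_congr_right fun hp => ?_
  rw [laplace_eq, hp, map_smul, smul_eq_zero_iff_right (laplaceFactor_ne_zero N),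
    smul_eq_zero_iff_right (pow_ne_zero _ qsq_ne_zero)]

/-- The field `orth` holds for every ring endomorphism c of ℂ fixing s, so it covers the linear and
the conjugate-linear star together. -/
theorem HarmonicSystem.isOrthogonalBasis {I J : Type} {deg : I → ℕ} {Ξ : I → QSpace N s}
    (H : HarmonicSystem N s deg Ξ) (hN : 0 < N) {h : QSphere N s →ₗ[ℂ] ℂ}
    (hh : ∀ p, h (restrict N s p) = haarFun N s p) (m : ℕ) {f : J → I}
    (hf : Function.Injective f) (hdeg : ∀ i, deg i = m ↔ i ∈ Set.range f) :
    IsOrthogonalBasis Generic.ne_zero (pbw N s) h m fun j => Ξ (f j) := by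
  have hm : ∀ j, deg (f j) = m := fun j => (hdeg _).mpr ⟨j, rfl⟩
  have hli : LinearIndependent ℂ fun j => Ξ (f j) := H.li.comp f hf
  have hspan : Submodule.span ℂ (Set.range fun j => Ξ (f j)) = harmonic (pbw N s) m := by
    refine le_antisymm (Submodule.span_le.mpr ?_) fun p hp => ?_
    · rintro _ ⟨j, rfl⟩
      refine mem_harmonic_iff.mpr ⟨?_, H.low _⟩
      have := H.hom (f j)
      rwa [hm] at this
    · rw [mem_harmonic_iff] at hp
      refine Submodule.span_mono ?_ (H.mem_span_of_hom hN hp.1 hp.2)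
      rintro _ ⟨i, hi, rfl⟩
      obtain ⟨j, rfl⟩ := (hdeg i).mp hi
      exact ⟨j, rfl⟩
  have horth : ∀ (c : ℂ →+* ℂ) (hc : c s = s) (x y : J), x ≠ y →
      scalarProduct h c Generic.ne_zero hc (Ξ (f x)) (Ξ (f y)) = 0 := by
    intro c hc x y hxy
    have h1 := haarFun_of_hom (((H.hom (f x)).conj hc).mul (H.hom (f y)))
    rw [H.orth c hc _ _ (fun e => hxy (hf e)), mul_zero] at h1
    exact (hh _).trans h1
  refine ⟨⟨(Module.Basis.span hli).map (LinearEquiv.ofEq _ _ hspan), fun x => ?_⟩,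
    fun x y => horth _ rfl x y, fun hc x y => horth _ hc x y⟩
  rw [Module.Basis.map_apply, LinearEquiv.coe_ofEq_apply, Module.Basis.span_apply]

end Functional

end QEuclid
end

/-! ### The two families of the theorem -/

noncomputable section
namespace QEuclid

open Finset

section Main

variable {s : ℂ} [Generic s]

theorem harmonicSystem_odd (n N : ℕ) (hN : N = 1 + 2 * n) (h1 : 2 * n ≤ N) (h2 : n < N) :
    HarmonicSystem N s
      (fun x : (Fin n → ℕ) × (Fin n → ℕ) × Fin 2 => ∑ i, (x.1 i + x.2.1 i) + (x.2.2 : ℕ))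
      (fun x => xi N n h1 s (∑ i, (x.1 i + x.2.1 i) + (x.2.2 : ℕ)) x.1 x.2.1
        (gen N s ⟨n, h2⟩ ^ (x.2.2 : ℕ))) := by
  subst hN
  refine (HarmonicSystem.one.chain one_pos n).congr (fun _ => rfl) fun x => ?_
  rw [map_pow, iotaPow_gen]
  congr 3
  ext
  simp

theorem harmonicSystem_even (n N : ℕ) (hN : N = 0 + 2 + 2 * n) (h1 : 2 * n ≤ N) (h2 : n < N)
    (h3 : n + 1 < N) : HarmonicSystem N s
      (fun x : (Fin n → ℕ) × (Fin n → ℕ) × ℤ => ∑ i, (x.1 i + x.2.1 i) + x.2.2.natAbs)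
      (fun x => xi N n h1 s (∑ i, (x.1 i + x.2.1 i) + x.2.2.natAbs) x.1 x.2.1
        (gen N s ⟨n, h2⟩ ^ x.2.2.toNat * gen N s ⟨n + 1, h3⟩ ^ (-x.2.2).toNat)) := by
  subst hN
  refine (HarmonicSystem.two.chain two_pos n).congr (fun _ => rfl) fun x => ?_
  rw [tri, map_one, mul_one, map_mul, map_pow, map_pow, iotaPow_gen, iotaPow_gen]
  congr 4
  · ext
    simp
  · ext
    simp [add_comm]

end Main

end QEuclid
end

theorem theorem3 (s : ℂ) (hs : s ≠ 0) (hq : ∀ k : ℕ, 0 < k → (s ^ 2) ^ k ≠ 1) :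
    (∀ (n : ℕ) (hn : 1 ≤ n),
      ∃ B : Module.Basis (Fin (2 * n) → ℕ) ℂ (QEuclid.QSpace (2 * n) s),
        (∀ ν, B ν = QEuclid.mono (2 * n) s ν) ∧
        ∃ h : QEuclid.QSphere (2 * n) s →ₗ[ℂ] ℂ,
          QEuclid.IsInvariantFunctional h ∧
          ∀ m : ℕ, QEuclid.IsOrthogonalBasis hs B h m (QEuclid.xiEven n hn s m)) ∧
    (∀ n : ℕ,
      ∃ B : Module.Basis (Fin (2 * n + 1) → ℕ) ℂ (QEuclid.QSpace (2 * n + 1) s),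
        (∀ ν, B ν = QEuclid.mono (2 * n + 1) s ν) ∧
        ∃ h : QEuclid.QSphere (2 * n + 1) s →ₗ[ℂ] ℂ,
          QEuclid.IsInvariantFunctional h ∧
          ∀ m : ℕ, QEuclid.IsOrthogonalBasis hs B h m (QEuclid.xiOdd n s m)) := by
  have : QEuclid.Generic s := ⟨hs, hq⟩
  refine ⟨fun n hn => ⟨QEuclid.pbw _ s, QEuclid.pbw_apply, ?_⟩,
    fun n => ⟨QEuclid.pbw _ s, QEuclid.pbw_apply, ?_⟩⟩
  · obtain ⟨h, hh, hres⟩ := QEuclid.exists_invariantFunctional (N := 2 * n) (s := s) (by omega)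
    refine ⟨h, hh, fun m => ?_⟩
    have H := (QEuclid.harmonicSystem_even (s := s) (n - 1) (2 * n) (by omega) (by omega)
      (by omega) (by omega)).isOrthogonalBasis (by omega) hres m
      (f := fun x : QEuclid.EvenIndex n m => x.1) Subtype.val_injective
      (fun i => ⟨fun hi => ⟨⟨i, hi⟩, rfl⟩, by rintro ⟨x, rfl⟩; exact x.2⟩)
    convert H using 1
    funext x
    rw [x.2, QEuclid.xi, QEuclid.xiEven]
    congr 1
    rw [QEuclid.tTwo]
    have hidx : (⟨n - 1 + 1, by omega⟩ : Fin (2 * n)) = ⟨n, by omega⟩ :=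
      Fin.ext (Nat.sub_add_cancel hn)
    rw [hidx]
    -- The system uses the product of the powers with exponents max(k, 0) and max(-k, 0). At most
    -- one is nontrivial, which gives the three cases of `tTwo`.
    split_ifs with h1 h2
    · rw [show (-x.1.2.2).toNat = 0 by omega, pow_zero, mul_one,
        show x.1.2.2.toNat = x.1.2.2.natAbs by omega]
    · rw [h2]
      simp
    · rw [show x.1.2.2.toNat = 0 by omega, pow_zero, one_mul,
        show (-x.1.2.2).toNat = x.1.2.2.natAbs by omega]
  · obtain ⟨h, hh, hres⟩ := QEuclid.exists_invariantFunctional (N := 2 * n + 1) (s := s) (by omega)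
    refine ⟨h, hh, fun m => ?_⟩
    have H := (QEuclid.harmonicSystem_odd (s := s) n (2 * n + 1) (by omega) (by omega)
      (by omega)).isOrthogonalBasis (by omega) hres m
      (f := fun x : QEuclid.OddIndex n m => x.1) Subtype.val_injective
      (fun i => ⟨fun hi => ⟨⟨i, hi⟩, rfl⟩, by rintro ⟨x, rfl⟩; exact x.2⟩)
    convert H using 1
    funext x
    rw [x.2]
    rfl
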